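/- Let $(M,g)$ be a globally hyperbolic, time-oriented Lorentzian manifold of signature $(+,-,\dots,-)$ with volume measure $d\mu_g$, let $P=\Box_g+V$ with $V\in C^\infty(M,\mathbb R)$, let $E^{\pm}$ be the retarded ($+$) and advanced ($-$) Green operators of $P$ on $\mathcal D(M)=C_c^\infty(M,\mathbb C)$, i.e. $PE^\pm f=f=E^\pm Pf$ and $\operatorname{supp}E^\pm f\subset J^\pm(\operatorname{supp}f)$, and let $E(f,h)=\int_M f\,(E^-h-E^+h)\,d\mu_g$. A *Hadamard function* is a distribution $W$ on $M\times M$ such that - $W=\tfrac i2E+H$ with a real distribution $H$ on $M\times M$; - $W(\bar f\otimes f)\ge 0$ for all $f\in\mathcal D(M)$; - $W(Pf\otimes h)=0=W(f\otimes Ph)$ for all $f,h\in\mathcal D(M)$; - $\mathrm{WF}(W)$ is the set of all $(x,k;x',-k')$ such that $k$ is a nonzero null covector in the closed forward light cone at $x$ and $(x,k)\sim(x',k')$, i.e. $x,x'$ lie on a null geodesic to which $k$ is cotangent at $x$ and along which $k'$ is the parallel transport of $k$ (with $x=x'$, $k=k'$ allowed). Here the wave front set is taken with the Fourier convention $\hat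 u(k)=\int u(x)e^{i\langle k,x\rangle}dx$. Let $\mathcal F_{\rm pol}(M)$ be the space of regular polynomials, i.e. of functionals on $C^\infty(M,\mathbb R)$ of the form $$F(\varphi)=F_0+\sum_{k=1}^N\int_{M^k}f_k(x_1,\dots,x_k)\,\varphi(x_1)\cdots\varphi(x_k)\,d\mu_g(x_1)\cdots d\mu_g(x_k),\qquad F_0\in\mathbb C,\ f_k\in C_c^\infty(M^k,\mathbb C),$$ with involution $F^*(\varphi)=\overline{F(\varphi)}$, and for a Hadamard function $W$ put $$(F\star_HG)(\varphi)=\sum_{n\ge0}\frac1{n!}\big\langle W^{\otimes n},F^{(n)}(\varphi)\otimes G^{(n)}(\varphi)\big\rangle ,$$ where $F^{(n)}(\varphi)\in C_c^\infty(M^n,\mathbb C)$ is the integral kernel of the $n$-th functional derivative. Let $\Phi_f(\varphi)=\int_M f\varphi\,d\mu_g$ for $f\in\mathcal D(M)$. **Proposition.** The product $\star_H$ maps $\mathcal F_{\rm pol}(M)\times\mathcal F_{\rm pol}(M)$ to $\mathcal F_{\rm pol}(M)$, and evaluation at zero, $\omega_0(F)=F(0)$, is a quasi-free Hadamard state on $\mathfrak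 A_H(M)=(\mathcal F_{\rm pol}(M),\star_H)$ with two-point function $W$. That is: $\omega_0$ is linear, $\omega_0(1)=1$ and $\omega_0(F^*\star_HF)\ge0$ for all $F$; $\omega_0(\Phi_f\star_H\Phi_h)=W(f\otimes h)$ for all $f,h\in\mathcal D(M)$, so that the two-point function of $\omega_0$ is a Hadamard function; and for all $m\ge0$ and $f_1,\dots,f_m\in\mathcal D(M)$, $$\omega_0(\Phi_{f_1}\star_H\cdots\star_H\Phi_{f_m})=\sum_{\pi}\ \prod_{\{i<j\}\in\pi}W(f_i\otimes f_j),$$ the sum being over all partitions $\pi$ of $\{1,\dots,m\}$ into pairs (so the left-hand side vanishes for odd $m$). -/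

import Mathlib

open scoped Manifold ContDiff Topology ComplexOrder
open MeasureTheory Set

noncomputable section

namespace ScalarQFT

/-! ## Test functions, distributions and wave front sets on manifolds (without boundary) -/

section Distributions

variable {E H X : Type*} [NormedAddCommGroup E] [NormedSpace ℝ E] [TopologicalSpace H]
  [TopologicalSpace X] [ChartedSpace H X]

/-- The space of complex-valued smooth compactly supported functions on `X`. -/
def TestFn (I : ModelWithCorners ℝ E H) (X : Type*) [TopologicalSpace X] [ChartedSpace H X] :
    Submodule ℂ (X → ℂ) where
  carrier := {f | ContMDiff I 𝓘(ℝ, ℂ) ∞ f ∧ HasCompactSupport f}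
  zero_mem' := ⟨contMDiff_const, HasCompactSupport.zero⟩
  add_mem' hf hg := ⟨hf.1.add hg.1, hf.2.add hg.2⟩
  smul_mem' c _ hf := ⟨(contDiff_const_smul c).contMDiff.comp hf.1, hf.2.comp_left (smul_zero c)⟩

/-- A distribution on `X`: a linear functional on test functions which, on the test functions
supported in a given compact subset `K` of a chart domain, is bounded by finitely many derivatives
in that chart. (If the derivatives of order `≤ N` are bounded by `B` on `K`, then
`|T f| ≤ C B`.) -/
structure Distr (I : ModelWithCorners ℝ E H) (X : Type*) [TopologicalSpace X]
    [ChartedSpace H X] where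
  /-- the underlying linear functional -/
  toLinear : TestFn I X →ₗ[ℂ] ℂ
  bound : ∀ (x : X) (K : Set X), IsCompact K → K ⊆ (chartAt H x).source →
    ∃ (N : ℕ) (C : ℝ), ∀ f : TestFn I X, tsupport (f : X → ℂ) ⊆ K → ∀ B : ℝ,
      (∀ k ≤ N, ∀ y ∈ K, ‖iteratedFDeriv ℝ k ((f : X → ℂ) ∘ (extChartAt I x).symm)
        (extChartAt I x y)‖ ≤ B) →
      ‖toLinear f‖ ≤ C * B

open Classical in
/-- Evaluation of a distribution on a function `f`, meaningful if `f` is a test function. -/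
def Distr.eval {I : ModelWithCorners ℝ E H} (T : Distr I X) (f : X → ℂ) : ℂ :=
  if h : f ∈ TestFn I X then T.toLinear ⟨f, h⟩ else 0

/-- Complex conjugate of a test function. -/
def testConj {I : ModelWithCorners ℝ E H} (f : TestFn I X) : TestFn I X :=
  ⟨fun x => (starRingEnd ℂ) ((f : X → ℂ) x),
    Complex.conjCLE.contDiff.contMDiff.comp f.2.1,
    f.2.2.comp_left (map_zero _)⟩

/-- The tensor product `(f ⊗ g)(x, y) = f x * g y` of two test functions. -/
def tensor {I : ModelWithCorners ℝ E H} (f g : TestFn I X) : TestFn (I.prod I) (X × X) :=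
  ⟨fun p => (f : X → ℂ) p.1 * (g : X → ℂ) p.2, by
    have hm : ContDiff ℝ ∞ (fun z : ℂ × ℂ => z.1 * z.2) := contDiff_fst.mul contDiff_snd
    refine ⟨hm.contMDiff.comp
      ((f.2.1.comp contMDiff_fst).prodMk_space (g.2.1.comp contMDiff_snd)), ?_⟩
    refine (f.2.2.prod g.2.2).of_isClosed_subset (isClosed_tsupport _) (closure_minimal ?_
      ((isClosed_tsupport _).prod (isClosed_tsupport _)))
    intro p hp
    have h := Function.mem_support.1 hp
    exact ⟨subset_tsupport _ (left_ne_zero_of_mul h), subset_tsupport _ (right_ne_zero_of_mul h)⟩⟩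

/-- `χ(y) e^{i ⟨η, κ(y)⟩}` where `κ` is the preferred chart at `x`. -/
def oscFun (I : ModelWithCorners ℝ E H) (x : X) (χ : X → ℂ) (η : E →L[ℝ] ℝ) : X → ℂ :=
  fun y => χ y * Complex.exp (Complex.I * (η (extChartAt I x y) : ℂ))

theorem oscFun_mem {I : ModelWithCorners ℝ E H} [IsManifold I ∞ X] (x : X) (χ : TestFn I X)
    (hχ : tsupport (χ : X → ℂ) ⊆ (chartAt H x).source) (η : E →L[ℝ] ℝ) :
    oscFun I x χ η ∈ TestFn I X := by
  refine ⟨?_, χ.2.2.mul_right⟩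
  refine contMDiff_of_tsupport ?_
  intro y hy
  have hy' : y ∈ (chartAt H x).source := hχ (tsupport_mul_subset_left hy)
  have h1 : ContMDiffAt I 𝓘(ℝ, E) ∞ (extChartAt I x) y := contMDiffAt_extChartAt' hy'
  have h2 : ContDiff ℝ ∞ (fun v : E => Complex.exp (Complex.I * (η v : ℂ))) :=
    (contDiff_const.mul (Complex.ofRealCLM.contDiff.comp η.contDiff)).cexp
  have hm : ContDiff ℝ ∞ (fun z : ℂ × ℂ => z.1 * z.2) := contDiff_fst.mul contDiff_snd
  exact hm.contMDiff.contMDiffAt.comp y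
    ((χ.2.1 y).prodMk_space (h2.contMDiff.contMDiffAt.comp y h1))

/-- A distribution `T` is microlocally regular at the covector `ξ ∈ T*_x X` if, for some cutoff `χ`
with `χ x ≠ 0` supported in the domain of the preferred chart at `x`, the localized Fourier
transform `η ↦ ⟨T, χ e^{i ⟨η, ·⟩}⟩` decays rapidly in an open cone around `ξ`.
The tangent space at `x` is, as everywhere in Mathlib, identified with the model space through the
preferred chart at `x`. The Fourier transform is taken with the convention `e^{+ i ⟨η, x⟩}`. -/
def MicroRegular {I : ModelWithCorners ℝ E H} (T : Distr I X) (x : X) (ξ : E →L[ℝ] ℝ) : Prop :=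
  ∃ χ : TestFn I X, (χ : X → ℂ) x ≠ 0 ∧ tsupport (χ : X → ℂ) ⊆ (chartAt H x).source ∧
    ∃ Γ : Set (E →L[ℝ] ℝ), IsOpen Γ ∧ ξ ∈ Γ ∧ (∀ η ∈ Γ, ∀ t : ℝ, 0 < t → t • η ∈ Γ) ∧
      ∀ N : ℕ, ∃ C : ℝ, ∀ η ∈ Γ, (1 + ‖η‖) ^ N * ‖T.eval (oscFun I x χ η)‖ ≤ C

/-- The wave front set of `T`, a set of nonzero covectors `(x, ξ)`. -/
def waveFrontSet {I : ModelWithCorners ℝ E H} (T : Distr I X) : Set (X × (E →L[ℝ] ℝ)) :=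
  {p | p.2 ≠ 0 ∧ ¬ MicroRegular T p.1 p.2}

end Distributions

/-! ## Lorentzian geometry -/

/-- The model space of `d`-dimensional spacetimes. -/
abbrev Coord (d : ℕ) := EuclideanSpace ℝ (Fin d)

section Geometry

variable {d : ℕ} {M : Type*} [TopologicalSpace M] [ChartedSpace (Coord d) M]
  [IsManifold 𝓘(ℝ, Coord d) ∞ M]

/-- A smooth Lorentzian metric of signature `(+, -, …, -)` together with a time orientation, given
by a smooth timelike vector field. -/
structure Spacetime (d : ℕ) (M : Type*) [TopologicalSpace M] [ChartedSpace (Coord d) M]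
    [IsManifold 𝓘(ℝ, Coord d) ∞ M] where
  /-- the metric tensor -/
  metric : ∀ x : M, TangentSpace 𝓘(ℝ, Coord d) x →L[ℝ] TangentSpace 𝓘(ℝ, Coord d) x →L[ℝ] ℝ
  metric_symm : ∀ x v w, metric x v w = metric x w v
  metric_smooth : ContMDiff 𝓘(ℝ, Coord d)
    (𝓘(ℝ, Coord d).prod 𝓘(ℝ, Coord d →L[ℝ] Coord d →L[ℝ] ℝ)) ∞
    (fun x : M => Bundle.TotalSpace.mk' (Coord d →L[ℝ] Coord d →L[ℝ] ℝ)
      (E := fun x : M => TangentSpace 𝓘(ℝ, Coord d) x →L[ℝ] TangentSpace 𝓘(ℝ, Coord d) x →L[ℝ] ℝ)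
      x (metric x))
  metric_lorentzian : ∀ x v w, 0 < metric x v v → metric x v w = 0 → w ≠ 0 → metric x w w < 0
  /-- the time orientation -/
  timeDir : ∀ x : M, TangentSpace 𝓘(ℝ, Coord d) x
  timeDir_smooth : ContMDiff 𝓘(ℝ, Coord d) 𝓘(ℝ, Coord d).tangent ∞
    (fun x : M => (⟨x, timeDir x⟩ : TangentBundle 𝓘(ℝ, Coord d) M))
  timeDir_timelike : ∀ x, 0 < metric x (timeDir x) (timeDir x)

namespace Spacetime

variable (S : Spacetime d M)

/-- Future-directed causal (timelike or null, nonzero) tangent vectors. -/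
def FutureCausal (x : M) (v : TangentSpace 𝓘(ℝ, Coord d) x) : Prop :=
  v ≠ 0 ∧ 0 ≤ S.metric x v v ∧ 0 < S.metric x v (S.timeDir x)

/-- The velocity of a curve. -/
def velocity (γ : ℝ → M) (s : ℝ) : TangentSpace 𝓘(ℝ, Coord d) (γ s) :=
  mfderiv 𝓘(ℝ, ℝ) 𝓘(ℝ, Coord d) γ s (1 : ℝ)

/-- There is a smooth future-directed causal curve from `x` to `y`. -/
def CausalCurve (x y : M) : Prop :=
  ∃ γ : ℝ → M, ContMDiff 𝓘(ℝ, ℝ) 𝓘(ℝ, Coord d) ∞ γ ∧ γ 0 = x ∧ γ 1 = y ∧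
    ∀ s ∈ Icc (0 : ℝ) 1, S.FutureCausal (γ s) (velocity γ s)

/-- `y ∈ J⁺(x)`: `x = y`, or there is a piecewise smooth future-directed causal curve
from `x` to `y`. -/
def Precedes (x y : M) : Prop := Relation.ReflTransGen S.CausalCurve x y

/-- The causal future of a set. -/
def futureOf (A : Set M) : Set M := {y | ∃ x ∈ A, S.Precedes x y}

/-- The causal past of a set. -/
def pastOf (A : Set M) : Set M := {y | ∃ x ∈ A, S.Precedes y x}

/-- Global hyperbolicity: there are no closed (piecewise smooth) causal curves, and all causal
diamonds `J⁺(p) ∩ J⁻(q)` are compact. -/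
def GloballyHyperbolic : Prop :=
  (∀ x, ¬ Relation.TransGen S.CausalCurve x x) ∧
    ∀ p q, IsCompact {r | S.Precedes p r ∧ S.Precedes r q}

/-- The metric at the point with coordinates `y` in the preferred chart at `x`, on coordinate
vectors. -/
def coordMetric (x : M) (y v w : Coord d) : ℝ :=
  S.metric ((extChartAt 𝓘(ℝ, Coord d) x).symm y)
    (mfderiv 𝓘(ℝ, Coord d) 𝓘(ℝ, Coord d) (extChartAt 𝓘(ℝ, Coord d) x).symm y v)
    (mfderiv 𝓘(ℝ, Coord d) 𝓘(ℝ, Coord d) (extChartAt 𝓘(ℝ, Coord d) x).symm y w)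

/-- The matrix `g_{ij}` in the preferred chart at `x`. -/
def gram (x : M) (y : Coord d) : Matrix (Fin d) (Fin d) ℝ :=
  Matrix.of fun i j => S.coordMetric x y (EuclideanSpace.single i 1) (EuclideanSpace.single j 1)

/-- The density `√|det g_{ij}|` in the preferred chart at `x`. -/
def density (x : M) (y : Coord d) : ℝ := Real.sqrt |(S.gram x y).det|

/-- The measure `√|det g_{ij}| dy` on the domain of the preferred chart at `x`. -/
def chartVolume [MeasurableSpace M] (x : M) : Measure M :=
  (((volume : Measure (Coord d)).restrict (extChartAt 𝓘(ℝ, Coord d) x).target).withDensity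
    (fun y => ENNReal.ofReal (S.density x y))).map (extChartAt 𝓘(ℝ, Coord d) x).symm

/-- The invariant volume measure `dμ_g`. The measures `chartVolume x` agree on overlaps of chart
domains; their supremum is the measure on `M` obtained by gluing them. -/
def vol [MeasurableSpace M] : Measure M := ⨆ x : M, S.chartVolume x

/-- The d'Alembert operator `□ f = |g|^{-1/2} ∂_i (|g|^{1/2} g^{ij} ∂_j f)`; the value at `x` is
computed in the preferred chart at `x`. -/
def box (f : M → ℂ) (x : M) : ℂ :=
  ((S.density x (extChartAt 𝓘(ℝ, Coord d) x x))⁻¹ : ℝ) *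
    ∑ i : Fin d, fderiv ℝ (fun y : Coord d => ∑ j : Fin d,
      ((S.density x y * (S.gram x y)⁻¹ i j : ℝ) : ℂ) *
        fderiv ℝ (f ∘ (extChartAt 𝓘(ℝ, Coord d) x).symm) y (EuclideanSpace.single j 1))
      (extChartAt 𝓘(ℝ, Coord d) x x) (EuclideanSpace.single i 1)

/-- The curve `γ` satisfies the geodesic equation
`d/ds (g_{ij} γ'^j) = ½ (∂_i g_{jk}) γ'^j γ'^k` at the parameter `s`
(in the preferred chart at `γ s`). -/
def IsGeodesicAt (γ : ℝ → M) (s : ℝ) : Prop :=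
  ∀ w : Coord d,
    deriv (fun t => S.coordMetric (γ s) (extChartAt 𝓘(ℝ, Coord d) (γ s) (γ t))
      (deriv (fun r => extChartAt 𝓘(ℝ, Coord d) (γ s) (γ r)) t) w) s =
    (1 / 2) * fderiv ℝ (fun y => S.coordMetric (γ s) y
      (deriv (fun r => extChartAt 𝓘(ℝ, Coord d) (γ s) (γ r)) s)
      (deriv (fun r => extChartAt 𝓘(ℝ, Coord d) (γ s) (γ r)) s))
      (extChartAt 𝓘(ℝ, Coord d) (γ s) (γ s)) w

/-- The covector `k = g(γ'(s), ·)`. -/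
def momentum (γ : ℝ → M) (s : ℝ) : Coord d →L[ℝ] ℝ := S.metric (γ s) (velocity γ s)

/-- The set of all `(x, k; x', -k')` with `(x, k) ∼ (x', k')` and `k` in the closed forward
light cone: `x = γ 0` and `x' = γ b` lie on a null geodesic `γ` (with `b` of any sign, and `b = 0`
giving `x = x'`, `k = k'`) to which `k ≠ 0` is cotangent at `x`, and `k'` is the parallel transport
of `k` along `γ`. -/
def hadamardSet : Set ((M × M) × (Coord d × Coord d →L[ℝ] ℝ)) :=
  {p | ∃ (γ : ℝ → M) (b : ℝ), ContMDiff 𝓘(ℝ, ℝ) 𝓘(ℝ, Coord d) ∞ γ ∧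
    (∀ s ∈ uIcc 0 b, S.IsGeodesicAt γ s) ∧
    S.metric (γ 0) (velocity γ 0) (velocity γ 0) = 0 ∧ S.FutureCausal (γ 0) (velocity γ 0) ∧
    p = ((γ 0, γ b), (S.momentum γ 0).comp (ContinuousLinearMap.fst ℝ (Coord d) (Coord d)) -
      (S.momentum γ b).comp (ContinuousLinearMap.snd ℝ (Coord d) (Coord d)))}

end Spacetime

/-! ## Field operator, Green operators, Hadamard functions -/

/-- Real smooth functions on `M`; this is also the off-shell configuration space. -/
abbrev Config (d : ℕ) (M : Type*) [TopologicalSpace M] [ChartedSpace (Coord d) M] :=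
  ContMDiffMap 𝓘(ℝ, Coord d) 𝓘(ℝ, ℝ) M ℝ ∞

/-- Test functions on spacetime. -/
abbrev Test (d : ℕ) (M : Type*) [TopologicalSpace M] [ChartedSpace (Coord d) M] :=
  TestFn 𝓘(ℝ, Coord d) M

/-- Test functions on `Mⁿ`. -/
abbrev TestPow (d : ℕ) (M : Type*) [TopologicalSpace M] [ChartedSpace (Coord d) M] (n : ℕ) :=
  TestFn (ModelWithCorners.pi fun _ : Fin n => 𝓘(ℝ, Coord d)) (Fin n → M)

/-- Bi-distributions on spacetime. -/
abbrev BiDistr (d : ℕ) (M : Type*) [TopologicalSpace M] [ChartedSpace (Coord d) M] :=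
  Distr (𝓘(ℝ, Coord d).prod 𝓘(ℝ, Coord d)) (M × M)

/-- The field operator `P = □ + V`. -/
def fieldOp (S : Spacetime d M) (V : Config d M) (f : M → ℂ) (x : M) : ℂ :=
  S.box f x + (V x : ℂ) * f x

/-- `G` inverts `P = □ + V` on test functions, with `supp (G f)` contained in `J (supp f)`. -/
structure IsGreenOperator (S : Spacetime d M) (V : Config d M) (J : Set M → Set M)
    (G : Test d M →ₗ[ℂ] (M → ℂ)) : Prop where
  smooth : ∀ f, ContMDiff 𝓘(ℝ, Coord d) 𝓘(ℝ, ℂ) ∞ (G f)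
  right_inv : ∀ f : Test d M, fieldOp S V (G f) = f
  left_inv : ∀ f h : Test d M, (h : M → ℂ) = fieldOp S V f → G h = f
  supp : ∀ f : Test d M, tsupport (G f) ⊆ J (tsupport (f : M → ℂ))

/-- `E` is (the integral kernel of) the commutator function, i.e. advanced minus retarded Green
operator: `E(f, g) = ∫ f (E⁻ g - E⁺ g) dμ_g`. -/
def IsCommutatorFunction [MeasurableSpace M] (S : Spacetime d M) (V : Config d M)
    (E : Test d M → Test d M → ℂ) : Prop :=
  ∃ Gret Gadv : Test d M →ₗ[ℂ] (M → ℂ),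
    IsGreenOperator S V S.futureOf Gret ∧ IsGreenOperator S V S.pastOf Gadv ∧
    ∀ f g : Test d M, E f g = ∫ x, (f : M → ℂ) x * (Gadv g x - Gret g x) ∂S.vol

/-- `W` is a Hadamard function for `P = □ + V`. -/
structure IsHadamardFunction [MeasurableSpace M] (S : Spacetime d M) (V : Config d M)
    (W : BiDistr d M) : Prop where
  /-- `W = (i/2) E + H` with `E` the commutator function and `H` a real bi-distribution -/
  decomp : ∃ (E : Test d M → Test d M → ℂ) (H : BiDistr d M), IsCommutatorFunction S V E ∧
    (∀ F, H.toLinear (testConj F) = (starRingEnd ℂ) (H.toLinear F)) ∧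
    ∀ f g : Test d M, W.toLinear (tensor f g) =
      Complex.I / 2 * E f g + H.toLinear (tensor f g)
  /-- `W` is of positive type -/
  pos : ∀ f : Test d M, 0 ≤ W.toLinear (tensor (testConj f) f)
  /-- `W` solves the field equation in the first argument -/
  sol_left : ∀ f g h : Test d M, (h : M → ℂ) = fieldOp S V f → W.toLinear (tensor h g) = 0
  /-- `W` solves the field equation in the second argument -/
  sol_right : ∀ f g h : Test d M, (h : M → ℂ) = fieldOp S V g → W.toLinear (tensor f h) = 0
  /-- the microlocal spectrum condition -/
  wf : waveFrontSet W = S.hadamardSet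

/-! ## Functionals and the star product -/

section Functionals

variable [MeasurableSpace M] (S : Spacetime d M)

/-- The functional `φ ↦ ⟨φ^{⊗ k}, f⟩ = ∫_{M^k} f(x) φ(x₁) ⋯ φ(x_k) dμ_g(x₁) ⋯ dμ_g(x_k)`. -/
def monomial (k : ℕ) (f : TestPow d M k) (φ : Config d M) : ℂ :=
  ∫ x, (f : (Fin k → M) → ℂ) x * ∏ i, (φ (x i) : ℂ) ∂(Measure.pi fun _ : Fin k => S.vol)

/-- The regular polynomial functionals: finite sums of functionals `⟨φ^{⊗ k}, f_k⟩`
with `f_k` a test function on `M^k` (`k = 0` gives the constants). -/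
def regularPolynomials : Submodule ℂ (Config d M → ℂ) :=
  Submodule.span ℂ {F | ∃ (k : ℕ) (f : TestPow d M k), F = monomial S k f}

/-- The directional derivative `⟨F^{(1)}(φ), ψ⟩`. -/
def dirDeriv (F : Config d M → ℂ) (ψ φ : Config d M) : ℂ :=
  deriv (fun t : ℝ => F (φ + t • ψ)) 0

/-- The iterated directional derivative `⟨F^{(n)}(φ), ψ₁ ⊗ ⋯ ⊗ ψ_n⟩`. -/
def iterDeriv (F : Config d M → ℂ) : (n : ℕ) → (Fin n → Config d M) → Config d M → ℂ
  | 0, _ => F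
  | n + 1, ψ => dirDeriv (iterDeriv F n (Fin.tail ψ)) (ψ 0)

/-- `k` is the integral kernel of the functional derivative `F^{(n)}(φ)`. -/
def IsDerivKernel (F : Config d M → ℂ) (n : ℕ) (φ : Config d M) (k : TestPow d M n) : Prop :=
  ∀ ψ : Fin n → Config d M, iterDeriv F n ψ φ =
    ∫ x, (k : (Fin n → M) → ℂ) x * ∏ i, (ψ i (x i) : ℂ) ∂(Measure.pi fun _ : Fin n => S.vol)

open Classical in
/-- The integral kernel of `F^{(n)}(φ)`, a test function on `Mⁿ` if `F` is a regular polynomial. -/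
def derivKernel (F : Config d M → ℂ) (n : ℕ) (φ : Config d M) : TestPow d M n :=
  if h : ∃ k, IsDerivKernel S F n φ k then h.choose else 0

/-- The tensor power `W^{⊗ n}`, a distribution on `Mⁿ × Mⁿ` pairing the `i`-th variable of the first
factor with the `i`-th variable of the second one, evaluated on `c` by iterated pairing. -/
def tensorPow (W : BiDistr d M) : (n : ℕ) → ((Fin n → M) → (Fin n → M) → ℂ) → ℂ
  | 0, c => c ![] ![]
  | n + 1, c => W.eval fun p => tensorPow W n fun x y => c (Fin.cons p.1 x) (Fin.cons p.2 y)

/-- The star product `(F ⋆_H G)(φ) = ∑ₙ (1/n!) ⟨W^{⊗ n}, F^{(n)}(φ) ⊗ G^{(n)}(φ)⟩` (with `ħ = 1`). -/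
def starProd (W : BiDistr d M) (F G : Config d M → ℂ) (φ : Config d M) : ℂ :=
  ∑' n : ℕ, (1 / (n.factorial : ℂ)) * tensorPow W n fun x y =>
    (derivKernel S F n φ : (Fin n → M) → ℂ) x * (derivKernel S G n φ : (Fin n → M) → ℂ) y

end Functionals

end Geometry

/-! ## States -/

section States

variable {A : Type*} [AddCommGroup A] [Module ℂ A] [Mul A] [One A] [Star A]

/-- A state: a linear functional with `Ω(1) = 1` and `Ω(a* a) ≥ 0` for all `a`. -/
def IsState (Ω : A →ₗ[ℂ] ℂ) : Prop := Ω 1 = 1 ∧ ∀ a : A, 0 ≤ Ω (star a * a)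

/-- The pairings of `{1, …, m}`, encoded as involutions without fixed points. -/
def pairings (m : ℕ) : Finset (Equiv.Perm (Fin m)) :=
  Finset.univ.filter fun σ => ∀ i, σ (σ i) = i ∧ σ i ≠ i

/-- `Ω` is quasi-free with respect to the fields `Φ`: every `m`-point function is the sum over all
pairings of the product of the two-point functions of the pairs, ordered increasingly. In particular
the `m`-point functions with `m` odd vanish. -/
def IsQuasiFree {T : Type*} (Φ : T → A) (Ω : A →ₗ[ℂ] ℂ) : Prop :=
  ∀ (m : ℕ) (f : Fin m → T), Ω (List.ofFn fun i => Φ (f i)).prod =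
    ∑ σ ∈ pairings m, ∏ i ∈ Finset.univ.filter (fun i => i < σ i), Ω (Φ (f i) * Φ (f (σ i)))

end States

section Wick

variable {d : ℕ} {M : Type*} [TopologicalSpace M] [ChartedSpace (Coord d) M]
  [IsManifold 𝓘(ℝ, Coord d) ∞ M] [MeasurableSpace M]

/-- The algebra `𝔄_H(M)`: regular polynomials with the product `⋆_H` determined by `W` and with
complex conjugation as involution. -/
def WickAlgebra (S : Spacetime d M) (_W : BiDistr d M) : Type _ := regularPolynomials S

namespace WickAlgebra

variable {S : Spacetime d M} {W : BiDistr d M}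

instance : AddCommGroup (WickAlgebra S W) := inferInstanceAs (AddCommGroup (regularPolynomials S))

instance : Module ℂ (WickAlgebra S W) := inferInstanceAs (Module ℂ (regularPolynomials S))

/-- The underlying functional. -/
def toFun (F : WickAlgebra S W) : Config d M → ℂ := Subtype.val F

instance : One (WickAlgebra S W) :=
  ⟨⟨fun _ => 1, Submodule.subset_span ⟨0, ⟨fun _ => 1, contMDiff_const,
    HasCompactSupport.of_compactSpace _⟩, by
      funext φ
      simp only [monomial]
      rw [Measure.pi_of_empty]
      simp⟩⟩⟩

theorem conj_mem {F : Config d M → ℂ} (hF : F ∈ regularPolynomials S) :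
    (fun φ => (starRingEnd ℂ) (F φ)) ∈ regularPolynomials S := by
  induction hF using Submodule.span_induction with
  | mem F h =>
    obtain ⟨k, f, rfl⟩ := h
    refine Submodule.subset_span ⟨k, testConj f, ?_⟩
    funext φ
    simp only [monomial, testConj]
    rw [← integral_conj]
    simp [map_prod]
  | zero =>
    convert (regularPolynomials S).zero_mem using 1
    funext φ
    simp
  | add F G _ _ hF hG =>
    convert (regularPolynomials S).add_mem hF hG using 1
    funext φ
    simp
  | smul c F _ hF =>
    convert (regularPolynomials S).smul_mem ((starRingEnd ℂ) c) hF using 1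
    funext φ
    simp

instance : Star (WickAlgebra S W) := ⟨fun F => ⟨fun φ => (starRingEnd ℂ) (F.toFun φ), conj_mem F.2⟩⟩

open Classical in
/-- The product `F ⋆_H G` (the second case does not occur if `⋆_H` preserves regular
polynomials). -/
instance : Mul (WickAlgebra S W) :=
  ⟨fun F G => if h : starProd S W F.toFun G.toFun ∈ regularPolynomials S then ⟨_, h⟩ else 0⟩

/-- A test function on `M`, regarded as a test function on `M¹`. -/
def toPowOne (f : Test d M) : TestPow d M 1 :=
  ⟨fun x => (f : M → ℂ) (x 0), by
    have hc : Continuous fun x : Fin 1 → M => x 0 := continuous_apply 0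
    have hs : ContMDiff (ModelWithCorners.pi fun _ : Fin 1 => 𝓘(ℝ, Coord d)) 𝓘(ℝ, Coord d) ∞
        (fun x : Fin 1 → M => x 0) := by
      intro x
      rw [contMDiffAt_iff]
      refine ⟨hc.continuousAt, ?_⟩
      have hp : ContDiffWithinAt ℝ ∞ (fun v : Fin 1 → Coord d => v 0)
          (range (ModelWithCorners.pi fun _ : Fin 1 => 𝓘(ℝ, Coord d)))
          (extChartAt (ModelWithCorners.pi fun _ : Fin 1 => 𝓘(ℝ, Coord d)) x x) :=
        (contDiff_apply ℝ (Coord d) (0 : Fin 1)).contDiffWithinAt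
      refine hp.congr_of_eventuallyEq ?_ ?_
      · filter_upwards [extChartAt_target_mem_nhdsWithin x] with v hv
        exact congrFun ((extChartAt (ModelWithCorners.pi fun _ : Fin 1 => 𝓘(ℝ, Coord d)) x).right_inv
          hv) 0
      · exact congrFun ((extChartAt (ModelWithCorners.pi fun _ : Fin 1 => 𝓘(ℝ, Coord d)) x).right_inv
          (mem_extChartAt_target x)) 0
    refine ⟨f.2.1.comp hs, ?_⟩
    have hK : IsCompact ((fun x : Fin 1 → M => x 0) ⁻¹' tsupport (f : M → ℂ)) :=
      (Homeomorph.funUnique (Fin 1) M).isClosedEmbedding.isCompact_preimage f.2.2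
    exact hK.of_isClosed_subset (isClosed_tsupport _) (closure_minimal
      (fun x hx => subset_tsupport _ hx) ((isClosed_tsupport _).preimage hc))⟩

/-- The smeared field `Φ_f(φ) = ∫ f φ dμ_g`. -/
def field (S : Spacetime d M) (W : BiDistr d M) (f : Test d M) : WickAlgebra S W :=
  ⟨fun φ => ∫ x, (f : M → ℂ) x * (φ x : ℂ) ∂S.vol, Submodule.subset_span ⟨1, toPowOne f, by
    funext φ
    have h := (measurePreserving_funUnique S.vol (Fin 1)).integral_comp
      (MeasurableEquiv.funUnique (Fin 1) M).measurableEmbedding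
      (fun x => (f : M → ℂ) x * (φ x : ℂ))
    rw [← h]
    simp [monomial, toPowOne]
    rfl⟩⟩

/-- Evaluation at the zero field configuration, `ω₀(F) = F(0)`. -/
def evalZero (S : Spacetime d M) (W : BiDistr d M) : WickAlgebra S W →ₗ[ℂ] ℂ where
  toFun F := F.toFun 0
  map_add' _ _ := rfl
  map_smul' _ _ := rfl

/-- `W` is the two-point function of `Ω`. -/
def IsTwoPointFunction (Ω : WickAlgebra S W →ₗ[ℂ] ℂ) (w : BiDistr d M) : Prop :=
  ∀ f g : Test d M, Ω (field S W f * field S W g) = w.toLinear (tensor f g)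

/-- `Ω` is a Hadamard state for `P = □ + V`: its two-point function is a Hadamard function. -/
def IsHadamard (V : Config d M) (Ω : WickAlgebra S W →ₗ[ℂ] ℂ) : Prop :=
  IsState Ω ∧ ∃ w : BiDistr d M, IsTwoPointFunction Ω w ∧ IsHadamardFunction S V w

end WickAlgebra

end Wick

end ScalarQFT

end

/-!
All objects in sight become computable once test functions are expanded in a fixed system of
elementary ones. For a compact `K ⊆ M` choose finitely many charts, bump functions `χ_a` in them
covering `K`, and the functions `χ_a e^{i⟨ξ, ·⟩}` with `ξ` in a lattice of frequencies. Together
they form a `Frame`: by Fourier series in the charts and a partition of unity, every test function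
on `Kⁿ` is a series of `n`-fold tensor products of these functions with rapidly decreasing
coefficients (`BumpCover.elem_expand`); conversely every such series is a test function, and since
distributions are bounded by finitely many derivatives, they grow polynomially in the frequencies
and can be applied to such series term by term (`BumpCover.elem_bi_sum`). No kernel theorem and no
topology on test functions is needed.

Consequently the regular polynomials are exactly the rapidly convergent series of products of
smeared fields (`exists_expansion`, `Expansion.eval_mem`). These can be differentiated term by term
(`Expansion.hasDerivAt_eval`), which produces the integral kernels of functional derivatives. The
kernels are unique (`testPow_ext`), because the volume measure is locally finite and charges open
sets, which is checked in charts using the change of variables formula. A tensor power of `W`,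
applied to two kernels, is the double series of coefficients multiplied with products of matrix
elements of `W` (`tensorPow_series`). This is again such a series in the configuration, so that the
star product of two regular polynomials, a finite sum, is a regular polynomial (`starProd_mem`).

The kernel of the `n`-th derivative of `F*` is the complex conjugate of that of `F`, whence the
`n`-th term of `(F* ⋆ F)(φ)` is `∑ c̄_j c_{j'} ∏ᵢ W(ē_{j,i} ⊗ e_{j',i}) / n!`. For each `i` the
matrix `W(ē_{j,i} ⊗ e_{j',i})` is positive semidefinite as `W` is of positive type, and so are
products of such matrices by the Schur product theorem (`tensorPow_conj_nonneg`). This gives the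
positivity of the state.

Finally `Φ_f ⋆ G = Φ_f G + W(f ⊗ G⁽¹⁾)`, since the higher derivatives of `Φ_f` vanish
(`starProd_pair`). Iterating this yields Wick's theorem (`starProd_pair_wickProd`); at `φ = 0` it
reduces to a recursion which expands a sum over pairings with respect to the partner of the first
index (`sum_pairings`).
-/

noncomputable section

namespace ScalarQFT

set_option linter.unusedSectionVars false

/-! ### Rapidly convergent Fourier series -/

section Fourier

theorem summable_prod_apply {ι β : Type*} [Fintype ι] {f : β → ℝ} (hf : Summable f)
    (h0 : ∀ b, 0 ≤ f b) : Summable fun ξ : ι → β => ∏ i, f (ξ i) := by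
  classical
  refine summable_of_sum_le (c := ∏ _i : ι, ∑' b, f b)
    (fun ξ => Finset.prod_nonneg fun i _ => h0 _) fun s => ?_
  calc ∑ ξ ∈ s, ∏ i, f (ξ i)
      ≤ ∑ ξ ∈ Fintype.piFinset (fun i => s.image (fun ξ => ξ i)), ∏ i, f (ξ i) := by
        refine Finset.sum_le_sum_of_subset_of_nonneg (fun ξ hξ => ?_)
          fun _ _ _ => Finset.prod_nonneg fun i _ => h0 _
        exact Fintype.mem_piFinset.2 fun i => Finset.mem_image_of_mem _ hξ
    _ = ∏ i, ∑ b ∈ s.image (fun ξ => ξ i), f b := (Finset.prod_univ_sum _ _).symm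
    _ ≤ ∏ _i : ι, ∑' b, f b := Finset.prod_le_prod
        (fun i _ => Finset.sum_nonneg fun b _ => h0 b) fun i _ => hf.sum_le_tsum _ fun b _ => h0 b

theorem summable_int_inv_sq : Summable fun n : ℤ => ((1 + ‖n‖) ^ 2)⁻¹ := by
  have h : Summable fun n : ℕ => (((1 : ℝ) + n) ^ 2)⁻¹ := by
    have := (summable_nat_add_iff 1).2 (Real.summable_one_div_nat_pow.2 (one_lt_two))
    refine this.congr fun n => ?_
    push_cast
    rw [one_div, add_comm]
  rw [summable_int_iff_summable_nat_and_neg]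
  simpa using h

/-- The lattice sum `∑ (1 + ‖ξ‖)^{-2 |ι|}` over `ξ : ℤ^ι` converges. -/
theorem summable_lattice (ι : Type*) [Fintype ι] :
    Summable fun ξ : ι → ℤ => ((1 + ‖ξ‖) ^ (2 * Fintype.card ι))⁻¹ := by
  refine Summable.of_nonneg_of_le (fun ξ => by positivity) (fun ξ => ?_)
    (summable_prod_apply (ι := ι) summable_int_inv_sq fun n => by positivity)
  rw [Finset.prod_inv_distrib]
  refine inv_anti₀ (Finset.prod_pos fun i _ => by positivity) ?_
  calc ∏ i, (1 + ‖ξ i‖) ^ 2 ≤ ∏ _i : ι, (1 + ‖ξ‖) ^ 2 := by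
        refine Finset.prod_le_prod (fun i _ => by positivity) fun i _ => ?_
        gcongr
        exact norm_le_pi_norm ξ i
    _ = _ := by simp [pow_mul]

theorem summable_of_decay {ι : Type*} [Fintype ι] {c : (ι → ℤ) → ℂ}
    (h : ∀ N : ℕ, ∃ C : ℝ, ∀ ξ, ‖c ξ‖ * (1 + ‖ξ‖) ^ N ≤ C) (N : ℕ) :
    Summable fun ξ => ‖c ξ‖ * (1 + ‖ξ‖) ^ N := by
  obtain ⟨C, hC⟩ := h (N + 2 * Fintype.card ι)
  refine Summable.of_nonneg_of_le (fun ξ => by positivity) (fun ξ => ?_)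
    ((summable_lattice ι).mul_left C)
  rw [← div_eq_mul_inv, le_div_iff₀ (by positivity), mul_assoc, ← pow_add]
  exact hC ξ

/-- The periodization of a function supported in the cube `[-r, r]^ι`, `r < 1/2`, as a function on
the torus. -/
def torusLift {ι : Type*} (g : (ι → ℝ) → ℂ) (z : UnitAddTorus ι) : ℂ :=
  g fun i => (AddCircle.equivIoc (1 : ℝ) (-1 / 2) (z i)).1

theorem torusLift_coe {ι : Type*} (g : (ι → ℝ) → ℂ) {v : ι → ℝ}
    (hv : ∀ i, v i ∈ Ioc (-1 / 2 : ℝ) (-1 / 2 + 1)) :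
    torusLift g (fun i => (v i : UnitAddCircle)) = g v := by
  simp only [torusLift]
  congr 1
  funext i
  rw [AddCircle.equivIoc_coe_eq (hv i)]

theorem continuous_torusLift {ι : Type*} [Fintype ι] {g : (ι → ℝ) → ℂ} (hg : Continuous g) {r : ℝ}
    (hr : r < 1 / 2) (hsupp : ∀ v, g v ≠ 0 → ∀ i, |v i| ≤ r) : Continuous (torusLift g) := by
  set C : Set UnitAddCircle := (fun t : ℝ => (t : UnitAddCircle)) '' Icc (-r) r with hC
  have hCc : IsClosed C := (isCompact_Icc.image (AddCircle.continuous_mk' 1)).isClosed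
  refine continuous_iff_continuousAt.2 fun z => ?_
  -- At points of `C^ι` the coordinates stay away from the cut point `-1/2`, where `equivIoc` jumps;
  -- elsewhere the function vanishes locally.
  by_cases hz : ∀ i, z i ∈ C
  · refine hg.continuousAt.comp (f := fun z : UnitAddTorus ι => fun i =>
      (AddCircle.equivIoc (1 : ℝ) (-1 / 2) (z i)).1) ?_
    refine continuousAt_pi.2 fun i => ?_
    obtain ⟨t, ht, hti⟩ := hz i
    have hne : z i ≠ ((-1 / 2 : ℝ) : UnitAddCircle) := by
      rw [← hti]
      intro h
      have e : ((-1 / 2 : ℝ) : UnitAddCircle) = ((1 / 2 : ℝ) : UnitAddCircle) := by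
        rw [← AddCircle.coe_add_period (1 : ℝ) (-1 / 2)]; norm_num
      rw [e] at h
      have h1 := AddCircle.equivIoc_coe_eq (p := (1 : ℝ)) (a := -1 / 2) (x := t)
        ⟨by linarith [ht.1], by linarith [ht.2]⟩
      have h2 := AddCircle.equivIoc_coe_eq (p := (1 : ℝ)) (a := -1 / 2) (x := 1 / 2)
        ⟨by norm_num, by norm_num⟩
      rw [show (t : AddCircle (1 : ℝ)) = ((1 / 2 : ℝ) : AddCircle (1 : ℝ)) from h, h2] at h1
      have := congrArg Subtype.val h1
      simp only at this
      linarith [ht.2]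
    have h1 := AddCircle.continuousAt_equivIoc (1 : ℝ) (-1 / 2) hne
    exact (continuous_subtype_val.continuousAt.comp h1).comp
      (f := fun z : UnitAddTorus ι => z i) (continuous_apply i).continuousAt
  · push Not at hz
    obtain ⟨i, hi⟩ := hz
    have key : ∀ z' : UnitAddTorus ι, z' i ∉ C → torusLift g z' = 0 := by
      intro z' hz'
      by_contra hne
      apply hz'
      have := hsupp _ hne i
      exact ⟨_, abs_le.1 this, AddCircle.coe_equivIoc⟩
    have hev : torusLift g =ᶠ[𝓝 z] fun _ => 0 := by
      filter_upwards [(hCc.isOpen_compl.preimage (continuous_apply i)).mem_nhds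
        (show z ∈ (fun p : UnitAddTorus ι => p i) ⁻¹' Cᶜ from hi)] with z' hz'
      exact key z' hz'
    exact continuousAt_const.congr hev.symm

/-- The Fourier coefficients of a smooth function with compact support decay rapidly: they are
values of its Fourier transform, a Schwartz function. -/
theorem mFourierCoeff_torusLift_decay {ι : Type*} [Fintype ι] {g : (ι → ℝ) → ℂ}
    (hg : ContDiff ℝ ∞ g) {r : ℝ} (hr : r < 1 / 2)
    (hsupp : ∀ v, g v ≠ 0 → ∀ i, |v i| ≤ r) (N : ℕ) :
    ∃ C : ℝ, ∀ ξ, ‖UnitAddTorus.mFourierCoeff (torusLift g) ξ‖ * (1 + ‖ξ‖) ^ N ≤ C := by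
  classical
  set f : EuclideanSpace ℝ ι → ℂ := fun v => g v.ofLp with hf
  have hfs : ContDiff ℝ ∞ f := hg.comp (PiLp.continuousLinearEquiv 2 ℝ (fun _ : ι => ℝ)).contDiff
  have hgc : HasCompactSupport g := by
    refine HasCompactSupport.intro (K := Set.pi univ fun _ => Icc (-r) r)
      (isCompact_univ_pi fun _ => isCompact_Icc (α := ℝ)) fun v hv => ?_
    by_contra hne
    exact hv fun i _ => abs_le.1 (hsupp v hne i)
  have hfc : HasCompactSupport f :=
    hgc.comp_homeomorph (PiLp.continuousLinearEquiv 2 ℝ (fun _ : ι => ℝ)).toHomeomorph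
  set F : SchwartzMap (EuclideanSpace ℝ ι) ℂ := hfc.toSchwartzMap hfs with hF
  have hcoef : ∀ ξ : ι → ℤ, UnitAddTorus.mFourierCoeff (torusLift g) ξ =
      FourierTransform.fourier F (WithLp.toLp 2 fun i => (ξ i : ℝ)) := by
    intro ξ
    rw [UnitAddTorus.mFourierCoeff_eq_integral _ _ fun _ => -1 / 2, SchwartzMap.fourier_coe,
      Real.fourier_eq',
      ← (PiLp.volume_preserving_toLp ι).integral_comp
        (MeasurableEquiv.toLp 2 (ι → ℝ)).measurableEmbedding]
    refine Eq.trans ?_ (setIntegral_eq_integral_of_forall_compl_eq_zero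
      (s := {x : ι → ℝ | ∀ i, x i ∈ Ioc (-1 / 2 : ℝ) (-1 / 2 + 1)}) ?_)
    · -- On the unit cube the integrands agree.
      refine setIntegral_congr_fun (MeasurableSet.univ_pi' fun i => measurableSet_Ioc) ?_
      intro v hv
      simp only
      rw [torusLift_coe g hv]
      congr 1
      simp only [UnitAddTorus.mFourier, ContinuousMap.coe_mk, Pi.neg_apply, fourier_coe_apply,
        ← Complex.exp_sum]
      congr 1
      simp only [PiLp.inner_apply, RCLike.inner_apply, conj_trivial]
      push_cast
      simp only [Finset.mul_sum, Finset.sum_mul]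
      refine Finset.sum_congr rfl fun i _ => ?_
      ring
    · intro v hv
      have : g v = 0 := by
        by_contra hne
        refine hv fun i => ?_
        have := abs_le.1 (hsupp v hne i)
        constructor <;> linarith
      have h2 : F (WithLp.toLp 2 v) = 0 := this
      simp only [h2, smul_zero]
  set G := FourierTransform.fourier F with hG
  obtain ⟨C, hC⟩ : ∃ C : ℝ, ∀ x, (1 + ‖x‖) ^ N * ‖iteratedFDeriv ℝ 0 G x‖ ≤ C :=
    ⟨_, SchwartzMap.one_add_le_sup_seminorm_apply (𝕜 := ℝ) (m := (N, 0)) (k := N) (n := 0)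
      le_rfl le_rfl G⟩
  refine ⟨C, fun ξ => ?_⟩
  rw [hcoef]
  refine le_trans ?_ (hC (WithLp.toLp 2 fun i => (ξ i : ℝ)))
  rw [norm_iteratedFDeriv_zero, mul_comm]
  gcongr
  refine (pi_norm_le_iff_of_nonneg (norm_nonneg _)).2 fun i => ?_
  have := PiLp.norm_apply_le (p := 2) (WithLp.toLp 2 fun i => (ξ i : ℝ) : EuclideanSpace ℝ ι) i
  simpa [Int.norm_eq_abs] using this

/-- A smooth function supported in a cube of side length less than one is, on the open unit cube,
the sum of a Fourier series with rapidly decreasing coefficients. -/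
theorem exists_fourier_series {ι : Type*} [Fintype ι] {g : (ι → ℝ) → ℂ}
    (hg : ContDiff ℝ ∞ g) {r : ℝ} (hr : r < 1 / 2)
    (hsupp : ∀ v, g v ≠ 0 → ∀ i, |v i| ≤ r) :
    ∃ c : (ι → ℤ) → ℂ, (∀ N : ℕ, Summable fun ξ => ‖c ξ‖ * (1 + ‖ξ‖) ^ N) ∧
      ∀ v : ι → ℝ, (∀ i, |v i| < 1 / 2) →
        HasSum (fun ξ => c ξ * Complex.exp (Complex.I * (2 * Real.pi * ∑ i, ξ i * v i : ℝ)))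
          (g v) := by
  have hs := summable_of_decay (mFourierCoeff_torusLift_decay hg hr hsupp)
  refine ⟨UnitAddTorus.mFourierCoeff (torusLift g), hs, fun v hv => ?_⟩
  have h := UnitAddTorus.hasSum_mFourier_series_apply_of_summable
    (f := ⟨torusLift g, continuous_torusLift hg.continuous hr hsupp⟩)
    (Summable.of_norm (by simpa using hs 0)) (fun i => (v i : UnitAddCircle))
  simp only [ContinuousMap.coe_mk] at h
  rw [torusLift_coe g fun i => by
    have := abs_lt.1 (hv i); constructor <;> linarith] at h
  refine h.congr_fun fun ξ => ?_
  rw [smul_eq_mul]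
  congr 1
  simp only [UnitAddTorus.mFourier, ContinuousMap.coe_mk, fourier_coe_apply, ← Complex.exp_sum]
  congr 1
  push_cast
  simp only [Finset.mul_sum]
  refine Finset.sum_congr rfl fun i _ => ?_
  ring

end Fourier

/-! ### Rapidly decreasing families and trigonometric series -/

section Rapid

/-- The family `c` of coefficients decreases rapidly with respect to the weights `u`. -/
def Rapid {J : Type*} (u : J → ℝ) (c : J → ℂ) : Prop := ∀ N : ℕ, Summable fun j => ‖c j‖ * u j ^ N

namespace Rapid

variable {J J' : Type*} {u : J → ℝ} {c : J → ℂ} {u' : J' → ℝ} {c' : J' → ℂ}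

theorem summable_norm (h : Rapid u c) : Summable fun j => ‖c j‖ := by simpa using h 0

theorem mul_bound (h : Rapid u c) (h0 : ∀ j, 0 ≤ u j) {a : J → ℂ} {C : ℝ} {N : ℕ}
    (ha : ∀ j, ‖a j‖ ≤ C * u j ^ N) : Rapid u fun j => c j * a j := by
  intro K
  refine Summable.of_nonneg_of_le (fun j => by have := h0 j; positivity) (fun j => ?_)
    ((h (N + K)).mul_left C)
  have := h0 j
  rw [norm_mul]
  calc ‖c j‖ * ‖a j‖ * u j ^ K ≤ ‖c j‖ * (C * u j ^ N) * u j ^ K := by gcongr; exact ha j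
    _ = _ := by ring

theorem mul_bounded (h : Rapid u c) (h0 : ∀ j, 0 ≤ u j) {a : J → ℂ} {C : ℝ}
    (ha : ∀ j, ‖a j‖ ≤ C) : Rapid u fun j => c j * a j :=
  h.mul_bound h0 (N := 0) (by simpa using ha)

theorem prod (h : Rapid u c) (h' : Rapid u' c') (h0 : ∀ j, 0 ≤ u j) (h0' : ∀ j, 0 ≤ u' j) :
    Rapid (fun p : J × J' => u p.1 * u' p.2) fun p => c p.1 * c' p.2 := by
  intro N
  have := (h N).mul_of_nonneg (h' N) (fun j => by have := h0 j; positivity)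
    (fun j => by have := h0' j; positivity)
  refine this.congr fun p => ?_
  rw [norm_mul, mul_pow]; ring

theorem star (h : Rapid u c) : Rapid u fun j => (starRingEnd ℂ) (c j) := fun N => by
  simpa using h N

theorem const_mul (h : Rapid u c) (a : ℂ) : Rapid u fun j => a * c j := fun N => by
  simpa [mul_assoc] using (h N).mul_left ‖a‖

theorem indicator (h : Rapid u c) (h0 : ∀ j, 0 ≤ u j) (s : Set J) : Rapid u (s.indicator c) := by
  classical
  intro N
  refine Summable.of_nonneg_of_le (fun j => by have := h0 j; positivity) (fun j => ?_) (h N)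
  have := h0 j
  gcongr
  exact norm_indicator_le_norm_self c j

theorem sum_elim (h : Rapid u c) (h' : Rapid u' c') :
    Rapid (Sum.elim u u') (Sum.elim c c') := fun N => by
  exact Summable.sum _ (by simpa [Function.comp_def] using h N)
    (by simpa [Function.comp_def] using h' N)

end Rapid

variable {V : Type*} [NormedAddCommGroup V] [NormedSpace ℝ V]

/-- The plane wave `z ↦ e^{i L z}`. -/
def wave (L : V →L[ℝ] ℝ) (z : V) : ℂ := Complex.exp (Complex.I * (L z : ℂ))

theorem norm_wave (L : V →L[ℝ] ℝ) (z : V) : ‖wave L z‖ = 1 := by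
  rw [wave, mul_comm]; exact Complex.norm_exp_ofReal_mul_I _

theorem contDiff_wave (L : V →L[ℝ] ℝ) {n : ℕ∞} : ContDiff ℝ n (wave L) :=
  (contDiff_const.mul (Complex.ofRealCLM.contDiff.comp L.contDiff)).cexp

theorem iteratedDeriv_cexp_I (k : ℕ) :
    iteratedDeriv k (fun t : ℝ => Complex.exp (Complex.I * (t : ℂ))) =
      fun t : ℝ => Complex.I ^ k * Complex.exp (Complex.I * (t : ℂ)) := by
  induction k with
  | zero => simp
  | succ k ih =>
    rw [iteratedDeriv_succ, ih]
    funext t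
    have h : HasDerivAt (fun t : ℝ => Complex.exp (Complex.I * (t : ℂ)))
        (Complex.exp (Complex.I * (t : ℂ)) * (Complex.I * 1)) t :=
      ((Complex.ofRealCLM.hasDerivAt (x := t)).const_mul Complex.I).cexp
    rw [(h.const_mul (Complex.I ^ k)).deriv]
    ring

theorem norm_iteratedFDeriv_wave_le (L : V →L[ℝ] ℝ) (k : ℕ) (z : V) :
    ‖iteratedFDeriv ℝ k (wave L) z‖ ≤ ‖L‖ ^ k := by
  have h1 : ContDiff ℝ ∞ (fun t : ℝ => Complex.exp (Complex.I * (t : ℂ))) :=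
    (contDiff_const.mul Complex.ofRealCLM.contDiff).cexp
  have h : wave L = (fun t : ℝ => Complex.exp (Complex.I * (t : ℂ))) ∘ L := rfl
  rw [h, L.iteratedFDeriv_comp_right h1 z (i := k) (by exact_mod_cast le_top)]
  refine (ContinuousMultilinearMap.norm_compContinuousLinearMap_le _ _).trans ?_
  rw [norm_iteratedFDeriv_eq_norm_iteratedDeriv, iteratedDeriv_cexp_I]
  have : ‖Complex.exp (Complex.I * ((L z : ℝ) : ℂ))‖ = 1 := norm_wave L z
  simp [this]

/-- The bound for the `k`-th derivatives of a trigonometric series. -/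
def waveBound {J : Type*} (u : J → ℝ) (c : J → ℂ) (A : ℝ) (k : ℕ) : ℝ := ∑' j, ‖c j‖ * (A * u j) ^ k

theorem Rapid.summable_wave {J : Type*} {u : J → ℝ} {c : J → ℂ} (hc : Rapid u c) (A : ℝ) (k : ℕ) :
    Summable fun j => ‖c j‖ * (A * u j) ^ k := by
  refine ((hc k).mul_left (A ^ k)).congr fun j => ?_
  ring

theorem norm_iteratedFDeriv_term_le {J : Type*} {u : J → ℝ} {c : J → ℂ}
    {L : J → V →L[ℝ] ℝ} {A : ℝ} (hL : ∀ j, ‖L j‖ ≤ A * u j) (k : ℕ) (j : J) (z : V) :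
    ‖iteratedFDeriv ℝ k (fun z => c j * wave (L j) z) z‖ ≤ ‖c j‖ * (A * u j) ^ k := by
  have h : (fun z => c j * wave (L j) z) = c j • wave (L j) := by
    funext z; simp
  rw [h, iteratedFDeriv_const_smul_apply (contDiff_wave (L j)).contDiffAt, norm_smul]
  gcongr
  exact (norm_iteratedFDeriv_wave_le _ _ _).trans (by gcongr; exact hL j)

/-- A trigonometric series with rapidly decreasing coefficients is smooth. -/
theorem contDiff_waveSeries {J : Type*} {u : J → ℝ} {c : J → ℂ} (hc : Rapid u c)
    {L : J → V →L[ℝ] ℝ} {A : ℝ} (hL : ∀ j, ‖L j‖ ≤ A * u j) :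
    ContDiff ℝ ∞ fun z => ∑' j, c j * wave (L j) z :=
  contDiff_tsum (N := ⊤) (v := fun k j => ‖c j‖ * (A * u j) ^ k)
    (fun j => contDiff_const.mul (contDiff_wave (L j)))
    (fun k _ => hc.summable_wave A k)
    (fun k j z _ => norm_iteratedFDeriv_term_le hL k j z)

theorem norm_iteratedFDeriv_waveSeries_le {J : Type*} {u : J → ℝ} {c : J → ℂ} (hc : Rapid u c)
    {L : J → V →L[ℝ] ℝ} {A : ℝ} (hL : ∀ j, ‖L j‖ ≤ A * u j) (k : ℕ) (z : V) :
    ‖iteratedFDeriv ℝ k (fun z => ∑' j, c j * wave (L j) z) z‖ ≤ waveBound u c A k := by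
  rw [iteratedFDeriv_tsum_apply (N := ⊤) (v := fun k j => ‖c j‖ * (A * u j) ^ k)
    (fun j => contDiff_const.mul (contDiff_wave (L j)))
    (fun k _ => hc.summable_wave A k)
    (fun k j z _ => norm_iteratedFDeriv_term_le hL k j z) le_top]
  exact tsum_of_norm_bounded (hc.summable_wave A k).hasSum
    fun j => norm_iteratedFDeriv_term_le hL k j z

/-- A linear functional on smooth functions which is bounded by finitely many derivatives may be
applied to a rapidly convergent trigonometric series term by term. -/
theorem hasSum_apply_waveSeries {J : Type*} {u : J → ℝ} {c : J → ℂ} (hc : Rapid u c)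
    (h0 : ∀ j, 0 ≤ u j) {L : J → V →L[ℝ] ℝ} {A : ℝ} (hA : 0 ≤ A) (hL : ∀ j, ‖L j‖ ≤ A * u j)
    {T : (V → ℂ) → ℂ}
    (hadd : ∀ f g : V → ℂ, ContDiff ℝ ∞ f → ContDiff ℝ ∞ g → T (f + g) = T f + T g)
    (hsmul : ∀ (a : ℂ) (f : V → ℂ), ContDiff ℝ ∞ f → T (a • f) = a * T f) {N : ℕ} {C : ℝ}
    (hb : ∀ f : V → ℂ, ContDiff ℝ ∞ f → ∀ B : ℝ,
      (∀ k ≤ N, ∀ z, ‖iteratedFDeriv ℝ k f z‖ ≤ B) → ‖T f‖ ≤ C * B) :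
    HasSum (fun j => c j * T (wave (L j))) (T fun z => ∑' j, c j * wave (L j) z) := by
  classical
  have hfin : ∀ s : Finset J, ContDiff ℝ ∞ (fun z => ∑ j ∈ s, c j * wave (L j) z) ∧
      T (fun z => ∑ j ∈ s, c j * wave (L j) z) = ∑ j ∈ s, c j * T (wave (L j)) := by
    intro s
    refine ⟨ContDiff.sum fun j _ => contDiff_const.mul (contDiff_wave (L j)), ?_⟩
    induction s using Finset.induction_on with
    | empty =>
      have := hsmul 0 (fun _ => 0) contDiff_const
      simp only [zero_smul, zero_mul] at this
      simpa using! this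
    | insert j s hj ih =>
      rw [Finset.sum_insert hj, ← ih, ← hsmul _ _ (contDiff_wave (L j)), ← hadd]
      · congr 1
        funext z
        simp [Finset.sum_insert hj]
      · exact contDiff_const.smul (contDiff_wave (L j))
      · exact ContDiff.sum fun j _ => contDiff_const.mul (contDiff_wave (L j))
  -- The remainder of the series is a trigonometric series with small derivatives.
  have hsplit : ∀ s : Finset J, ‖∑ j ∈ s, c j * T (wave (L j)) -
      T (fun z => ∑' j, c j * wave (L j) z)‖ ≤
        C * ∑ k ∈ Finset.range (N + 1), ∑' j : {j // j ∉ s}, ‖c j‖ * (A * u j) ^ k := by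
    intro s
    set c' : J → ℂ := ((s : Set J)ᶜ).indicator c with hc'
    have hr : Rapid u c' := hc.indicator h0 _
    have hsm : ∀ z, Summable fun j => c j * wave (L j) z := fun z =>
      Summable.of_norm (by simpa [norm_wave] using hc.summable_norm)
    have e : (fun z => ∑' j, c j * wave (L j) z) =
        (fun z => ∑ j ∈ s, c j * wave (L j) z) + fun z => ∑' j, c' j * wave (L j) z := by
      funext z
      rw [Pi.add_apply, ← (hsm z).sum_add_tsum_compl (s := s)]
      congr 1
      rw [tsum_subtype ((s : Set J)ᶜ) (fun j => c j * wave (L j) z)]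
      refine tsum_congr fun j => ?_
      by_cases hj : j ∈ s <;> simp [hc', hj]
    rw [e, hadd _ _ (hfin s).1 (contDiff_waveSeries hr hL), (hfin s).2, sub_add_cancel_left,
      norm_neg]
    refine hb _ (contDiff_waveSeries hr hL) _ fun k hk z => ?_
    refine (norm_iteratedFDeriv_waveSeries_le hr hL k z).trans ?_
    have e2 : ∀ k, waveBound u c' A k = ∑' j : {j // j ∉ s}, ‖c j‖ * (A * u j) ^ k := by
      intro k
      have := tsum_subtype ((s : Set J)ᶜ) (fun j => ‖c j‖ * (A * u j) ^ k)
      refine Eq.trans ?_ this.symm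
      refine tsum_congr fun j => ?_
      by_cases hj : j ∈ s <;> simp [hc', hj]
    rw [e2]
    exact Finset.single_le_sum (f := fun k => ∑' j : {j // j ∉ s}, ‖c j‖ * (A * u j) ^ k)
      (fun k _ => tsum_nonneg fun j => mul_nonneg (norm_nonneg _)
        (pow_nonneg (mul_nonneg hA (h0 _)) _)) (Finset.mem_range.2 (Nat.lt_succ_of_le hk))
  rw [HasSum, SummationFilter.unconditional_filter, tendsto_iff_norm_sub_tendsto_zero]
  refine squeeze_zero (fun _ => norm_nonneg _) hsplit ?_
  have h1 : ∀ k ∈ Finset.range (N + 1), Filter.Tendsto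
      (fun s : Finset J => ∑' j : {j // j ∉ s}, ‖c j‖ * (A * u j) ^ k) Filter.atTop (𝓝 0) :=
    fun k _ => tendsto_tsum_compl_atTop_zero fun j => ‖c j‖ * (A * u j) ^ k
  have h2 := (tendsto_finsetSum _ h1).const_mul C
  simpa using h2

end Rapid

/-! ### The volume measure of a spacetime -/

section Volume

variable {d : ℕ} {M : Type*} [TopologicalSpace M] [ChartedSpace (Coord d) M]
  [IsManifold 𝓘(ℝ, Coord d) ∞ M]

local notation "κ" => extChartAt 𝓘(ℝ, Coord d)

/-- The derivative of the inverse of the preferred chart at `x`, as a map of the model space. -/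
def chartFrame (x : M) (y : Coord d) : Coord d →L[ℝ] Coord d :=
  mfderiv 𝓘(ℝ, Coord d) 𝓘(ℝ, Coord d) (κ x).symm y

/-- The transition map from the preferred chart at `x` to the preferred chart at `x'`. -/
def transition (x x' : M) (y : Coord d) : Coord d := κ x' ((κ x).symm y)

theorem mdifferentiableAt_chart_symm {x : M} {y : Coord d} (hy : y ∈ (κ x).target) :
    MDifferentiableAt 𝓘(ℝ, Coord d) 𝓘(ℝ, Coord d) (κ x).symm y :=
  ((contMDiffOn_extChartAt_symm (n := ∞) x).contMDiffAt
    ((isOpen_extChartAt_target x).mem_nhds hy)).mdifferentiableAt (by simp)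

theorem differentiableAt_transition {x x' : M} {y : Coord d} (hy : y ∈ (κ x).target)
    (hy' : (κ x).symm y ∈ (κ x').source) : DifferentiableAt ℝ (transition x x') y := by
  have h1 := mdifferentiableAt_chart_symm hy
  have h2 : MDifferentiableAt 𝓘(ℝ, Coord d) 𝓘(ℝ, Coord d) (κ x') ((κ x).symm y) :=
    mdifferentiableAt_extChartAt (by simpa using hy')
  exact mdifferentiableAt_iff_differentiableAt.1 (h2.comp y h1)

theorem chartFrame_eq_comp {x x' : M} {y : Coord d} (hy : y ∈ (κ x).target)
    (hy' : (κ x).symm y ∈ (κ x').source) :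
    chartFrame x y = (chartFrame x' (transition x x' y)).comp (fderiv ℝ (transition x x') y) := by
  have ht : transition x x' y ∈ (κ x').target := (κ x').map_source hy'
  have hev : (κ x).symm =ᶠ[𝓝 y] (κ x').symm ∘ transition x x' := by
    have hc : ContinuousAt (κ x).symm y := continuousAt_extChartAt_symm'' hy
    filter_upwards [hc.preimage_mem_nhds ((isOpen_extChartAt_source x').mem_nhds hy')] with z hz
    exact ((κ x').left_inv hz).symm
  have h1 : mfderiv 𝓘(ℝ, Coord d) 𝓘(ℝ, Coord d) ((κ x').symm ∘ transition x x') y =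
      (mfderiv 𝓘(ℝ, Coord d) 𝓘(ℝ, Coord d) (κ x').symm (transition x x' y)).comp
        (mfderiv 𝓘(ℝ, Coord d) 𝓘(ℝ, Coord d) (transition x x') y) :=
    mfderiv_comp y (mdifferentiableAt_chart_symm ht)
      (differentiableAt_transition hy hy').mdifferentiableAt
  rw [mfderiv_eq_fderiv] at h1
  exact hev.mfderiv_eq.trans h1

theorem chartFrame_injective {x : M} {y : Coord d} (hy : y ∈ (κ x).target) :
    Function.Injective (chartFrame x y) := by
  have := isInvertible_mfderivWithin_extChartAt_symm (I := 𝓘(ℝ, Coord d)) hy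
  rw [show range 𝓘(ℝ, Coord d) = univ by simp, mfderivWithin_univ] at this
  exact this.injective

variable (S : Spacetime d M)

/-- The metric at a point as a bilinear form on the model space. -/
def Spacetime.form (p : M) : Coord d →L[ℝ] Coord d →L[ℝ] ℝ := S.metric p

theorem Spacetime.coordMetric_eq (x : M) (y v w : Coord d) :
    S.coordMetric x y v w = S.form ((κ x).symm y) (chartFrame x y v) (chartFrame x y w) := rfl

theorem Spacetime.coordMetric_transition {x x' : M} {y : Coord d} (hy : y ∈ (κ x).target)
    (hy' : (κ x).symm y ∈ (κ x').source) (v w : Coord d) :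
    S.coordMetric x y v w = S.coordMetric x' (transition x x' y)
      (fderiv ℝ (transition x x') y v) (fderiv ℝ (transition x x') y w) := by
  rw [S.coordMetric_eq, S.coordMetric_eq, chartFrame_eq_comp hy hy', transition,
    (κ x').left_inv hy']
  rfl

theorem coord_eq_sum (v : Coord d) : v = ∑ i, v i • EuclideanSpace.single i (1 : ℝ) := by
  ext j
  simp [Finset.sum_apply, Pi.single_apply]

theorem Spacetime.coordMetric_expand (x : M) (y v w : Coord d) :
    S.coordMetric x y v w = ∑ i, ∑ j, v i * w j * S.gram x y i j := by
  conv_lhs => rw [coord_eq_sum v, coord_eq_sum w]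
  simp only [S.coordMetric_eq, map_sum, map_smul, sum_apply, smul_apply, smul_eq_mul, Finset.mul_sum, Spacetime.gram, Matrix.of_apply]
  rw [Finset.sum_comm]
  refine Finset.sum_congr rfl fun i _ => Finset.sum_congr rfl fun j _ => ?_
  ring

theorem Spacetime.gram_transition {x x' : M} {y : Coord d} (hy : y ∈ (κ x).target)
    (hy' : (κ x).symm y ∈ (κ x').source) :
    S.gram x y = (LinearMap.toMatrix (PiLp.basisFun 2 ℝ (Fin d)) (PiLp.basisFun 2 ℝ (Fin d))
        (fderiv ℝ (transition x x') y : Coord d →ₗ[ℝ] Coord d)).transpose *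
      S.gram x' (transition x x' y) *
      (LinearMap.toMatrix (PiLp.basisFun 2 ℝ (Fin d)) (PiLp.basisFun 2 ℝ (Fin d))
        (fderiv ℝ (transition x x') y : Coord d →ₗ[ℝ] Coord d)) := by
  ext i j
  conv_lhs => rw [Spacetime.gram, Matrix.of_apply, S.coordMetric_transition hy hy',
    S.coordMetric_expand]
  simp only [Matrix.mul_apply, Matrix.transpose_apply, LinearMap.toMatrix_apply,
    PiLp.basisFun_repr, PiLp.basisFun_apply, Finset.sum_mul, ContinuousLinearMap.coe_coe]
  rw [Finset.sum_comm]
  refine Finset.sum_congr rfl fun k _ => Finset.sum_congr rfl fun l _ => ?_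
  simp only [EuclideanSpace.single]
  ring

theorem Spacetime.density_transition {x x' : M} {y : Coord d} (hy : y ∈ (κ x).target)
    (hy' : (κ x).symm y ∈ (κ x').source) :
    S.density x y = |(fderiv ℝ (transition x x') y).det| * S.density x' (transition x x' y) := by
  rw [Spacetime.density, S.gram_transition hy hy', Matrix.det_mul, Matrix.det_mul,
    Matrix.det_transpose, LinearMap.det_toMatrix, abs_mul, abs_mul, ContinuousLinearMap.det,
    mul_comm (|LinearMap.det _|) (|Matrix.det _|), mul_assoc, ← pow_two,
    Real.sqrt_mul (abs_nonneg _), Real.sqrt_sq (abs_nonneg _), mul_comm, Spacetime.density]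

/-- A vector orthogonal to all vectors is orthogonal to the timelike direction, hence spacelike or
zero; but it is also null. -/
theorem Spacetime.form_nondegenerate (p : M) (v : Coord d) (h : ∀ w, S.form p v w = 0) :
    v = 0 := by
  by_contra hv
  have h1 := S.metric_lorentzian p (S.timeDir p) v (S.timeDir_timelike p)
    ((S.metric_symm _ _ _).trans (h _)) hv
  exact (ne_of_lt h1) (h v)

theorem Spacetime.density_pos {x : M} {y : Coord d} (hy : y ∈ (κ x).target) :
    0 < S.density x y := by
  refine Real.sqrt_pos.2 (abs_pos.2 fun h0 => ?_)
  obtain ⟨v, hv0, hv⟩ := Matrix.exists_mulVec_eq_zero_iff.2 h0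
  set v' : Coord d := WithLp.toLp 2 v with hv'
  have hall : ∀ w, S.coordMetric x y w v' = 0 := by
    intro w
    rw [S.coordMetric_expand]
    have : ∀ i, ∑ j, w i * v' j * S.gram x y i j = w i * (S.gram x y).mulVec v i := by
      intro i
      rw [Matrix.mulVec, dotProduct, Finset.mul_sum]
      refine Finset.sum_congr rfl fun j _ => ?_
      simp only [hv']
      ring
    simp [this, hv]
  have hinj := chartFrame_injective hy
  have hsurj : Function.Surjective (chartFrame x y) :=
    (LinearMap.injective_iff_surjective (f := (chartFrame x y : Coord d →ₗ[ℝ] Coord d))).1 hinj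
  have hz : chartFrame x y v' = 0 := by
    refine S.form_nondegenerate ((κ x).symm y) _ fun w => ?_
    obtain ⟨w', rfl⟩ := hsurj w
    have := hall w'
    rw [S.coordMetric_eq] at this
    rw [← this]
    exact S.metric_symm _ _ _
  have : v' = 0 := hinj (hz.trans (map_zero _).symm)
  apply hv0
  have h2 := congrArg WithLp.ofLp this
  simpa [hv'] using h2

theorem contMDiffOn_chartFrame (x : M) (v : Coord d) :
    ContMDiffOn 𝓘(ℝ, Coord d) 𝓘(ℝ, Coord d).tangent 0
      (fun y => (⟨(κ x).symm y, chartFrame x y v⟩ : TangentBundle 𝓘(ℝ, Coord d) M))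
      (κ x).target := by
  have ho := isOpen_extChartAt_target (I := 𝓘(ℝ, Coord d)) x
  have h1 := (contMDiffOn_extChartAt_symm (I := 𝓘(ℝ, Coord d)) (n := ∞)
    x).contMDiffOn_tangentMapWithin (m := 0) (by simp) ho.uniqueMDiffOn
  have h2 : ContMDiff 𝓘(ℝ, Coord d) 𝓘(ℝ, Coord d).tangent 0
      (fun y : Coord d => (⟨y, v⟩ : TangentBundle 𝓘(ℝ, Coord d) (Coord d))) :=
    contMDiff_vectorSpace_iff_contDiff.2 contDiff_const
  have h3 := h1.comp h2.contMDiffOn (s := (κ x).target) fun y hy => hy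
  refine h3.congr fun y hy => ?_
  simp only [Function.comp, tangentMapWithin, chartFrame, mfderivWithin_of_isOpen ho hy]
  rfl

theorem Spacetime.continuousOn_coordMetric (x : M) (v w : Coord d) :
    ContinuousOn (fun y => S.coordMetric x y v w) (κ x).target := by
  have key : ContMDiffOn 𝓘(ℝ, Coord d) (𝓘(ℝ, Coord d).prod 𝓘(ℝ)) 0
      (fun y => Bundle.TotalSpace.mk' ℝ (E := Bundle.Trivial M ℝ) ((κ x).symm y)
        (S.metric ((κ x).symm y) (chartFrame x y v) (chartFrame x y w))) (κ x).target := by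
    apply ContMDiffOn.clm_bundle_apply₂ (F₁ := Coord d) (F₂ := Coord d)
    · exact (S.metric_smooth.of_le (by simp)).comp_contMDiffOn
        ((contMDiffOn_extChartAt_symm (I := 𝓘(ℝ, Coord d)) (n := ∞) x).of_le (by simp))
    · exact contMDiffOn_chartFrame x v
    · exact contMDiffOn_chartFrame x w
  intro y hy
  have := key y hy
  simp only [Bundle.contMDiffWithinAt_totalSpace] at this
  exact this.2.continuousWithinAt

theorem Spacetime.continuousOn_density (x : M) : ContinuousOn (S.density x) (κ x).target := by
  refine ContinuousOn.sqrt (ContinuousOn.abs ?_)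
  rw [continuousOn_iff_continuous_domRestrict]
  refine Continuous.matrix_det (continuous_matrix fun i j => ?_)
  exact continuousOn_iff_continuous_domRestrict.1 (S.continuousOn_coordMetric x _ _)

variable [T2Space M] [SecondCountableTopology M] [MeasurableSpace M] [BorelSpace M]

theorem Spacetime.chartVolume_apply (x : M) {s : Set M} (hs : MeasurableSet s) :
    S.chartVolume x s =
      ∫⁻ y in (κ x).symm ⁻¹' s ∩ (κ x).target, ENNReal.ofReal (S.density x y) := by
  have ht : MeasurableSet (κ x).target := (isOpen_extChartAt_target x).measurableSet
  have hae : AEMeasurable (κ x).symm ((volume : Measure (Coord d)).restrict (κ x).target) :=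
    (continuousOn_extChartAt_symm x).aemeasurable ht
  rw [Spacetime.chartVolume, Measure.map_apply_of_aemeasurable
    (hae.mono_ac (withDensity_absolutelyContinuous _ _)) hs, withDensity_apply',
    Measure.restrict_restrict' ht]

theorem measurableSet_chart_preimage (x : M) {s : Set M} (hs : MeasurableSet s) :
    MeasurableSet ((κ x).symm ⁻¹' s ∩ (κ x).target) := by
  have ht : MeasurableSet (κ x).target := (isOpen_extChartAt_target x).measurableSet
  have h1 := (continuousOn_iff_continuous_domRestrict.1
    (continuousOn_extChartAt_symm (I := 𝓘(ℝ, Coord d)) x)).measurable hs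
  have h2 := ht.subtype_image h1
  convert h2 using 1
  ext y
  simp [and_comm]

/-- The local volume measures agree on overlaps of chart domains, by the change of variables
formula. -/
theorem Spacetime.chartVolume_eq {x x' : M} {s : Set M} (hs : MeasurableSet s)
    (hx : s ⊆ (κ x).source) (hx' : s ⊆ (κ x').source) :
    S.chartVolume x s = S.chartVolume x' s := by
  rw [S.chartVolume_apply x hs, S.chartVolume_apply x' hs]
  set A := (κ x).symm ⁻¹' s ∩ (κ x).target with hA
  have himg : (κ x').symm ⁻¹' s ∩ (κ x').target = transition x x' '' A := by
    ext y
    constructor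
    · rintro ⟨hy1, hy2⟩
      refine ⟨κ x ((κ x').symm y), ⟨?_, (κ x).map_source (hx hy1)⟩, ?_⟩
      · rw [mem_preimage, (κ x).left_inv (hx hy1)]; exact hy1
      · rw [transition, (κ x).left_inv (hx hy1), (κ x').right_inv hy2]
    · rintro ⟨z, ⟨hz1, hz2⟩, rfl⟩
      refine ⟨?_, (κ x').map_source (hx' hz1)⟩
      rw [mem_preimage, transition, (κ x').left_inv (hx' hz1)]
      exact hz1
  have hd : ∀ y ∈ A, HasFDerivWithinAt (transition x x') (fderiv ℝ (transition x x') y) A y :=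
    fun y hy => (differentiableAt_transition hy.2 (hx' hy.1)).hasFDerivAt.hasFDerivWithinAt
  have hinj : InjOn (transition x x') A := by
    intro y hy z hz h
    have h1 := congrArg (κ x').symm h
    rw [transition, transition, (κ x').left_inv (hx' hy.1), (κ x').left_inv (hx' hz.1)] at h1
    rw [← (κ x).right_inv hy.2, ← (κ x).right_inv hz.2, h1]
  rw [himg, lintegral_image_eq_lintegral_abs_det_fderiv_mul _
    (measurableSet_chart_preimage x hs) hd hinj]
  refine setLIntegral_congr_fun (measurableSet_chart_preimage x hs) fun y hy => ?_
  rw [S.density_transition hy.2 (hx' hy.1), ENNReal.ofReal_mul (abs_nonneg _)]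

theorem Spacetime.chartVolume_compl (x : M) : S.chartVolume x (κ x).sourceᶜ = 0 := by
  rw [S.chartVolume_apply x (isOpen_extChartAt_source x).measurableSet.compl]
  have : (κ x).symm ⁻¹' (κ x).sourceᶜ ∩ (κ x).target = ∅ := by
    ext y
    simp only [mem_inter_iff, mem_preimage, mem_compl_iff, mem_empty_iff_false, iff_false, not_and]
    exact fun h1 h2 => h1 ((κ x).map_target h2)
  rw [this]
  simp

/-- On the domain of a chart, the volume measure is at most the local volume measure. -/
theorem Spacetime.vol_le (x : M) {s : Set M} (hs : MeasurableSet s) (hx : s ⊆ (κ x).source) :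
    S.vol s ≤ S.chartVolume x s := by
  have hm : MeasurableSet (κ x).source := (isOpen_extChartAt_source x).measurableSet
  -- The supremum is dominated by a measure which agrees with `chartVolume x` in the chart domain.
  have h : S.vol ≤ S.chartVolume x + (⊤ : Measure M).restrict (κ x).sourceᶜ := by
    refine iSup_le fun x' => Measure.le_iff.2 fun t ht => ?_
    have hm' : MeasurableSet (κ x').source := (isOpen_extChartAt_source x').measurableSet
    rw [← measure_inter_add_sdiff t hm, Measure.add_apply, Measure.restrict_apply ht]
    refine add_le_add ?_ ?_
    · rw [← measure_inter_add_sdiff (t ∩ (κ x).source) hm',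
        S.chartVolume_eq (x := x') (x' := x) ((ht.inter hm).inter hm') inter_subset_right
          fun y hy => hy.1.2]
      have h0 : S.chartVolume x' ((t ∩ (κ x).source) \ (κ x').source) = 0 :=
        measure_mono_null (fun y hy => hy.2) (S.chartVolume_compl x')
      rw [h0, add_zero]
      exact measure_mono fun y hy => hy.1.1
    · rw [sdiff_eq]
      exact le_top (a := S.chartVolume x') _
  refine (h s).trans ?_
  rw [Measure.add_apply, Measure.restrict_apply hs, ← sdiff_eq, sdiff_eq_empty.2 hx]
  simp

theorem Spacetime.vol_lt_top_of_compact {x : M} {K : Set M} (hK : IsCompact K)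
    (hx : K ⊆ (κ x).source) : S.vol K < ⊤ := by
  refine (S.vol_le x hK.measurableSet hx).trans_lt ?_
  rw [S.chartVolume_apply x hK.measurableSet]
  have himg : (κ x).symm ⁻¹' K ∩ (κ x).target = κ x '' K := by
    rw [inter_comm, ← (κ x).image_source_inter_eq', inter_eq_right.2 hx]
  have hc : IsCompact (κ x '' K) := hK.image_of_continuousOn ((continuousOn_extChartAt x).mono hx)
  have hsub : κ x '' K ⊆ (κ x).target := by
    rintro _ ⟨y, hy, rfl⟩
    exact (κ x).map_source (hx hy)
  rw [himg]
  obtain ⟨C, hC⟩ := hc.exists_bound_of_continuousOn ((S.continuousOn_density x).mono hsub)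
  calc ∫⁻ y in κ x '' K, ENNReal.ofReal (S.density x y)
      ≤ ∫⁻ _y in κ x '' K, ENNReal.ofReal C := setLIntegral_mono' hc.measurableSet fun y hy =>
        ENNReal.ofReal_le_ofReal ((Real.le_norm_self _).trans (hC y hy))
    _ = ENNReal.ofReal C * volume (κ x '' K) := setLIntegral_const _ _
    _ < ⊤ := ENNReal.mul_lt_top ENNReal.ofReal_lt_top hc.measure_lt_top

instance Spacetime.isLocallyFiniteMeasure_vol : IsLocallyFiniteMeasure S.vol := by
  refine ⟨fun x => ?_⟩
  have : LocallyCompactSpace M := ChartedSpace.locallyCompactSpace (Coord d) M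
  obtain ⟨K, hK, hxK, hKs⟩ := exists_compact_subset (isOpen_extChartAt_source (I := 𝓘(ℝ, Coord d)) x)
    (mem_extChartAt_source x)
  exact ⟨K, mem_interior_iff_mem_nhds.1 hxK, S.vol_lt_top_of_compact hK hKs⟩

instance Spacetime.isOpenPosMeasure_vol : Measure.IsOpenPosMeasure S.vol := by
  refine ⟨fun U hU ⟨x, hx⟩ h0 => ?_⟩
  have h1 : S.chartVolume x U = 0 :=
    le_antisymm ((le_iSup S.chartVolume x U).trans h0.le) zero_le
  rw [S.chartVolume_apply x hU.measurableSet, setLIntegral_eq_zero_iff'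
    (measurableSet_chart_preimage x hU.measurableSet)] at h1
  · have ho : IsOpen ((κ x).symm ⁻¹' U ∩ (κ x).target) := by
      rw [inter_comm]
      exact (continuousOn_extChartAt_symm x).isOpen_inter_preimage (isOpen_extChartAt_target x) hU
    have hne : ((κ x).symm ⁻¹' U ∩ (κ x).target).Nonempty :=
      ⟨κ x x, by simpa using hx, mem_extChartAt_target x⟩
    refine (ho.measure_pos volume hne).ne' ?_
    refine measure_mono_null (fun y hy => ?_) (ae_iff.1 h1)
    simp only [mem_ofPred_eq, Classical.not_imp]
    exact ⟨hy, (ENNReal.ofReal_pos.2 (S.density_pos hy.2)).ne'⟩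
  · exact ((S.continuousOn_density x).mono inter_subset_right).aemeasurable
      (measurableSet_chart_preimage x hU.measurableSet) |>.ennreal_ofReal

end Volume

/-! ### Uniqueness of integral kernels -/

section Kernels

variable {d : ℕ} {M : Type*} [TopologicalSpace M] [ChartedSpace (Coord d) M]
  [IsManifold 𝓘(ℝ, Coord d) ∞ M] [T2Space M] [SecondCountableTopology M] [MeasurableSpace M]
  [BorelSpace M] (S : Spacetime d M)

theorem continuous_config (ψ : Config d M) : Continuous fun x => (ψ x : ℂ) :=
  Complex.continuous_ofReal.comp ψ.contMDiff.continuous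

theorem continuous_prod_config {n : ℕ} (ψ : Fin n → Config d M) :
    Continuous fun x : Fin n → M => ∏ i, (ψ i (x i) : ℂ) :=
  continuous_finsetProd _ fun i _ => (continuous_config (ψ i)).comp (continuous_apply i)

theorem integrable_testPow_mul {n : ℕ} (k : TestPow d M n) {h : (Fin n → M) → ℂ}
    (hh : Continuous h) :
    Integrable (fun x => (k : (Fin n → M) → ℂ) x * h x) (Measure.pi fun _ : Fin n => S.vol) :=
  (k.2.1.continuous.mul hh).integrable_of_hasCompactSupport k.2.2.mul_right

/-- A test function on `M^n` is determined by its integrals against products of smooth functions: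
the volume measure charges every nonempty open set, so a nonzero value is detected by a product of
bump functions. -/
theorem testPow_ext {n : ℕ} {k₁ k₂ : TestPow d M n}
    (h : ∀ ψ : Fin n → Config d M,
      ∫ x, (k₁ : (Fin n → M) → ℂ) x * ∏ i, (ψ i (x i) : ℂ) ∂(Measure.pi fun _ => S.vol) =
      ∫ x, (k₂ : (Fin n → M) → ℂ) x * ∏ i, (ψ i (x i) : ℂ) ∂(Measure.pi fun _ => S.vol)) :
    k₁ = k₂ := by
  rw [← sub_eq_zero]
  set k := k₁ - k₂ with hk
  have hzero : ∀ ψ : Fin n → Config d M,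
      ∫ x, (k : (Fin n → M) → ℂ) x * ∏ i, (ψ i (x i) : ℂ) ∂(Measure.pi fun _ => S.vol) = 0 := by
    intro ψ
    have e : ∀ x, (k : (Fin n → M) → ℂ) x * ∏ i, (ψ i (x i) : ℂ) =
        (k₁ : (Fin n → M) → ℂ) x * ∏ i, (ψ i (x i) : ℂ) -
        (k₂ : (Fin n → M) → ℂ) x * ∏ i, (ψ i (x i) : ℂ) := fun x => sub_mul _ _ _
    simp_rw [e]
    rw [integral_sub (integrable_testPow_mul S k₁ (continuous_prod_config ψ))
      (integrable_testPow_mul S k₂ (continuous_prod_config ψ)), h ψ, sub_self]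
  by_contra hne
  obtain ⟨x₀, hx₀⟩ : ∃ x₀, (k : (Fin n → M) → ℂ) x₀ ≠ 0 := by
    by_contra hall
    push Not at hall
    exact hne (Subtype.ext (funext hall))
  have hkc : Continuous (k : (Fin n → M) → ℂ) := k.2.1.continuous
  -- After multiplication with a phase, the real part of `k` is positive near `x₀`.
  set a := (starRingEnd ℂ) ((k : (Fin n → M) → ℂ) x₀) with ha
  set g : (Fin n → M) → ℝ := fun x => (a * (k : (Fin n → M) → ℂ) x).re with hg
  have hgc : Continuous g := Complex.continuous_re.comp (continuous_const.mul hkc)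
  have hgpos : 0 < g x₀ := by
    have : g x₀ = Complex.normSq ((k : (Fin n → M) → ℂ) x₀) := by
      simp only [hg, ha]
      rw [← Complex.normSq_eq_conj_mul_self, Complex.ofReal_re]
    rw [this]
    exact Complex.normSq_pos.2 hx₀
  have hU : {x | 0 < g x} ∈ 𝓝 x₀ := (isOpen_lt continuous_const hgc).mem_nhds hgpos
  rw [nhds_pi, Filter.mem_pi] at hU
  obtain ⟨I, -, t, ht, hsub⟩ := hU
  choose b hb using fun i => (SmoothBumpFunction.nhds_basis_tsupport
    (I := 𝓘(ℝ, Coord d)) (x₀ i)).mem_iff.1 (ht i)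
  set ψ : Fin n → Config d M := fun i => ⟨b i, (b i).contMDiff⟩ with hψ
  have hgψ : Continuous fun x : Fin n → M => g x * ∏ i, b i (x i) :=
    hgc.mul (continuous_finsetProd _ fun i _ => (b i).continuous.comp (continuous_apply i))
  have hnn : 0 ≤ fun x : Fin n → M => g x * ∏ i, b i (x i) := by
    intro x
    by_cases hx : ∀ i, x i ∈ t i
    · exact mul_nonneg (hsub fun i _ => hx i : 0 < g x).le
        (Finset.prod_nonneg fun i _ => (b i).nonneg)
    · push Not at hx
      obtain ⟨i, hi⟩ := hx
      have : b i (x i) = 0 := image_eq_zero_of_notMem_tsupport fun h' => hi ((hb i).2 h')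
      show 0 ≤ g x * ∏ i, b i (x i)
      rw [Finset.prod_eq_zero (f := fun i => b i (x i)) (Finset.mem_univ i) this, mul_zero]
  have hsupp : HasCompactSupport fun x : Fin n → M => g x * ∏ i, b i (x i) := by
    refine HasCompactSupport.mul_right ?_
    refine k.2.2.mono' fun x hx => subset_tsupport _ fun h0 => hx ?_
    simp [hg, h0]
  have hpos := hgψ.integral_pos_of_hasCompactSupport_nonneg_nonzero
    (μ := Measure.pi fun _ : Fin n => S.vol) hsupp hnn (x := x₀) (by simp [hgpos.ne'])
  have hint := (integrable_testPow_mul S k (continuous_prod_config ψ)).const_mul a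
  have : ∫ x, g x * ∏ i, b i (x i) ∂(Measure.pi fun _ : Fin n => S.vol) = 0 := by
    have e : ∀ x : Fin n → M, g x * ∏ i, b i (x i) =
        RCLike.re (a * ((k : (Fin n → M) → ℂ) x * ∏ i, (ψ i (x i) : ℂ))) := by
      intro x
      have : (∏ i, (ψ i (x i) : ℂ)) = ((∏ i, b i (x i) : ℝ) : ℂ) := by
        push_cast
        rfl
      rw [this, ← mul_assoc]
      exact (Complex.re_mul_ofReal _ _).symm
    simp_rw [e]
    rw [integral_re hint, integral_const_mul, hzero ψ]
    simp
  exact hpos.ne' this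

/-- By uniqueness of kernels, the chosen kernel of a functional derivative is any given one. -/
theorem derivKernel_eq {F : Config d M → ℂ} {n : ℕ} {φ : Config d M} {k : TestPow d M n}
    (h : IsDerivKernel S F n φ k) : derivKernel S F n φ = k := by
  have hex : ∃ k, IsDerivKernel S F n φ k := ⟨k, h⟩
  rw [derivKernel, dif_pos hex]
  exact testPow_ext S fun ψ => (hex.choose_spec ψ).symm.trans (h ψ)

end Kernels

/-! ### Frames: systems of test functions in which all test functions expand -/

section Frame

variable {d : ℕ} {M : Type*} [TopologicalSpace M] [ChartedSpace (Coord d) M]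
  [IsManifold 𝓘(ℝ, Coord d) ∞ M]

/-- A system of test functions `e b` on `M` with weights `wt b ≥ 1` such that every test function
on `M^n` supported in `K^n` is the sum of a rapidly convergent series of tensor products of the
`e b`, and such that distributions can be applied to rapidly convergent series of tensor products
term by term. The index sets of the series are arbitrary; convergence is controlled by weights `u`
which dominate the weights of all factors. -/
structure Frame (d : ℕ) {M : Type*} [TopologicalSpace M] [ChartedSpace (Coord d) M]
    (K : Set M) where
  /-- the index set -/
  B : Type
  /-- the test functions -/
  e : B → Test d M
  /-- the weights -/
  wt : B → ℝ
  one_le_wt : ∀ b, 1 ≤ wt b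
  /-- the index of the complex conjugate function -/
  conj : B → B
  e_conj : ∀ b, e (conj b) = testConj (e b)
  wt_conj : ∀ b, wt (conj b) = wt b
  norm_le : ∀ b x, ‖(e b : M → ℂ) x‖ ≤ 1
  /-- a compact set containing all supports -/
  supp : Set M
  isCompact_supp : IsCompact supp
  eq_zero : ∀ b, ∀ x ∉ supp, (e b : M → ℂ) x = 0
  bi_bound : ∀ W : BiDistr d M, ∃ (N : ℕ) (C : ℝ), ∀ b b',
    ‖W.toLinear (tensor (e b) (e b'))‖ ≤ C * (wt b * wt b') ^ N
  bi_sum : ∀ {J : Type} {u : J → ℝ} {c : J → ℂ} {b b' : J → B}, Rapid u c → (∀ j, 1 ≤ u j) →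
    (∀ j, wt (b j) ≤ u j) → (∀ j, wt (b' j) ≤ u j) →
    ∃ h : (fun p : M × M => ∑' j, c j * ((e (b j) : M → ℂ) p.1 * (e (b' j) : M → ℂ) p.2)) ∈
      TestFn (𝓘(ℝ, Coord d).prod 𝓘(ℝ, Coord d)) (M × M),
      ∀ W : BiDistr d M, HasSum (fun j => c j * W.toLinear (tensor (e (b j)) (e (b' j))))
        (W.toLinear ⟨_, h⟩)
  pow_mem : ∀ {n : ℕ} {J : Type} {u : J → ℝ} {c : J → ℂ} {P : J → Fin n → B}, Rapid u c →
    (∀ j, 1 ≤ u j) → (∀ j i, wt (P j i) ≤ u j) →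
    (fun x : Fin n → M => ∑' j, c j * ∏ i, (e (P j i) : M → ℂ) (x i)) ∈ TestPow d M n
  expand : ∀ {n : ℕ} (f : TestPow d M n), tsupport (f : (Fin n → M) → ℂ) ⊆ univ.pi (fun _ => K) →
    ∃ (J : Type) (_ : Countable J) (u : J → ℝ) (c : J → ℂ) (P : J → Fin n → B),
      Rapid u c ∧ (∀ j, 1 ≤ u j) ∧
      (∀ j i, wt (P j i) ≤ u j) ∧
      ∀ x, (f : (Fin n → M) → ℂ) x = ∑' j, c j * ∏ i, (e (P j i) : M → ℂ) (x i)

end Frame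

/-! ### Existence of frames -/

section BumpCover

variable {d : ℕ} {M : Type*} [TopologicalSpace M] [ChartedSpace (Coord d) M]
  [IsManifold 𝓘(ℝ, Coord d) ∞ M] [T2Space M] [SecondCountableTopology M]

local notation "κ" => extChartAt 𝓘(ℝ, Coord d)

/-- Finitely many bump functions, each supported in the domain of a chart, and a partition of unity
near `K` supported where the bump functions are one. The number `R` bounds the size of the supports
in the charts. -/
structure BumpCover (d : ℕ) {M : Type*} [TopologicalSpace M] [ChartedSpace (Coord d) M]
    (K : Set M) where
  /-- the number of bump functions -/
  N : ℕ
  /-- the centres -/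
  ctr : Fin N → M
  /-- the bump functions -/
  bump : ∀ a, SmoothBumpFunction 𝓘(ℝ, Coord d) (ctr a)
  /-- four times a bound on coordinates in the supports -/
  R : ℝ
  R_pos : 0 < R
  coord_le : ∀ a, ∀ x ∈ tsupport (bump a), ∀ i, |extChartAt 𝓘(ℝ, Coord d) (ctr a) x i| ≤ R / 4
  /-- the partition of unity -/
  part : SmoothPartitionOfUnity (Fin N) 𝓘(ℝ, Coord d) M K
  bump_eq_one : ∀ a, ∀ x ∈ tsupport (part a), bump a x = 1

theorem exists_bumpCover {K : Set M} (hK : IsCompact K) : Nonempty (BumpCover d K) := by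
  have : LocallyCompactSpace M := ChartedSpace.locallyCompactSpace (Coord d) M
  have hex : ∀ x : M, Nonempty (SmoothBumpFunction 𝓘(ℝ, Coord d) x) := fun x =>
    let ⟨f, _⟩ := (SmoothBumpFunction.nhds_basis_tsupport (I := 𝓘(ℝ, Coord d)) x).ex_mem
    ⟨f⟩
  let β : ∀ x : M, SmoothBumpFunction 𝓘(ℝ, Coord d) x := fun x => (hex x).some
  have hone : ∀ x, {y | β x y = 1} ∈ 𝓝 x := fun x => (β x).eventuallyEq_one
  obtain ⟨t, htK, hcov⟩ := hK.elim_nhds_subcover (fun x => interior {y | β x y = 1})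
    fun x _ => interior_mem_nhds.2 (hone x)
  let q := t.equivFin
  let ctr : Fin t.card → M := fun a => (q.symm a : M)
  obtain ⟨ρ, hρ⟩ := SmoothPartitionOfUnity.exists_isSubordinate 𝓘(ℝ, Coord d) hK.isClosed
    (fun a : Fin t.card => interior {y | β (ctr a) y = 1}) (fun _ => isOpen_interior) (by
      intro x hx
      obtain ⟨y, hy, hxy⟩ := mem_iUnion₂.1 (hcov hx)
      refine mem_iUnion.2 ⟨q ⟨y, hy⟩, ?_⟩
      have e : ctr (q ⟨y, hy⟩) = y := by simp [ctr]
      rw [e]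
      exact hxy)
  have hbd : ∀ a : Fin t.card, ∃ R : ℝ, ∀ x ∈ tsupport (β (ctr a)), ‖κ (ctr a) x‖ ≤ R := fun a =>
    IsCompact.exists_bound_of_continuousOn (β (ctr a)).hasCompactSupport
      ((continuousOn_extChartAt (ctr a)).mono (β (ctr a)).tsupport_subset_extChartAt_source)
  choose R hR using hbd
  refine ⟨⟨t.card, ctr, fun a => β (ctr a), 4 * (1 + ∑ a, |R a|), ?_, ?_, ρ, ?_⟩⟩
  · have : 0 ≤ ∑ a, |R a| := Finset.sum_nonneg fun _ _ => abs_nonneg _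
    linarith
  · intro a x hx i
    have h1 : |κ (ctr a) x i| ≤ ‖κ (ctr a) x‖ := PiLp.norm_apply_le (κ (ctr a) x) i
    have h2 := hR a x hx
    have h3 : |R a| ≤ ∑ a, |R a| :=
      Finset.single_le_sum (f := fun a => |R a|) (fun _ _ => abs_nonneg _) (Finset.mem_univ a)
    have h4 := le_abs_self (R a)
    linarith
  · intro a x hx
    exact interior_subset (s := {y | β (ctr a) y = 1}) (hρ a hx)

theorem contMDiff_eval {n : ℕ} (i : Fin n) :
    ContMDiff (ModelWithCorners.pi fun _ : Fin n => 𝓘(ℝ, Coord d)) 𝓘(ℝ, Coord d) ∞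
      (fun x : Fin n → M => x i) := by
  intro x
  rw [contMDiffAt_iff]
  refine ⟨(continuous_apply i).continuousAt, ?_⟩
  have hp : ContDiffWithinAt ℝ ∞ (fun v : Fin n → Coord d => v i)
      (range (ModelWithCorners.pi fun _ : Fin n => 𝓘(ℝ, Coord d)))
      (extChartAt (ModelWithCorners.pi fun _ : Fin n => 𝓘(ℝ, Coord d)) x x) :=
    (contDiff_apply ℝ (Coord d) i).contDiffWithinAt
  refine hp.congr_of_eventuallyEq ?_ ?_
  · filter_upwards [extChartAt_target_mem_nhdsWithin x] with v hv
    exact congrFun ((extChartAt (ModelWithCorners.pi fun _ : Fin n => 𝓘(ℝ, Coord d)) x).right_inv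
      hv) i
  · exact congrFun ((extChartAt (ModelWithCorners.pi fun _ : Fin n => 𝓘(ℝ, Coord d)) x).right_inv
      (mem_extChartAt_target x)) i

theorem contMDiffAt_pi_chart_symm {n : ℕ} (x₀ : Fin n → M) {u : Fin n → Coord d}
    (hu : ∀ i, u i ∈ (κ (x₀ i)).target) :
    ContMDiffAt 𝓘(ℝ, Fin n → Coord d) (ModelWithCorners.pi fun _ : Fin n => 𝓘(ℝ, Coord d)) ∞
      (fun u : Fin n → Coord d => fun i => (κ (x₀ i)).symm (u i)) u := by
  have hs : ∀ i, ContMDiffAt 𝓘(ℝ, Coord d) 𝓘(ℝ, Coord d) ∞ (κ (x₀ i)).symm (u i) := fun i =>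
    (contMDiffOn_extChartAt_symm (n := ∞) (x₀ i)).contMDiffAt
      ((isOpen_extChartAt_target (x₀ i)).mem_nhds (hu i))
  rw [contMDiffAt_iff]
  refine ⟨continuousAt_pi.2 fun i => (hs i).continuousAt.comp
    (f := fun u : Fin n → Coord d => u i) (continuous_apply i).continuousAt, ?_⟩
  refine contDiffWithinAt_pi.2 fun i => ContDiffAt.contDiffWithinAt (x := u) ?_
  have h1 : ContMDiffAt 𝓘(ℝ, Coord d) 𝓘(ℝ, Coord d) ∞
      (fun v => κ ((κ (x₀ i)).symm (u i)) ((κ (x₀ i)).symm v)) (u i) :=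
    ContMDiffAt.comp (u i) (contMDiffAt_extChartAt (I := 𝓘(ℝ, Coord d))
      (x := (κ (x₀ i)).symm (u i))) (hs i)
  exact ContDiffAt.comp u (f := fun u : Fin n → Coord d => u i) h1.contDiffAt
    (contDiff_apply ℝ (Coord d) i).contDiffAt

namespace BumpCover

variable {K : Set M} (A : BumpCover d K)

/-- The linear form `v ↦ (2π/R) ∑ ξᵢ vᵢ`. -/
def freq (ξ : Fin d → ℤ) : Coord d →L[ℝ] ℝ :=
  ∑ i, (2 * Real.pi / A.R * ξ i) • EuclideanSpace.proj (𝕜 := ℝ) i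

theorem freq_apply (ξ : Fin d → ℤ) (v : Coord d) :
    A.freq ξ v = 2 * Real.pi * ∑ i, ξ i * (v i / A.R) := by
  simp only [freq, sum_apply, smul_apply, smul_eq_mul, Finset.mul_sum]
  refine Finset.sum_congr rfl fun i _ => ?_
  rw [show (EuclideanSpace.proj i : Coord d →L[ℝ] ℝ) v = v i from rfl]
  ring

/-- A constant bounding the frequencies `freq ξ` in terms of `ξ`. -/
def freqConst : ℝ := d * (2 * Real.pi / A.R)

theorem freqConst_nonneg : 0 ≤ A.freqConst := by
  have := A.R_pos
  unfold freqConst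
  positivity

theorem norm_freq_le (ξ : Fin d → ℤ) : ‖A.freq ξ‖ ≤ A.freqConst * (1 + ‖ξ‖) := by
  have hR := A.R_pos
  calc ‖A.freq ξ‖ ≤ ∑ i, ‖(2 * Real.pi / A.R * ξ i) • EuclideanSpace.proj (𝕜 := ℝ) i‖ :=
        norm_sum_le _ _
    _ ≤ ∑ _i : Fin d, 2 * Real.pi / A.R * (1 + ‖ξ‖) := by
        refine Finset.sum_le_sum fun i _ => ?_
        rw [norm_smul, norm_mul, Real.norm_of_nonneg (by positivity)]
        have h1 : ‖(EuclideanSpace.proj i : Coord d →L[ℝ] ℝ)‖ ≤ 1 :=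
          ContinuousLinearMap.opNorm_le_bound _ zero_le_one fun v => by
            simpa using PiLp.norm_apply_le v i
        have h2 : ‖(ξ i : ℝ)‖ ≤ 1 + ‖ξ‖ := by
          have := norm_le_pi_norm ξ i
          rw [Int.norm_eq_abs] at this
          rw [Real.norm_eq_abs]
          linarith
        calc _ ≤ 2 * Real.pi / A.R * (1 + ‖ξ‖) * 1 := by gcongr
          _ = _ := mul_one _
    _ = _ := by simp [freqConst, mul_assoc]

/-- The bump function as a complex test function. -/
def cutoff (a : Fin A.N) : Test d M :=
  ⟨fun x => (A.bump a x : ℂ), Complex.ofRealCLM.contDiff.contMDiff.comp (A.bump a).contMDiff,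
    (A.bump a).hasCompactSupport.comp_left Complex.ofReal_zero⟩

theorem tsupport_cutoff (a : Fin A.N) :
    tsupport (A.cutoff a : M → ℂ) = tsupport (A.bump a) := by
  have : Function.support (A.cutoff a : M → ℂ) = Function.support (A.bump a) := by
    ext x
    simp [cutoff]
  rw [tsupport, this, tsupport]

theorem tsupport_cutoff_subset (a : Fin A.N) :
    tsupport (A.cutoff a : M → ℂ) ⊆ (chartAt (Coord d) (A.ctr a)).source := by
  rw [tsupport_cutoff]
  exact (A.bump a).tsupport_subset_chartAt_source

theorem cutoff_eq_zero {a : Fin A.N} {x : M} (hx : x ∉ tsupport (A.bump a)) :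
    (A.cutoff a : M → ℂ) x = 0 := by
  rw [← tsupport_cutoff] at hx
  exact image_eq_zero_of_notMem_tsupport hx

/-- The functions `bump a · e^{i ⟨freq ξ, ·⟩}`. -/
def elem (b : Fin A.N × (Fin d → ℤ)) : Test d M :=
  ⟨oscFun 𝓘(ℝ, Coord d) (A.ctr b.1) (A.cutoff b.1) (A.freq b.2),
    oscFun_mem _ _ (A.tsupport_cutoff_subset b.1) _⟩

theorem elem_apply (b : Fin A.N × (Fin d → ℤ)) (x : M) :
    (A.elem b : M → ℂ) x = (A.cutoff b.1 : M → ℂ) x * wave (A.freq b.2) (κ (A.ctr b.1) x) := rfl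

/-- The function on `M × M` which is `f` in the charts, multiplied with bump functions. -/
def cut (a a' : Fin A.N) (f : Coord d × Coord d → ℂ) (p : M × M) : ℂ :=
  (A.cutoff a : M → ℂ) p.1 * (A.cutoff a' : M → ℂ) p.2 * f (κ (A.ctr a) p.1, κ (A.ctr a') p.2)

theorem contMDiff_mul_complex {E' H' X : Type*} [NormedAddCommGroup E'] [NormedSpace ℝ E']
    [TopologicalSpace H'] {I : ModelWithCorners ℝ E' H'} [TopologicalSpace X] [ChartedSpace H' X]
    {f g : X → ℂ} {x : X} (hf : ContMDiffAt I 𝓘(ℝ, ℂ) ∞ f x) (hg : ContMDiffAt I 𝓘(ℝ, ℂ) ∞ g x) :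
    ContMDiffAt I 𝓘(ℝ, ℂ) ∞ (fun x => f x * g x) x := by
  have hm : ContDiff ℝ ∞ (fun z : ℂ × ℂ => z.1 * z.2) := contDiff_fst.mul contDiff_snd
  exact hm.contMDiff.contMDiffAt.comp x (hf.prodMk_space hg)

theorem cut_mem (a a' : Fin A.N) {f : Coord d × Coord d → ℂ} (hf : ContDiff ℝ ∞ f) :
    A.cut a a' f ∈ TestFn (𝓘(ℝ, Coord d).prod 𝓘(ℝ, Coord d)) (M × M) := by
  have ht := (tensor (A.cutoff a) (A.cutoff a')).2
  refine ⟨contMDiff_of_tsupport fun p hp => ?_, ht.2.mul_right⟩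
  have hp1 : p.1 ∈ tsupport (A.bump a) := by
    by_contra h
    refine absurd hp (notMem_tsupport_iff_eventuallyEq.2 ?_)
    filter_upwards [((isClosed_tsupport _).isOpen_compl.preimage continuous_fst).mem_nhds
      (show p ∈ Prod.fst ⁻¹' (tsupport (A.bump a))ᶜ from h)] with q hq
    simp [cut, A.cutoff_eq_zero hq]
  have hp2 : p.2 ∈ tsupport (A.bump a') := by
    by_contra h
    refine absurd hp (notMem_tsupport_iff_eventuallyEq.2 ?_)
    filter_upwards [((isClosed_tsupport _).isOpen_compl.preimage continuous_snd).mem_nhds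
      (show p ∈ Prod.snd ⁻¹' (tsupport (A.bump a'))ᶜ from h)] with q hq
    simp [cut, A.cutoff_eq_zero hq]
  refine contMDiff_mul_complex (ht.1 p) ?_
  refine hf.contMDiff.contMDiffAt.comp p (ContMDiffAt.prodMk_space ?_ ?_)
  · exact (contMDiffAt_extChartAt' ((A.bump a).tsupport_subset_chartAt_source hp1)).comp p
      contMDiffAt_fst
  · exact (contMDiffAt_extChartAt' ((A.bump a').tsupport_subset_chartAt_source hp2)).comp p
      contMDiffAt_snd

theorem tsupport_cut (a a' : Fin A.N) (f : Coord d × Coord d → ℂ) :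
    tsupport (A.cut a a' f) ⊆ tsupport (A.bump a) ×ˢ tsupport (A.bump a') := by
  refine closure_minimal (fun p hp => ?_) ((isClosed_tsupport _).prod (isClosed_tsupport _))
  refine ⟨?_, ?_⟩
  · by_contra h
    exact hp (by simp [cut, A.cutoff_eq_zero h])
  · by_contra h
    exact hp (by simp [cut, A.cutoff_eq_zero h])

end BumpCover

end BumpCover

/-! ### Evaluation of distributions -/

section Evaluation

variable {E H X : Type*} [NormedAddCommGroup E] [NormedSpace ℝ E] [TopologicalSpace H]
  [TopologicalSpace X] [ChartedSpace H X] {I : ModelWithCorners ℝ E H} (T : Distr I X)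

theorem Distr.eval_of_mem {f : X → ℂ} (hf : f ∈ TestFn I X) : T.eval f = T.toLinear ⟨f, hf⟩ :=
  dif_pos hf

theorem Distr.eval_add {f g : X → ℂ} (hf : f ∈ TestFn I X) (hg : g ∈ TestFn I X) :
    T.eval (f + g) = T.eval f + T.eval g := by
  rw [T.eval_of_mem hf, T.eval_of_mem hg, T.eval_of_mem (add_mem hf hg), ← map_add]
  rfl

theorem Distr.eval_smul (c : ℂ) {f : X → ℂ} (hf : f ∈ TestFn I X) :
    T.eval (c • f) = c * T.eval f := by
  rw [T.eval_of_mem hf, T.eval_of_mem (Submodule.smul_mem _ c hf), ← smul_eq_mul, ← map_smul]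
  rfl

theorem Distr.eval_sum {ι : Type*} (s : Finset ι) {f : ι → X → ℂ} (hf : ∀ q, f q ∈ TestFn I X) :
    T.eval (∑ q ∈ s, f q) = ∑ q ∈ s, T.eval (f q) := by
  rw [T.eval_of_mem (Submodule.sum_mem _ fun q _ => hf q)]
  simp only [fun q => T.eval_of_mem (hf q)]
  rw [← map_sum]
  congr 1
  exact Subtype.ext (Submodule.coe_sum _ (fun q => (⟨f q, hf q⟩ : TestFn I X)) s).symm

/-- A family of coefficients is the sum of its restrictions to the fibres of a map. -/
theorem sum_fiber_indicator {J Q : Type*} [Fintype Q] (p : J → Q) (c : J → ℂ)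
    (T : Q → ℂ) (j : J) : ∑ q, {j | p j = q}.indicator c j * T q = c j * T (p j) := by
  classical
  rw [Finset.sum_eq_single (p j)]
  · rw [indicator_of_mem (show j ∈ {j' | p j' = p j} from rfl)]
  · intro q _ hq
    rw [indicator_of_notMem (s := {j | p j = q}) (fun h : p j = q => hq h.symm), zero_mul]
  · simp

end Evaluation

/-! ### Frames of localized plane waves -/

section BumpCover

variable {d : ℕ} {M : Type*} [TopologicalSpace M] [ChartedSpace (Coord d) M]
  [IsManifold 𝓘(ℝ, Coord d) ∞ M] [T2Space M] [SecondCountableTopology M]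

local notation "κ" => extChartAt 𝓘(ℝ, Coord d)

namespace BumpCover

variable {K : Set M} (A : BumpCover d K)

/-- The bump functions `bump a ⊗ bump a'` in the charts. -/
def coordBump (a a' : Fin A.N) (z : Coord d × Coord d) : ℂ :=
  (((A.bump a).toContDiffBump z.1 * (A.bump a').toContDiffBump z.2 : ℝ) : ℂ)

theorem contDiff_coordBump (a a' : Fin A.N) : ContDiff ℝ ∞ (A.coordBump a a') :=
  Complex.ofRealCLM.contDiff.comp (((A.bump a).toContDiffBump.contDiff.comp contDiff_fst).mul
    ((A.bump a').toContDiffBump.contDiff.comp contDiff_snd))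

theorem hasCompactSupport_coordBump (a a' : Fin A.N) : HasCompactSupport (A.coordBump a a') := by
  refine HasCompactSupport.intro (K := tsupport (A.bump a).toContDiffBump ×ˢ
    tsupport (A.bump a').toContDiffBump)
    ((A.bump a).toContDiffBump.hasCompactSupport.isCompact.prod
      (A.bump a').toContDiffBump.hasCompactSupport.isCompact) fun z hz => ?_
  rw [mem_prod, not_and_or] at hz
  rcases hz with hz | hz
  · rw [coordBump, image_eq_zero_of_notMem_tsupport hz, zero_mul, Complex.ofReal_zero]
  · rw [coordBump, image_eq_zero_of_notMem_tsupport hz, mul_zero, Complex.ofReal_zero]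

theorem cut_comp_chart_symm (a a' : Fin A.N) (f : Coord d × Coord d → ℂ) {z : Coord d × Coord d}
    (hz : z.1 ∈ (κ (A.ctr a)).target) (hz' : z.2 ∈ (κ (A.ctr a')).target) :
    A.cut a a' f ((κ (A.ctr a)).symm z.1, (κ (A.ctr a')).symm z.2) =
      A.coordBump a a' z * f z := by
  have h1 : (A.bump a) ((κ (A.ctr a)).symm z.1) = (A.bump a).toContDiffBump z.1 := by
    rw [(A.bump a).eqOn_source (by simpa using (κ (A.ctr a)).map_target hz), Function.comp,
      (κ (A.ctr a)).right_inv hz]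
  have h2 : (A.bump a') ((κ (A.ctr a')).symm z.2) = (A.bump a').toContDiffBump z.2 := by
    rw [(A.bump a').eqOn_source (by simpa using (κ (A.ctr a')).map_target hz'), Function.comp,
      (κ (A.ctr a')).right_inv hz']
  simp only [cut, cutoff, coordBump, h1, h2, (κ (A.ctr a)).right_inv hz,
    (κ (A.ctr a')).right_inv hz']
  push_cast
  rfl

/-- A distribution, applied to a smooth function of the coordinates cut off by bump functions, is
bounded by finitely many derivatives of that function. -/
theorem cut_bound (W : BiDistr d M) (a a' : Fin A.N) :
    ∃ (N : ℕ) (C : ℝ), ∀ (f : Coord d × Coord d → ℂ) (_ : ContDiff ℝ ∞ f) (B : ℝ),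
      (∀ k ≤ N, ∀ z, ‖iteratedFDeriv ℝ k f z‖ ≤ B) → ‖W.eval (A.cut a a' f)‖ ≤ C * B := by
  have hsub : tsupport (A.bump a) ×ˢ tsupport (A.bump a') ⊆
      (chartAt (ModelProd (Coord d) (Coord d)) (A.ctr a, A.ctr a')).source := by
    rw [prodChartedSpace_chartAt, OpenPartialHomeomorph.prod_source]
    exact prod_mono (A.bump a).tsupport_subset_chartAt_source
      (A.bump a').tsupport_subset_chartAt_source
  obtain ⟨N, C, hC⟩ := W.bound (A.ctr a, A.ctr a') (tsupport (A.bump a) ×ˢ tsupport (A.bump a'))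
    ((A.bump a).hasCompactSupport.isCompact.prod (A.bump a').hasCompactSupport.isCompact) hsub
  have hD : ∀ k : ℕ, ∃ D : ℝ, ∀ z, ‖iteratedFDeriv ℝ k (A.coordBump a a') z‖ ≤ D := fun k =>
    ((A.hasCompactSupport_coordBump a a').iteratedFDeriv k).exists_bound_of_continuous
      ((A.contDiff_coordBump a a').continuous_iteratedFDeriv (m := k) (by exact_mod_cast le_top))
  choose D hD using hD
  have hD0 : ∀ k, 0 ≤ D k := fun k => (norm_nonneg _).trans (hD k 0)
  set D' := ∑ k ∈ Finset.range (N + 1), D k with hD'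
  have hDD : ∀ k ≤ N, D k ≤ D' := fun k hk =>
    Finset.single_le_sum (f := D) (fun k _ => hD0 k) (Finset.mem_range.2 (Nat.lt_succ_of_le hk))
  have hD'0 : 0 ≤ D' := Finset.sum_nonneg fun k _ => hD0 k
  refine ⟨N, C * (2 ^ N * D'), fun f hf B hB => ?_⟩
  have hB0 : 0 ≤ B := (norm_nonneg _).trans (hB 0 (Nat.zero_le _) 0)
  rw [Distr.eval, dif_pos (A.cut_mem a a' hf), mul_assoc]
  refine hC ⟨_, A.cut_mem a a' hf⟩ (A.tsupport_cut a a' f) _ fun k hk y hy => ?_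
  have hy1 : y.1 ∈ (κ (A.ctr a)).source :=
    (A.bump a).tsupport_subset_extChartAt_source hy.1
  have hy2 : y.2 ∈ (κ (A.ctr a')).source :=
    (A.bump a').tsupport_subset_extChartAt_source hy.2
  have hev : (A.cut a a' f) ∘ (extChartAt (𝓘(ℝ, Coord d).prod 𝓘(ℝ, Coord d))
      (A.ctr a, A.ctr a')).symm =ᶠ[𝓝 (extChartAt (𝓘(ℝ, Coord d).prod 𝓘(ℝ, Coord d))
      (A.ctr a, A.ctr a') y)] fun z => A.coordBump a a' z * f z := by
    rw [extChartAt_prod]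
    have ho : IsOpen ((κ (A.ctr a)).target ×ˢ (κ (A.ctr a')).target) :=
      (isOpen_extChartAt_target _).prod (isOpen_extChartAt_target _)
    filter_upwards [ho.mem_nhds (show (κ (A.ctr a) y.1, κ (A.ctr a') y.2) ∈ _ from
      ⟨(κ (A.ctr a)).map_source hy1, (κ (A.ctr a')).map_source hy2⟩)] with z hz
    exact A.cut_comp_chart_symm a a' f hz.1 hz.2
  rw [(hev.iteratedFDeriv ℝ k).self_of_nhds]
  refine (norm_iteratedFDeriv_mul_le (A.contDiff_coordBump a a') hf _ (n := k)
    (by exact_mod_cast le_top)).trans ?_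
  calc ∑ i ∈ Finset.range (k + 1), (k.choose i : ℝ) *
        ‖iteratedFDeriv ℝ i (A.coordBump a a') _‖ * ‖iteratedFDeriv ℝ (k - i) f _‖
      ≤ ∑ i ∈ Finset.range (k + 1), (k.choose i : ℝ) * D' * B := by
        refine Finset.sum_le_sum fun i hi => ?_
        have hi' : i ≤ N := (Nat.lt_succ_iff.1 (Finset.mem_range.1 hi)).trans hk
        gcongr
        · exact (hD i _).trans (hDD i hi')
        · exact hB _ ((Nat.sub_le _ _).trans hk) _
    _ = 2 ^ k * (D' * B) := by
        rw [← Finset.sum_mul, ← Finset.sum_mul, ← Nat.cast_sum, Nat.sum_range_choose]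
        push_cast
        ring
    _ ≤ 2 ^ N * (D' * B) := by
        gcongr
        norm_num
    _ = 2 ^ N * D' * B := by ring

theorem eval_cut_add (W : BiDistr d M) (a a' : Fin A.N) {f g : Coord d × Coord d → ℂ}
    (hf : ContDiff ℝ ∞ f) (hg : ContDiff ℝ ∞ g) :
    W.eval (A.cut a a' (f + g)) = W.eval (A.cut a a' f) + W.eval (A.cut a a' g) := by
  rw [← W.eval_add (A.cut_mem a a' hf) (A.cut_mem a a' hg)]
  congr 1
  funext p
  exact mul_add _ _ _

theorem eval_cut_smul (W : BiDistr d M) (a a' : Fin A.N) (c : ℂ) {f : Coord d × Coord d → ℂ}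
    (hf : ContDiff ℝ ∞ f) : W.eval (A.cut a a' (c • f)) = c * W.eval (A.cut a a' f) := by
  rw [← W.eval_smul c (A.cut_mem a a' hf)]
  congr 1
  funext p
  exact mul_left_comm _ _ _

/-- The frequency of the tensor product of two frame functions. -/
def biFreq (ξ η : Fin d → ℤ) : Coord d × Coord d →L[ℝ] ℝ :=
  (A.freq ξ).comp (ContinuousLinearMap.fst ℝ _ _) + (A.freq η).comp (ContinuousLinearMap.snd ℝ _ _)

theorem norm_biFreq_le (ξ η : Fin d → ℤ) :
    ‖A.biFreq ξ η‖ ≤ A.freqConst * (1 + ‖ξ‖) + A.freqConst * (1 + ‖η‖) := by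
  refine (norm_add_le _ _).trans (add_le_add ?_ ?_)
  · refine (ContinuousLinearMap.opNorm_comp_le _ _).trans ?_
    refine (mul_le_of_le_one_right (norm_nonneg _) (ContinuousLinearMap.norm_fst_le ..)).trans
      (A.norm_freq_le ξ)
  · refine (ContinuousLinearMap.opNorm_comp_le _ _).trans ?_
    refine (mul_le_of_le_one_right (norm_nonneg _) (ContinuousLinearMap.norm_snd_le ..)).trans
      (A.norm_freq_le η)

theorem tensor_elem (b b' : Fin A.N × (Fin d → ℤ)) :
    (tensor (A.elem b) (A.elem b') : M × M → ℂ) =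
      A.cut b.1 b'.1 (wave (A.biFreq b.2 b'.2)) := by
  funext p
  have : wave (A.biFreq b.2 b'.2) (κ (A.ctr b.1) p.1, κ (A.ctr b'.1) p.2) =
      wave (A.freq b.2) (κ (A.ctr b.1) p.1) * wave (A.freq b'.2) (κ (A.ctr b'.1) p.2) := by
    rw [wave, wave, wave, ← Complex.exp_add, ← mul_add, ← Complex.ofReal_add]
    rfl
  simp only [tensor, elem_apply, cut, this]
  ring

theorem apply_tensor_elem (W : BiDistr d M) (b b' : Fin A.N × (Fin d → ℤ)) :
    W.toLinear (tensor (A.elem b) (A.elem b')) =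
      W.eval (A.cut b.1 b'.1 (wave (A.biFreq b.2 b'.2))) := by
  rw [← tensor_elem, Distr.eval, dif_pos (tensor (A.elem b) (A.elem b')).2]

/-- The derivatives of a plane wave, hence the values of a distribution on localized plane waves,
grow polynomially in the frequency. -/
theorem elem_bi_bound (W : BiDistr d M) : ∃ (N : ℕ) (C : ℝ), ∀ b b',
    ‖W.toLinear (tensor (A.elem b) (A.elem b'))‖ ≤ C * ((1 + ‖b.2‖) * (1 + ‖b'.2‖)) ^ N := by
  choose N C hC using fun q : Fin A.N × Fin A.N => A.cut_bound W q.1 q.2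
  set N' := ∑ q, N q
  set D : ℝ := 1 + 2 * A.freqConst with hD
  have hF := A.freqConst_nonneg
  have hD1 : 1 ≤ D := by linarith
  refine ⟨N', (∑ q, |C q|) * D ^ N', fun b b' => ?_⟩
  set X := (1 + ‖b.2‖) * (1 + ‖b'.2‖) with hX
  have hb : (1 : ℝ) ≤ 1 + ‖b.2‖ := by linarith [norm_nonneg b.2]
  have hb' : (1 : ℝ) ≤ 1 + ‖b'.2‖ := by linarith [norm_nonneg b'.2]
  have hX1 : 1 ≤ X := one_le_mul_of_one_le_of_one_le hb hb'
  have hL : ‖A.biFreq b.2 b'.2‖ ≤ D * X := by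
    refine (A.norm_biFreq_le _ _).trans ?_
    have h1 : 1 + ‖b.2‖ ≤ X := le_mul_of_one_le_right (by linarith) hb'
    have h2 : 1 + ‖b'.2‖ ≤ X := le_mul_of_one_le_left (by linarith) hb
    calc _ ≤ A.freqConst * X + A.freqConst * X := by gcongr
      _ ≤ D * X := by rw [hD]; linarith
  have hDX : 1 ≤ D * X := one_le_mul_of_one_le_of_one_le hD1 hX1
  have hq : N (b.1, b'.1) ≤ N' :=
    Finset.single_le_sum (f := N) (fun _ _ => Nat.zero_le _) (Finset.mem_univ (b.1, b'.1))
  have h := hC (b.1, b'.1) (wave (A.biFreq b.2 b'.2)) (contDiff_wave _) ((D * X) ^ N')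
    fun k hk z => (norm_iteratedFDeriv_wave_le _ k z).trans <| by
      calc ‖A.biFreq b.2 b'.2‖ ^ k ≤ (D * X) ^ k := by gcongr
        _ ≤ (D * X) ^ N' := pow_le_pow_right₀ hDX (hk.trans hq)
  rw [apply_tensor_elem]
  calc _ ≤ C (b.1, b'.1) * (D * X) ^ N' := h
    _ ≤ (∑ q, |C q|) * (D * X) ^ N' := by
        gcongr
        exact (le_abs_self _).trans (Finset.single_le_sum (f := fun q => |C q|)
          (fun _ _ => abs_nonneg _) (Finset.mem_univ (b.1, b'.1)))
    _ = _ := by rw [mul_pow, mul_assoc]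

/-- Distributions can be applied term by term to rapidly convergent series of tensor products of
localized plane waves. There are finitely many pairs of charts; in each of them the series is a
trigonometric series. -/
theorem elem_bi_sum {J : Type} {u : J → ℝ} {c : J → ℂ} {b b' : J → Fin A.N × (Fin d → ℤ)}
    (hc : Rapid u c) (hu : ∀ j, 1 ≤ u j) (hb : ∀ j, 1 + ‖(b j).2‖ ≤ u j)
    (hb' : ∀ j, 1 + ‖(b' j).2‖ ≤ u j) :
    ∃ h : (fun p : M × M => ∑' j, c j * ((A.elem (b j) : M → ℂ) p.1 *
        (A.elem (b' j) : M → ℂ) p.2)) ∈ TestFn (𝓘(ℝ, Coord d).prod 𝓘(ℝ, Coord d)) (M × M),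
      ∀ W : BiDistr d M, HasSum (fun j => c j * W.toLinear
        (tensor (A.elem (b j)) (A.elem (b' j)))) (W.toLinear ⟨_, h⟩) := by
  classical
  have hu0 : ∀ j, 0 ≤ u j := fun j => zero_le_one.trans (hu j)
  set L : J → Coord d × Coord d →L[ℝ] ℝ := fun j => A.biFreq (b j).2 (b' j).2 with hLdef
  have hF := A.freqConst_nonneg
  have hL : ∀ j, ‖L j‖ ≤ 2 * A.freqConst * u j := fun j => by
    refine (A.norm_biFreq_le _ _).trans ?_
    calc _ ≤ A.freqConst * u j + A.freqConst * u j := by gcongr; exacts [hb j, hb' j]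
      _ = _ := by ring
  set s : Fin A.N × Fin A.N → Set J := fun q => {j | ((b j).1, (b' j).1) = q} with hs
  have hr : ∀ q, Rapid u ((s q).indicator c) := fun q => hc.indicator hu0 _
  set Θ : Fin A.N × Fin A.N → Coord d × Coord d → ℂ :=
    fun q z => ∑' j, (s q).indicator c j * wave (L j) z with hΘ
  have hΘs : ∀ q, ContDiff ℝ ∞ (Θ q) := fun q => contDiff_waveSeries (hr q) hL
  have hfun : (fun p : M × M => ∑' j, c j * ((A.elem (b j) : M → ℂ) p.1 *
      (A.elem (b' j) : M → ℂ) p.2)) = ∑ q, A.cut q.1 q.2 (Θ q) := by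
    funext p
    rw [Finset.sum_apply]
    have hterm : ∀ q, HasSum (fun j => (s q).indicator c j * ((A.elem (b j) : M → ℂ) p.1 *
        (A.elem (b' j) : M → ℂ) p.2)) (A.cut q.1 q.2 (Θ q) p) := by
      intro q
      have hsum : Summable fun j => (s q).indicator c j *
          wave (L j) (κ (A.ctr q.1) p.1, κ (A.ctr q.2) p.2) :=
        Summable.of_norm (by simpa [norm_wave] using (hr q).summable_norm)
      have h := hsum.hasSum.mul_left ((A.cutoff q.1 : M → ℂ) p.1 * (A.cutoff q.2 : M → ℂ) p.2)
      refine h.congr_fun fun j => ?_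
      by_cases hj : j ∈ s q
      · have hj' : ((b j).1, (b' j).1) = q := hj
        subst hj'
        have := congrFun (A.tensor_elem (b j) (b' j)) p
        simp only [tensor, cut] at this
        rw [this]
        ring
      · simp [hj]
    have htot := hasSum_sum fun q (_ : q ∈ Finset.univ) => hterm q
    rw [← htot.tsum_eq]
    exact tsum_congr fun j => (sum_fiber_indicator (fun j => ((b j).1, (b' j).1)) c
      (fun _ => (A.elem (b j) : M → ℂ) p.1 * (A.elem (b' j) : M → ℂ) p.2) j).symm
  have hmem : ∀ q, A.cut q.1 q.2 (Θ q) ∈ TestFn (𝓘(ℝ, Coord d).prod 𝓘(ℝ, Coord d)) (M × M) :=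
    fun q => A.cut_mem q.1 q.2 (hΘs q)
  have hall : (fun p : M × M => ∑' j, c j * ((A.elem (b j) : M → ℂ) p.1 *
      (A.elem (b' j) : M → ℂ) p.2)) ∈ TestFn (𝓘(ℝ, Coord d).prod 𝓘(ℝ, Coord d)) (M × M) := by
    rw [hfun]
    exact Submodule.sum_mem _ fun q _ => hmem q
  refine ⟨hall, fun W => ?_⟩
  rw [← W.eval_of_mem hall, hfun, W.eval_sum _ hmem]
  have hterm : ∀ q : Fin A.N × Fin A.N, HasSum
      (fun j => (s q).indicator c j * W.eval (A.cut q.1 q.2 (wave (L j))))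
      (W.eval (A.cut q.1 q.2 (Θ q))) := by
    intro q
    obtain ⟨N, C, hC⟩ := A.cut_bound W q.1 q.2
    exact hasSum_apply_waveSeries (T := fun f => W.eval (A.cut q.1 q.2 f)) (hr q) hu0
      (by positivity) hL (fun f g hf hg => A.eval_cut_add W q.1 q.2 hf hg)
      (fun a f hf => A.eval_cut_smul W q.1 q.2 a hf) hC
  refine (hasSum_sum fun q (_ : q ∈ Finset.univ) => hterm q).congr_fun fun j => ?_
  rw [apply_tensor_elem]
  exact (sum_fiber_indicator (fun j => ((b j).1, (b' j).1)) c
    (fun q => W.eval (A.cut q.1 q.2 (wave (L j)))) j).symm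

/-- The function on `M^n` which is `f` in the charts, multiplied with bump functions. -/
def cutPow {n : ℕ} (a : Fin n → Fin A.N) (f : (Fin n → Coord d) → ℂ) (x : Fin n → M) : ℂ :=
  (∏ i, (A.cutoff (a i) : M → ℂ) (x i)) * f fun i => κ (A.ctr (a i)) (x i)

theorem tsupport_cutPow {n : ℕ} (a : Fin n → Fin A.N) (f : (Fin n → Coord d) → ℂ) :
    tsupport (A.cutPow a f) ⊆ univ.pi fun i => tsupport (A.bump (a i)) := by
  refine closure_minimal (fun x hx i _ => ?_)
    (isClosed_set_pi fun i _ => isClosed_tsupport _)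
  by_contra h
  refine hx ?_
  rw [cutPow, Finset.prod_eq_zero (Finset.mem_univ i) (A.cutoff_eq_zero h), zero_mul]

theorem cutPow_mem {n : ℕ} (a : Fin n → Fin A.N) {f : (Fin n → Coord d) → ℂ}
    (hf : ContDiff ℝ ∞ f) : A.cutPow a f ∈ TestPow d M n := by
  refine ⟨contMDiff_of_tsupport fun x hx => ?_,
    (isCompact_univ_pi fun i => (A.bump (a i)).hasCompactSupport.isCompact).of_isClosed_subset
      (isClosed_tsupport _) (A.tsupport_cutPow a f)⟩
  have hx' := A.tsupport_cutPow a f hx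
  refine contMDiff_mul_complex ?_ ?_
  · have h1 : ContMDiffAt (ModelWithCorners.pi fun _ : Fin n => 𝓘(ℝ, Coord d))
        𝓘(ℝ, Fin n → ℂ) ∞ (fun x : Fin n → M => fun i => (A.cutoff (a i) : M → ℂ) (x i)) x :=
      contMDiffAt_pi_space.2 fun i => ((A.cutoff (a i)).2.1.comp (contMDiff_eval i)) x
    have h2 : ContDiff ℝ ∞ fun z : Fin n → ℂ => ∏ i, z i :=
      contDiff_prod fun i _ => contDiff_apply ℝ ℂ i
    exact h2.contMDiff.contMDiffAt.comp x h1
  · have h1 : ContMDiffAt (ModelWithCorners.pi fun _ : Fin n => 𝓘(ℝ, Coord d))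
        𝓘(ℝ, Fin n → Coord d) ∞ (fun x : Fin n → M => fun i => κ (A.ctr (a i)) (x i)) x :=
      contMDiffAt_pi_space.2 fun i => ContMDiffAt.comp x (g := κ (A.ctr (a i)))
        (contMDiffAt_extChartAt'
          ((A.bump (a i)).tsupport_subset_chartAt_source (hx' i (mem_univ i))))
        (contMDiff_eval i x)
    exact hf.contMDiff.contMDiffAt.comp x h1

/-- The frequency of a tensor product of frame functions. -/
def powFreq {n : ℕ} (ξ : Fin n → Fin d → ℤ) : (Fin n → Coord d) →L[ℝ] ℝ :=
  ∑ i, (A.freq (ξ i)).comp (ContinuousLinearMap.proj i)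

theorem norm_powFreq_le {n : ℕ} (ξ : Fin n → Fin d → ℤ) {u : ℝ} (hu : ∀ i, 1 + ‖ξ i‖ ≤ u) :
    ‖A.powFreq ξ‖ ≤ n * A.freqConst * u := by
  have hF := A.freqConst_nonneg
  calc ‖A.powFreq ξ‖ ≤ ∑ i, ‖(A.freq (ξ i)).comp
        (ContinuousLinearMap.proj (R := ℝ) (φ := fun _ : Fin n => Coord d) i)‖ := norm_sum_le _ _
    _ ≤ ∑ _i : Fin n, A.freqConst * u := by
        refine Finset.sum_le_sum fun i _ => ?_
        refine (ContinuousLinearMap.opNorm_comp_le _ _).trans ?_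
        have h1 : ‖(ContinuousLinearMap.proj (R := ℝ) (φ := fun _ : Fin n => Coord d) i)‖ ≤ 1 :=
          ContinuousLinearMap.opNorm_le_bound _ zero_le_one fun v => by
            simpa using norm_le_pi_norm v i
        refine (mul_le_of_le_one_right (norm_nonneg _) h1).trans ((A.norm_freq_le _).trans ?_)
        gcongr
        exact hu i
    _ = _ := by simp [mul_assoc]

theorem prod_elem {n : ℕ} (P : Fin n → Fin A.N × (Fin d → ℤ)) (x : Fin n → M) :
    ∏ i, (A.elem (P i) : M → ℂ) (x i) =
      A.cutPow (fun i => (P i).1) (wave (A.powFreq fun i => (P i).2)) x := by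
  simp only [elem_apply, Finset.prod_mul_distrib, cutPow]
  congr 1
  simp only [wave, ← Complex.exp_sum, ← Finset.mul_sum, powFreq, sum_apply]
  push_cast
  rfl

theorem elem_pow_mem {n : ℕ} {J : Type} {u : J → ℝ} {c : J → ℂ}
    {P : J → Fin n → Fin A.N × (Fin d → ℤ)} (hc : Rapid u c) (hu : ∀ j, 1 ≤ u j)
    (hP : ∀ j i, 1 + ‖(P j i).2‖ ≤ u j) :
    (fun x : Fin n → M => ∑' j, c j * ∏ i, (A.elem (P j i) : M → ℂ) (x i)) ∈ TestPow d M n := by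
  classical
  have hu0 : ∀ j, 0 ≤ u j := fun j => zero_le_one.trans (hu j)
  set L : J → (Fin n → Coord d) →L[ℝ] ℝ := fun j => A.powFreq fun i => (P j i).2 with hLdef
  have hL : ∀ j, ‖L j‖ ≤ n * A.freqConst * u j := fun j => A.norm_powFreq_le _ (hP j)
  set s : (Fin n → Fin A.N) → Set J := fun q => {j | (fun i => (P j i).1) = q} with hs
  have hr : ∀ q, Rapid u ((s q).indicator c) := fun q => hc.indicator hu0 _
  set Θ : (Fin n → Fin A.N) → (Fin n → Coord d) → ℂ :=
    fun q z => ∑' j, (s q).indicator c j * wave (L j) z with hΘ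
  have hΘs : ∀ q, ContDiff ℝ ∞ (Θ q) := fun q => contDiff_waveSeries (hr q) hL
  have hfun : (fun x : Fin n → M => ∑' j, c j * ∏ i, (A.elem (P j i) : M → ℂ) (x i)) =
      ∑ q, A.cutPow q (Θ q) := by
    funext x
    rw [Finset.sum_apply]
    have hterm : ∀ q, HasSum (fun j => (s q).indicator c j *
        ∏ i, (A.elem (P j i) : M → ℂ) (x i)) (A.cutPow q (Θ q) x) := by
      intro q
      have hsum : Summable fun j => (s q).indicator c j *
          wave (L j) (fun i => κ (A.ctr (q i)) (x i)) :=
        Summable.of_norm (by simpa [norm_wave] using (hr q).summable_norm)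
      refine (hsum.hasSum.mul_left (∏ i, (A.cutoff (q i) : M → ℂ) (x i))).congr_fun fun j => ?_
      by_cases hj : j ∈ s q
      · have hj' : (fun i => (P j i).1) = q := hj
        subst hj'
        rw [prod_elem, cutPow]
        ring
      · simp [hj]
    have htot := hasSum_sum fun q (_ : q ∈ Finset.univ) => hterm q
    rw [← htot.tsum_eq]
    exact tsum_congr fun j => (sum_fiber_indicator (fun j => fun i => (P j i).1) c
      (fun _ => ∏ i, (A.elem (P j i) : M → ℂ) (x i)) j).symm
  rw [hfun]
  exact Submodule.sum_mem _ fun q _ => A.cutPow_mem q (hΘs q)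

/-- The point of `(ℝ^d)^n` whose rescaled coordinates are `v`. -/
def rescale {n : ℕ} (v : Fin n × Fin d → ℝ) (i : Fin n) : Coord d :=
  WithLp.toLp 2 fun j => A.R * v (i, j)

theorem contDiff_rescale {n : ℕ} : ContDiff ℝ ∞ (A.rescale (n := n)) := by
  refine contDiff_pi.2 fun i => ?_
  refine (PiLp.continuousLinearEquiv 2 ℝ (fun _ : Fin d => ℝ)).symm.contDiff.comp
    (contDiff_pi.2 fun j => contDiff_const.mul (contDiff_apply ℝ ℝ (i, j)))

open Classical in
/-- A function on `M^n` in rescaled coordinates, extended by zero. -/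
def coordFn {n : ℕ} (a : Fin n → Fin A.N) (F : (Fin n → M) → ℂ) (v : Fin n × Fin d → ℝ) : ℂ :=
  if ∀ i, A.rescale v i ∈ (κ (A.ctr (a i))).target then
    F fun i => (κ (A.ctr (a i))).symm (A.rescale v i) else 0

theorem coordFn_support {n : ℕ} {a : Fin n → Fin A.N} {F : (Fin n → M) → ℂ}
    (hF : ∀ x, F x ≠ 0 → ∀ i, x i ∈ tsupport (A.part (a i))) {v : Fin n × Fin d → ℝ}
    (hv : A.coordFn a F v ≠ 0) (i : Fin n) :
    A.rescale v i ∈ κ (A.ctr (a i)) '' tsupport (A.part (a i)) := by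
  rw [coordFn] at hv
  split_ifs at hv with h
  · exact ⟨_, hF _ hv i, (κ (A.ctr (a i))).right_inv (h i)⟩
  · exact absurd rfl hv

theorem tsupport_part_subset (a : Fin A.N) : tsupport (A.part a) ⊆ tsupport (A.bump a) :=
  fun x hx => subset_tsupport _ (by simp [A.bump_eq_one a x hx])

theorem contDiff_coordFn {n : ℕ} {a : Fin n → Fin A.N} {F : (Fin n → M) → ℂ}
    (hFs : ContMDiff (ModelWithCorners.pi fun _ : Fin n => 𝓘(ℝ, Coord d)) 𝓘(ℝ, ℂ) ∞ F)
    (hF : ∀ x, F x ≠ 0 → ∀ i, x i ∈ tsupport (A.part (a i))) :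
    ContDiff ℝ ∞ (A.coordFn a F) := by
  refine contDiff_iff_contDiffAt.2 fun v => ?_
  by_cases hv : ∀ i, A.rescale v i ∈ (κ (A.ctr (a i))).target
  · have hev : A.coordFn a F =ᶠ[𝓝 v]
        (F ∘ fun u : Fin n → Coord d => fun i => (κ (A.ctr (a i))).symm (u i)) ∘ A.rescale := by
      have ho : IsOpen (univ.pi fun i => (κ (A.ctr (a i))).target) :=
        isOpen_set_pi finite_univ fun i _ => isOpen_extChartAt_target _
      filter_upwards [(ho.preimage A.contDiff_rescale.continuous).mem_nhds
        (show v ∈ A.rescale ⁻¹' _ from fun i _ => hv i)] with w hw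
      exact if_pos fun i => hw i (mem_univ i)
    refine ContDiffAt.congr_of_eventuallyEq ?_ hev
    refine ContDiffAt.comp v ?_ A.contDiff_rescale.contDiffAt
    exact (ContMDiffAt.comp _ (hFs _)
      (contMDiffAt_pi_chart_symm (fun i => A.ctr (a i)) hv)).contDiffAt
  · push Not at hv
    obtain ⟨i, hi⟩ := hv
    have hcomp : IsCompact (κ (A.ctr (a i)) '' tsupport (A.part (a i))) :=
      ((A.bump (a i)).hasCompactSupport.isCompact.of_isClosed_subset (isClosed_tsupport _)
        (A.tsupport_part_subset _)).image_of_continuousOn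
        ((continuousOn_extChartAt _).mono ((A.tsupport_part_subset _).trans
          (A.bump (a i)).tsupport_subset_extChartAt_source))
    have hni : A.rescale v i ∉ κ (A.ctr (a i)) '' tsupport (A.part (a i)) := by
      rintro ⟨y, hy, hyv⟩
      refine hi (hyv ▸ (κ (A.ctr (a i))).map_source ?_)
      exact (A.bump (a i)).tsupport_subset_extChartAt_source (A.tsupport_part_subset _ hy)
    have hcont : Continuous fun v : Fin n × Fin d → ℝ => A.rescale v i :=
      (continuous_apply i).comp A.contDiff_rescale.continuous
    have hev : A.coordFn a F =ᶠ[𝓝 v] fun _ => 0 := by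
      filter_upwards [(hcomp.isClosed.isOpen_compl.preimage hcont).mem_nhds
        (show v ∈ (fun v => A.rescale v i) ⁻¹' _ from hni)] with w hw
      by_contra h
      exact hw (A.coordFn_support hF h i)
    exact contDiffAt_const.congr_of_eventuallyEq hev

/-- Expansion of a smooth function supported where the bump functions `bump (a i)` are one. -/
theorem expand_piece {n : ℕ} (a : Fin n → Fin A.N) {F : (Fin n → M) → ℂ}
    (hFs : ContMDiff (ModelWithCorners.pi fun _ : Fin n => 𝓘(ℝ, Coord d)) 𝓘(ℝ, ℂ) ∞ F)
    (hF : ∀ x, F x ≠ 0 → ∀ i, x i ∈ tsupport (A.part (a i))) :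
    ∃ c : (Fin n × Fin d → ℤ) → ℂ, (∀ N : ℕ, Summable fun ξ => ‖c ξ‖ * (1 + ‖ξ‖) ^ N) ∧
      ∀ x, HasSum (fun ξ => c ξ * ∏ i, (A.elem (a i, fun j => ξ (i, j)) : M → ℂ) (x i)) (F x) := by
  have hR := A.R_pos
  obtain ⟨c, hc, hsum⟩ := exists_fourier_series (A.contDiff_coordFn hFs hF) (r := 1 / 4)
    (by norm_num) fun v hv p => by
      obtain ⟨y, hy, hyv⟩ := A.coordFn_support hF hv p.1
      have h1 := A.coord_le (a p.1) y (A.tsupport_part_subset _ hy) p.2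
      rw [hyv, rescale, abs_mul, abs_of_pos hR] at h1
      nlinarith [abs_nonneg (v (p.1, p.2))]
  refine ⟨c, hc, fun x => ?_⟩
  simp only [prod_elem]
  by_cases hx : ∀ i, x i ∈ tsupport (A.bump (a i))
  · set v : Fin n × Fin d → ℝ := fun p => κ (A.ctr (a p.1)) (x p.1) p.2 / A.R with hv
    have hresc : ∀ i, A.rescale v i = κ (A.ctr (a i)) (x i) := by
      intro i
      ext j
      simp only [rescale, hv]
      field_simp
    have hsrc : ∀ i, x i ∈ (κ (A.ctr (a i))).source := fun i =>
      (A.bump (a i)).tsupport_subset_extChartAt_source (hx i)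
    have hval : A.coordFn a F v = F x := by
      rw [coordFn, if_pos fun i => by rw [hresc]; exact (κ (A.ctr (a i))).map_source (hsrc i)]
      congr 1
      funext i
      rw [hresc, (κ (A.ctr (a i))).left_inv (hsrc i)]
    have h := hsum v fun p => by
      have h1 := A.coord_le (a p.1) (x p.1) (hx p.1) p.2
      rw [hv, abs_div, abs_of_pos hR, div_lt_iff₀ hR]
      linarith
    rw [hval] at h
    have hprod : (∏ i, (A.cutoff (a i) : M → ℂ) (x i)) * F x = F x := by
      by_cases h0 : F x = 0
      · rw [h0, mul_zero]
      · rw [Finset.prod_eq_one, one_mul]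
        intro i _
        simp [cutoff, A.bump_eq_one _ _ (hF x h0 i)]
    rw [← hprod]
    refine (h.mul_left (∏ i, (A.cutoff (a i) : M → ℂ) (x i))).congr_fun fun ξ => ?_
    have hw : wave (A.powFreq fun i => fun j => ξ (i, j)) (fun i => κ (A.ctr (a i)) (x i)) =
        Complex.exp (Complex.I * (2 * Real.pi * ∑ p, ξ p * v p : ℝ)) := by
      rw [wave, powFreq, sum_apply, Fintype.sum_prod_type, Finset.mul_sum]
      congr 3
      refine Finset.sum_congr rfl fun i _ => ?_
      exact A.freq_apply _ _
    rw [cutPow, hw]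
    ring
  · push Not at hx
    obtain ⟨i, hi⟩ := hx
    have h0 : F x = 0 := by
      by_contra h
      exact hi (A.tsupport_part_subset _ (hF x h i))
    rw [h0]
    refine hasSum_zero.congr_fun fun ξ => ?_
    rw [cutPow, Finset.prod_eq_zero (Finset.mem_univ i) (A.cutoff_eq_zero hi), zero_mul, mul_zero]

/-- A test function on `K^n` is split by the partition of unity into pieces, which are expanded in
Fourier series in the charts. -/
theorem elem_expand {n : ℕ} (f : TestPow d M n)
    (hf : tsupport (f : (Fin n → M) → ℂ) ⊆ univ.pi (fun _ => K)) :
    ∃ (J : Type) (_ : Countable J) (u : J → ℝ) (c : J → ℂ)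
      (P : J → Fin n → Fin A.N × (Fin d → ℤ)), Rapid u c ∧
      (∀ j, 1 ≤ u j) ∧ (∀ j i, 1 + ‖(P j i).2‖ ≤ u j) ∧
      ∀ x, (f : (Fin n → M) → ℂ) x = ∑' j, c j * ∏ i, (A.elem (P j i) : M → ℂ) (x i) := by
  set F : (Fin n → Fin A.N) → (Fin n → M) → ℂ :=
    fun a x => (f : (Fin n → M) → ℂ) x * ∏ i, (A.part (a i) (x i) : ℂ) with hF
  have hsmooth : ∀ a, ContMDiff (ModelWithCorners.pi fun _ : Fin n => 𝓘(ℝ, Coord d))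
      𝓘(ℝ, ℂ) ∞ (F a) := by
    intro a x
    refine contMDiff_mul_complex (f.2.1 x) ?_
    have h1 : ContMDiffAt (ModelWithCorners.pi fun _ : Fin n => 𝓘(ℝ, Coord d))
        𝓘(ℝ, Fin n → ℂ) ∞ (fun x : Fin n → M => fun i => (A.part (a i) (x i) : ℂ)) x :=
      contMDiffAt_pi_space.2 fun i => (Complex.ofRealCLM.contDiff.contMDiff.comp
        ((A.part (a i)).contMDiff.comp (contMDiff_eval i))) x
    have h2 : ContDiff ℝ ∞ fun z : Fin n → ℂ => ∏ i, z i :=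
      contDiff_prod fun i _ => contDiff_apply ℝ ℂ i
    exact h2.contMDiff.contMDiffAt.comp x h1
  have hsupp : ∀ a x, F a x ≠ 0 → ∀ i, x i ∈ tsupport (A.part (a i)) := by
    intro a x hx i
    by_contra h
    refine hx ?_
    have h0 : A.part (a i) (x i) = 0 := image_eq_zero_of_notMem_tsupport h
    simp only [hF]
    rw [Finset.prod_eq_zero (Finset.mem_univ i) (by rw [h0, Complex.ofReal_zero]), mul_zero]
  choose c hc hsum using fun a => A.expand_piece a (hsmooth a) (hsupp a)
  refine ⟨(Fin n → Fin A.N) × (Fin n × Fin d → ℤ), inferInstance, fun q => 1 + ‖q.2‖, fun q => c q.1 q.2,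
    fun q i => (q.1 i, fun j => q.2 (i, j)), fun N => ?_, fun q => ?_, fun q i => ?_, fun x => ?_⟩
  · rw [summable_prod_of_nonneg fun q => by simp only [Pi.zero_apply]; positivity]
    exact ⟨fun a => hc a N, Summable.of_finite⟩
  · linarith [norm_nonneg q.2]
  · have : ‖fun j => q.2 (i, j)‖ ≤ ‖q.2‖ :=
      (pi_norm_le_iff_of_nonneg (norm_nonneg _)).2 fun j => norm_le_pi_norm q.2 (i, j)
    simpa using this
  · have hone : (f : (Fin n → M) → ℂ) x = ∑ a, F a x := by
      simp only [hF, ← Finset.mul_sum]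
      by_cases hx : (f : (Fin n → M) → ℂ) x = 0
      · rw [hx, zero_mul]
      · have hxK : ∀ i, x i ∈ K := fun i => hf (subset_tsupport _ hx) i (mem_univ i)
        have h1 : ∏ i : Fin n, ∑ a, (A.part a (x i) : ℂ) = 1 := Finset.prod_eq_one fun i _ => by
          have := A.part.sum_eq_one (hxK i)
          rw [finsum_eq_sum_of_fintype] at this
          exact_mod_cast this
        rw [Finset.prod_univ_sum, Fintype.piFinset_univ] at h1
        rw [h1, mul_one]
    have hs : Summable fun q : (Fin n → Fin A.N) × (Fin n × Fin d → ℤ) =>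
        c q.1 q.2 * ∏ i, (A.elem (q.1 i, fun j => q.2 (i, j)) : M → ℂ) (x i) := by
      refine Summable.of_norm ?_
      rw [summable_prod_of_nonneg fun q => norm_nonneg _]
      refine ⟨fun a => ?_, Summable.of_finite⟩
      exact (hsum a x).summable.norm
    rw [hs.tsum_prod, hone, tsum_fintype]
    exact Finset.sum_congr rfl fun a _ => (hsum a x).tsum_eq.symm

/-- The frame given by the functions `bump a · e^{i ⟨freq ξ, ·⟩}`. -/
def frame : Frame d K where
  B := Fin A.N × (Fin d → ℤ)
  e := A.elem
  wt b := 1 + ‖b.2‖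
  one_le_wt b := by linarith [norm_nonneg b.2]
  conj b := (b.1, -b.2)
  e_conj b := by
    refine Subtype.ext (funext fun x => ?_)
    have h : A.freq (-b.2) = -A.freq b.2 := by
      simp [freq, neg_smul]
    simp only [elem_apply, testConj, map_mul, h, cutoff, wave, Complex.conj_ofReal,
      ← Complex.exp_conj, Complex.conj_I, neg_apply]
    push_cast
    ring_nf
  wt_conj b := by simp
  norm_le b x := by
    rw [elem_apply, norm_mul, norm_wave, mul_one]
    simp only [cutoff, Complex.norm_real, Real.norm_eq_abs, abs_of_nonneg (A.bump b.1).nonneg]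
    exact (A.bump b.1).le_one
  supp := ⋃ a, tsupport (A.bump a)
  isCompact_supp := isCompact_iUnion fun a => (A.bump a).hasCompactSupport.isCompact
  eq_zero b x hx := by
    rw [elem_apply, A.cutoff_eq_zero fun h => hx (mem_iUnion.2 ⟨b.1, h⟩), zero_mul]
  bi_bound := A.elem_bi_bound
  bi_sum := A.elem_bi_sum
  pow_mem := A.elem_pow_mem
  expand := A.elem_expand

end BumpCover

end BumpCover

/-! ### Series of products of smeared fields -/

section Expansion

variable {d : ℕ} {M : Type*} [TopologicalSpace M] [ChartedSpace (Coord d) M]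
  [IsManifold 𝓘(ℝ, Coord d) ∞ M]

section Pairing

variable [T2Space M] [SecondCountableTopology M] [MeasurableSpace M] [BorelSpace M]
  (S : Spacetime d M)

/-- The smeared field `∫ f φ dμ_g`. -/
def pair (f : Test d M) (φ : Config d M) : ℂ := ∫ x, (f : M → ℂ) x * (φ x : ℂ) ∂S.vol

theorem integrable_pair (f : Test d M) (φ : Config d M) :
    Integrable (fun x => (f : M → ℂ) x * (φ x : ℂ)) S.vol :=
  (f.2.1.continuous.mul (continuous_config φ)).integrable_of_hasCompactSupport f.2.2.mul_right

theorem pair_add_smul (f : Test d M) (φ ψ : Config d M) (t : ℝ) :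
    pair S f (φ + t • ψ) = pair S f φ + t * pair S f ψ := by
  rw [pair, pair, pair, ← integral_const_mul, ← integral_add (integrable_pair S f φ)
    ((integrable_pair S f ψ).const_mul _)]
  refine integral_congr_ae (Filter.Eventually.of_forall fun x => ?_)
  have : ((φ + t • ψ) x : ℝ) = φ x + t * ψ x := rfl
  simp only [this]
  push_cast
  ring

theorem pair_zero (f : Test d M) : pair S f 0 = 0 := by
  have h : ∀ x : M, (0 : Config d M) x = 0 := fun _ => rfl
  simp [pair, h]

variable {K : Set M} (fr : Frame d K)

/-- The smeared fields of a frame are bounded at each configuration. -/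
theorem exists_pair_bound (φ : Config d M) :
    ∃ C : ℝ, 1 ≤ C ∧ ∀ b, ∫ x, ‖(fr.e b : M → ℂ) x * (φ x : ℂ)‖ ∂S.vol ≤ C := by
  obtain ⟨C, hC⟩ := fr.isCompact_supp.exists_bound_of_continuousOn
    (continuous_config φ).continuousOn
  refine ⟨1 + |C| * S.vol.real fr.supp, by
    have : 0 ≤ |C| * S.vol.real fr.supp := by positivity
    linarith, fun b => ?_⟩
  have h0 : ∀ x ∉ fr.supp, ‖(fr.e b : M → ℂ) x * (φ x : ℂ)‖ = 0 := fun x hx => by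
    rw [fr.eq_zero b x hx, zero_mul, norm_zero]
  rw [← setIntegral_eq_integral_of_forall_compl_eq_zero h0]
  refine (Real.le_norm_self _).trans ((norm_setIntegral_le_of_norm_le_const (C := |C|)
    fr.isCompact_supp.measure_lt_top fun x hx => ?_).trans (by linarith))
  rw [norm_norm, norm_mul]
  calc _ ≤ 1 * C := by gcongr; exacts [fr.norm_le b x, hC x hx]
    _ ≤ |C| := by rw [one_mul]; exact le_abs_self C

theorem norm_pair_le {φ : Config d M} {C : ℝ}
    (hC : ∀ b, ∫ x, ‖(fr.e b : M → ℂ) x * (φ x : ℂ)‖ ∂S.vol ≤ C) (b : fr.B) :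
    ‖pair S (fr.e b) φ‖ ≤ C := (norm_integral_le_integral_norm _).trans (hC b)

/-- Integration of a rapidly convergent series of tensor products against a product of smooth
functions, term by term. -/
theorem integral_series {n : ℕ} {J : Type} [Countable J] {u : J → ℝ} {c : J → ℂ}
    {P : J → Fin n → fr.B} (hc : Rapid u c) (ψ : Fin n → Config d M) :
    ∫ x, (∑' j, c j * ∏ i, (fr.e (P j i) : M → ℂ) (x i)) * ∏ i, (ψ i (x i) : ℂ)
        ∂(Measure.pi fun _ : Fin n => S.vol) =
      ∑' j, c j * ∏ i, pair S (fr.e (P j i)) (ψ i) := by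
  choose C hC1 hC using fun i => exists_pair_bound S fr (ψ i)
  have e : ∀ x : Fin n → M,
      (∑' j, c j * ∏ i, (fr.e (P j i) : M → ℂ) (x i)) * ∏ i, (ψ i (x i) : ℂ) =
      ∑' j, c j * ∏ i, ((fr.e (P j i) : M → ℂ) (x i) * (ψ i (x i) : ℂ)) := by
    intro x
    rw [← tsum_mul_right]
    refine tsum_congr fun j => ?_
    rw [Finset.prod_mul_distrib, mul_assoc]
  simp_rw [e]
  rw [← integral_tsum_of_summable_integral_norm]
  · refine tsum_congr fun j => ?_
    rw [integral_const_mul]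
    congr 1
    exact integral_fintype_prod_eq_prod (μ := fun _ : Fin n => S.vol)
      (fun i x => (fr.e (P j i) : M → ℂ) x * (ψ i x : ℂ))
  · intro j
    exact (Integrable.fintype_prod (μ := fun _ : Fin n => S.vol)
      (f := fun i x => (fr.e (P j i) : M → ℂ) x * (ψ i x : ℂ))
      fun i => integrable_pair S _ _).const_mul _
  · refine Summable.of_nonneg_of_le (fun j => integral_nonneg fun x => norm_nonneg _) (fun j => ?_)
      (hc.summable_norm.mul_right (∏ i, C i))
    simp_rw [norm_mul (c j), norm_prod]
    rw [integral_const_mul, integral_fintype_prod_eq_prod (μ := fun _ : Fin n => S.vol)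
      (fun i x => ‖(fr.e (P j i) : M → ℂ) x * (ψ i x : ℂ)‖)]
    exact mul_le_mul_of_nonneg_left (Finset.prod_le_prod
      (fun i _ => integral_nonneg fun x => norm_nonneg ((fr.e (P j i) : M → ℂ) x * (ψ i x : ℂ)))
      fun i _ => hC i _) (norm_nonneg _)

end Pairing

/-- A series `∑ c_j Q_{j,1}(ψ₁) ⋯ Q_{j,n}(ψ_n) ∏_{b ∈ P_j} b(φ)` of products of smeared fields,
multilinear in `n` directions `ψ` and polynomial of degree at most `D - n` in `φ`. -/
structure Expansion {K : Set M} (fr : Frame d K) (n D : ℕ) where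
  /-- the index set -/
  J : Type
  countable : Countable J
  /-- the weights -/
  u : J → ℝ
  /-- the coefficients -/
  c : J → ℂ
  /-- the factors evaluated at the directions -/
  Q : J → Fin n → fr.B
  /-- the factors evaluated at the configuration -/
  P : J → List fr.B
  rapid : Rapid u c
  one_le : ∀ j, 1 ≤ u j
  Q_le : ∀ j i, fr.wt (Q j i) ≤ u j
  P_le : ∀ j, ∀ b ∈ P j, fr.wt b ≤ u j
  length_le : ∀ j, (P j).length + n ≤ D

namespace Expansion

variable [T2Space M] [SecondCountableTopology M] [MeasurableSpace M] [BorelSpace M]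
  (S : Spacetime d M) {K : Set M} {fr : Frame d K} {n D : ℕ} (X : Expansion fr n D)

theorem u_nonneg (j : X.J) : 0 ≤ X.u j := zero_le_one.trans (X.one_le j)

/-- The product of the factors evaluated at `φ`. -/
def mono (j : X.J) (φ : Config d M) : ℂ := ((X.P j).map fun b => pair S (fr.e b) φ).prod

/-- The sum of the series. -/
def eval (ψ : Fin n → Config d M) (φ : Config d M) : ℂ :=
  ∑' j, X.c j * (∏ i, pair S (fr.e (X.Q j i)) (ψ i)) * X.mono S j φ

theorem _root_.List.norm_prod_map_le {β : Type*} {f : β → ℂ} {C : ℝ} (hC : 1 ≤ C)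
    {D : ℕ} {l : List β} (h : ∀ b, ‖f b‖ ≤ C) (hl : l.length ≤ D) : ‖(l.map f).prod‖ ≤ C ^ D := by
  refine le_trans ?_ (pow_le_pow_right₀ hC hl)
  clear hl
  induction l with
  | nil => simp
  | cons b l ih =>
    rw [List.map_cons, List.prod_cons, norm_mul, List.length_cons, pow_succ']
    gcongr
    exact h b

theorem exists_mono_bound (φ : Config d M) : ∃ C, ∀ j, ‖X.mono S j φ‖ ≤ C := by
  obtain ⟨C, hC1, hC⟩ := exists_pair_bound S fr φ
  exact ⟨C ^ D, fun j => List.norm_prod_map_le hC1 (norm_pair_le S fr hC)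
    ((Nat.le_add_right _ _).trans (X.length_le j))⟩

theorem rapid_mono (φ : Config d M) : Rapid X.u fun j => X.c j * X.mono S j φ := by
  obtain ⟨C, hC⟩ := X.exists_mono_bound S φ
  exact X.rapid.mul_bounded X.u_nonneg hC

theorem exists_dir_bound (ψ : Fin n → Config d M) :
    ∃ C, ∀ j, ‖∏ i, pair S (fr.e (X.Q j i)) (ψ i)‖ ≤ C := by
  choose C hC1 hC using fun i => exists_pair_bound S fr (ψ i)
  refine ⟨∏ i, C i, fun j => ?_⟩
  rw [norm_prod]
  gcongr with i
  exact norm_pair_le S fr (hC i) _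

/-- The integral kernel of the multilinear functional `ψ ↦ X.eval ψ φ`. -/
def kernel (φ : Config d M) : TestPow d M n :=
  ⟨fun x => ∑' j, (X.c j * X.mono S j φ) * ∏ i, (fr.e (X.Q j i) : M → ℂ) (x i),
    fr.pow_mem (X.rapid_mono S φ) X.one_le X.Q_le⟩

theorem integral_kernel (ψ : Fin n → Config d M) (φ : Config d M) :
    ∫ x, (X.kernel S φ : (Fin n → M) → ℂ) x * ∏ i, (ψ i (x i) : ℂ)
      ∂(Measure.pi fun _ : Fin n => S.vol) = X.eval S ψ φ := by
  have := X.countable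
  refine (integral_series S fr (X.rapid_mono S φ) ψ).trans (tsum_congr fun j => ?_)
  ring

/-- The derivative with respect to `φ`, by the product rule. -/
def deriv : Expansion fr (n + 1) D where
  J := Σ j, Fin (X.P j).length
  countable := by have := X.countable; infer_instance
  u q := X.u q.1
  c q := X.c q.1
  Q q := Fin.cons ((X.P q.1).get q.2) (X.Q q.1)
  P q := (X.P q.1).eraseIdx q.2
  rapid N := by
    rw [summable_sigma_of_nonneg fun q => mul_nonneg (norm_nonneg _)
      (pow_nonneg (X.u_nonneg q.1) N)]
    refine ⟨fun j => Summable.of_finite, ?_⟩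
    refine Summable.of_nonneg_of_le (fun j => tsum_nonneg fun i => mul_nonneg (norm_nonneg _)
      (pow_nonneg (X.u_nonneg j) N)) (fun j => ?_) ((X.rapid N).mul_left (D : ℝ))
    rw [tsum_fintype]
    change ∑ _i : Fin (X.P j).length, ‖X.c j‖ * X.u j ^ N ≤ _
    rw [Finset.sum_const, Finset.card_univ, Fintype.card_fin, nsmul_eq_mul]
    refine mul_le_mul_of_nonneg_right ?_ (mul_nonneg (norm_nonneg _) (pow_nonneg (X.u_nonneg j) N))
    exact_mod_cast (Nat.le_add_right _ _).trans (X.length_le j)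
  one_le q := X.one_le q.1
  Q_le q i := by
    refine Fin.cases ?_ (fun i => ?_) i
    · simpa using X.P_le q.1 _ (List.getElem_mem _)
    · simpa using X.Q_le q.1 i
  P_le q b hb := X.P_le q.1 b (List.mem_of_mem_eraseIdx hb)
  length_le q := by
    have h1 := X.length_le q.1
    have h2 := q.2.2
    rw [List.length_eraseIdx_of_lt h2]
    omega

theorem _root_.List.hasDerivAt_prod_map {β : Type*} (α γ : β → ℂ) (l : List β) (t : ℝ) :
    HasDerivAt (fun t : ℝ => (l.map fun b => α b + t * γ b).prod)
      (∑ i : Fin l.length, γ (l.get i) * ((l.eraseIdx i).map fun b => α b + t * γ b).prod) t := by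
  induction l with
  | nil => simpa using hasDerivAt_const t (1 : ℂ)
  | cons b l ih =>
    have h1 : HasDerivAt (fun t : ℝ => α b + t * γ b) (γ b) t := by
      simpa using ((Complex.ofRealCLM.hasDerivAt (x := t)).mul_const (γ b)).const_add (α b)
    have h := h1.mul ih
    simp only [List.map_cons, List.prod_cons]
    convert! h using 1
    simp only [List.length_cons, Fin.sum_univ_succ, Finset.mul_sum]
    congr 1
    refine Finset.sum_congr rfl fun i _ => ?_
    simp only [List.get_eq_getElem, Fin.val_succ, List.getElem_cons_succ, List.eraseIdx_cons_succ,
      List.map_cons, List.prod_cons]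
    ring

/-- The series can be differentiated term by term, the derivatives being dominated by a multiple of
the summable coefficients. -/
theorem hasDerivAt_eval (ψ : Fin n → Config d M) (χ φ : Config d M) :
    HasDerivAt (fun t : ℝ => X.eval S ψ (φ + t • χ)) (X.deriv.eval S (Fin.cons χ ψ) φ) 0 := by
  obtain ⟨C₁, hC₁, hb₁⟩ := exists_pair_bound S fr φ
  obtain ⟨C₂, hC₂, hb₂⟩ := exists_pair_bound S fr χ
  obtain ⟨C₃, hb₃⟩ := X.exists_dir_bound S ψ
  set C := C₁ + C₂ with hC
  have hC1 : 1 ≤ C := by linarith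
  have hbound : ∀ (b : fr.B), ∀ t ∈ Ioo (-1 : ℝ) 1,
      ‖pair S (fr.e b) φ + t * pair S (fr.e b) χ‖ ≤ C := by
    intro b t ht
    refine (norm_add_le _ _).trans (add_le_add (norm_pair_le S fr hb₁ b) ?_)
    rw [norm_mul, Complex.norm_real, Real.norm_eq_abs]
    have h1 : |t| ≤ 1 := abs_le.2 ⟨ht.1.le, ht.2.le⟩
    calc _ ≤ 1 * C₂ := by gcongr; exact norm_pair_le S fr hb₂ b
      _ = C₂ := one_mul _
  have hmono : ∀ j (t : ℝ), X.mono S j (φ + t • χ) =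
      ((X.P j).map fun b => pair S (fr.e b) φ + t * pair S (fr.e b) χ).prod := by
    intro j t
    simp only [mono, pair_add_smul]
  set g' : X.J → ℝ → ℂ := fun j t => X.c j * (∏ i, pair S (fr.e (X.Q j i)) (ψ i)) *
    ∑ i : Fin (X.P j).length, pair S (fr.e ((X.P j).get i)) χ *
      (((X.P j).eraseIdx i).map fun b => pair S (fr.e b) φ + t * pair S (fr.e b) χ).prod with hg'
  have hlen : ∀ j, (X.P j).length ≤ D := fun j => (Nat.le_add_right _ _).trans (X.length_le j)
  have hg'b : ∀ j, ∀ t ∈ Ioo (-1 : ℝ) 1, ‖g' j t‖ ≤ ‖X.c j‖ * (|C₃| * (D * (C₂ * C ^ D))) := by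
    intro j t ht
    simp only [hg']
    rw [norm_mul, norm_mul, mul_assoc]
    gcongr
    · exact (hb₃ j).trans (le_abs_self _)
    · calc _ ≤ ∑ _i : Fin (X.P j).length, C₂ * C ^ D := by
            refine norm_sum_le_of_le _ fun i _ => ?_
            rw [norm_mul]
            gcongr
            · exact norm_pair_le S fr hb₂ _
            · exact List.norm_prod_map_le hC1 (fun b => hbound b t ht)
                ((List.length_eraseIdx_le _ _).trans (hlen j))
        _ = (X.P j).length * (C₂ * C ^ D) := by simp
        _ ≤ D * (C₂ * C ^ D) := by
            gcongr
            exact_mod_cast hlen j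
  have hzero : (0 : ℝ) ∈ Ioo (-1 : ℝ) 1 := by norm_num
  have hsum0 : Summable fun j => X.c j * (∏ i, pair S (fr.e (X.Q j i)) (ψ i)) *
      X.mono S j (φ + (0 : ℝ) • χ) := by
    obtain ⟨C₄, hb₄⟩ := X.exists_mono_bound S (φ + (0 : ℝ) • χ)
    exact ((X.rapid.mul_bounded X.u_nonneg hb₃).mul_bounded X.u_nonneg hb₄).summable_norm.of_norm
  have key := hasDerivAt_tsum_of_isPreconnected
    (g := fun j (t : ℝ) => X.c j * (∏ i, pair S (fr.e (X.Q j i)) (ψ i)) *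
      X.mono S j (φ + t • χ)) (g' := g') (t := Ioo (-1) 1) (y₀ := 0) (y := 0)
    (X.rapid.summable_norm.mul_right _) isOpen_Ioo isPreconnected_Ioo (fun j t _ => by
      simp only [hmono]
      exact (List.hasDerivAt_prod_map (fun b => pair S (fr.e b) φ) (fun b => pair S (fr.e b) χ)
        (X.P j) t).const_mul _) hg'b hzero hsum0 hzero
  convert! key using 1
  have hsum : Summable fun q : X.deriv.J => X.deriv.c q *
      (∏ i, pair S (fr.e (X.deriv.Q q i)) ((Fin.cons χ ψ : Fin (n + 1) → Config d M) i)) *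
      X.deriv.mono S q φ := by
    obtain ⟨C₄, hb₄⟩ := X.deriv.exists_mono_bound S φ
    obtain ⟨C₅, hb₅⟩ := X.deriv.exists_dir_bound S (Fin.cons χ ψ)
    exact ((X.deriv.rapid.mul_bounded X.deriv.u_nonneg hb₅).mul_bounded X.deriv.u_nonneg
      hb₄).summable_norm.of_norm
  refine (Summable.tsum_sigma' (fun j => Summable.of_finite) hsum).trans (tsum_congr fun j => ?_)
  rw [tsum_fintype]
  simp only [hg', Finset.mul_sum]
  refine Finset.sum_congr rfl fun i _ => ?_
  simp only [Expansion.deriv, mono, Fin.prod_univ_succ, Fin.cons_zero, Fin.cons_succ,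
    Complex.ofReal_zero, zero_mul, add_zero]
  ring

/-- The iterated derivatives of a series of products of smeared fields. -/
def iter (X : Expansion fr 0 D) : (n : ℕ) → Expansion fr n D
  | 0 => X
  | n + 1 => (X.iter n).deriv

theorem iterDeriv_eq {X : Expansion fr 0 D} {F : Config d M → ℂ}
    (hF : ∀ ψ φ, F φ = X.eval S ψ φ) (n : ℕ) (ψ : Fin n → Config d M) (φ : Config d M) :
    iterDeriv F n ψ φ = (X.iter n).eval S ψ φ := by
  induction n generalizing φ with
  | zero => exact hF ψ φ
  | succ n ih =>
    simp only [iterDeriv, dirDeriv]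
    rw [show (fun t : ℝ => iterDeriv F n (Fin.tail ψ) (φ + t • ψ 0)) =
      fun t : ℝ => (X.iter n).eval S (Fin.tail ψ) (φ + t • ψ 0) from funext fun t => ih _ _,
      ((X.iter n).hasDerivAt_eval S (Fin.tail ψ) (ψ 0) φ).deriv, Fin.cons_self_tail]
    rfl

theorem derivKernel_eq_kernel {X : Expansion fr 0 D} {F : Config d M → ℂ}
    (hF : ∀ ψ φ, F φ = X.eval S ψ φ) (n : ℕ) (φ : Config d M) :
    derivKernel S F n φ = (X.iter n).kernel S φ :=
  derivKernel_eq S fun ψ => (iterDeriv_eq S hF n ψ φ).trans ((X.iter n).integral_kernel S ψ φ).symm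

theorem isEmpty_of_lt (h : D < n) : IsEmpty X.J :=
  ⟨fun j => by have := X.length_le j; omega⟩

/-- The empty series. -/
def zero (fr : Frame d K) (D : ℕ) : Expansion fr 0 D where
  J := Empty
  countable := inferInstance
  u := Empty.elim
  c := Empty.elim
  Q j := j.elim
  P j := j.elim
  rapid _ := Summable.of_finite
  one_le j := j.elim
  Q_le j := j.elim
  P_le j := j.elim
  length_le j := j.elim

/-- The sum of two series. -/
def add {D' : ℕ} (X : Expansion fr 0 D) (Y : Expansion fr 0 D') : Expansion fr 0 (D + D') where
  J := X.J ⊕ Y.J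
  countable := by have := X.countable; have := Y.countable; infer_instance
  u := Sum.elim X.u Y.u
  c := Sum.elim X.c Y.c
  Q := Sum.elim X.Q Y.Q
  P := Sum.elim X.P Y.P
  rapid := X.rapid.sum_elim Y.rapid
  one_le j := by cases j; exacts [X.one_le _, Y.one_le _]
  Q_le j := by cases j; exacts [X.Q_le _, Y.Q_le _]
  P_le j := by cases j; exacts [X.P_le _, Y.P_le _]
  length_le j := by
    cases j with
    | inl j => exact (X.length_le j).trans (Nat.le_add_right _ _)
    | inr j => exact (Y.length_le j).trans (Nat.le_add_left _ _)

/-- A multiple of a series. -/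
def smul (a : ℂ) (X : Expansion fr 0 D) : Expansion fr 0 D where
  J := X.J
  countable := X.countable
  u := X.u
  c j := a * X.c j
  Q := X.Q
  P := X.P
  rapid := X.rapid.const_mul a
  one_le := X.one_le
  Q_le := X.Q_le
  P_le := X.P_le
  length_le := X.length_le

theorem summable_eval (X : Expansion fr n D) (ψ : Fin n → Config d M) (φ : Config d M) :
    Summable fun j => X.c j * (∏ i, pair S (fr.e (X.Q j i)) (ψ i)) * X.mono S j φ := by
  obtain ⟨C₄, hb₄⟩ := X.exists_mono_bound S φ
  obtain ⟨C₅, hb₅⟩ := X.exists_dir_bound S ψ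
  exact ((X.rapid.mul_bounded X.u_nonneg hb₅).mul_bounded X.u_nonneg hb₄).summable_norm.of_norm

end Expansion

end Expansion

/-! ### Regular polynomials as series of products of smeared fields -/

section Star

variable {d : ℕ} {M : Type*} [TopologicalSpace M] [ChartedSpace (Coord d) M]
  [IsManifold 𝓘(ℝ, Coord d) ∞ M] [T2Space M] [SecondCountableTopology M] [MeasurableSpace M]
  [BorelSpace M] (S : Spacetime d M)

namespace Expansion

variable {K : Set M} {fr : Frame d K} {n D : ℕ}

theorem eval_add {D' : ℕ} (X : Expansion fr 0 D) (Y : Expansion fr 0 D')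
    (ψ : Fin 0 → Config d M) (φ : Config d M) :
    (X.add Y).eval S ψ φ = X.eval S ψ φ + Y.eval S ψ φ :=
  Summable.tsum_sum (f := fun j : X.J ⊕ Y.J => (X.add Y).c j *
    (∏ i, pair S (fr.e ((X.add Y).Q j i)) (ψ i)) * (X.add Y).mono S j φ)
    (X.summable_eval S ψ φ) (Y.summable_eval S ψ φ)

theorem eval_smul (a : ℂ) (X : Expansion fr 0 D) (ψ : Fin 0 → Config d M) (φ : Config d M) :
    (X.smul a).eval S ψ φ = a * X.eval S ψ φ := by
  rw [eval, eval, ← tsum_mul_left]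
  refine tsum_congr fun j => ?_
  rw [← mul_assoc, ← mul_assoc]
  rfl

theorem eval_zero (ψ : Fin 0 → Config d M) (φ : Config d M) :
    (zero fr D).eval S ψ φ = 0 := by
  have : IsEmpty (zero fr D).J := inferInstanceAs (IsEmpty Empty)
  exact tsum_empty

end Expansion

/-- Every regular polynomial is, in each frame for a sufficiently large compact set, a series of
products of smeared fields. -/
theorem exists_expansion {F : Config d M → ℂ} (hF : F ∈ regularPolynomials S) :
    ∃ K₀ : Set M, IsCompact K₀ ∧ ∀ (K : Set M) (fr : Frame d K), K₀ ⊆ K →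
      ∃ (D : ℕ) (X : Expansion fr 0 D), ∀ ψ φ, F φ = X.eval S ψ φ := by
  induction hF using Submodule.span_induction with
  | mem F h =>
    obtain ⟨k, f, rfl⟩ := h
    refine ⟨⋃ i : Fin k, (fun x : Fin k → M => x i) '' tsupport (f : (Fin k → M) → ℂ),
      isCompact_iUnion fun i => f.2.2.isCompact.image (continuous_apply i), fun K fr hK => ?_⟩
    obtain ⟨J, hJ, u, c, P, hc, hu, hP, hf⟩ := fr.expand f fun x hx i _ =>
      hK (mem_iUnion.2 ⟨i, x, hx, rfl⟩)
    refine ⟨k, ⟨J, hJ, u, c, fun _ i => i.elim0, fun j => List.ofFn (P j), hc, hu,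
      fun _ i => i.elim0, fun j b hb => ?_, fun j => by simp⟩, fun ψ φ => ?_⟩
    · obtain ⟨i, rfl⟩ := (List.mem_ofFn' _ _).1 hb
      exact hP j i
    · have h := integral_series S fr (P := P) hc fun _ => φ
      rw [monomial]
      simp_rw [hf]
      rw [h]
      refine tsum_congr fun j => ?_
      simp [Expansion.mono, List.map_ofFn, List.prod_ofFn]
  | zero => exact ⟨∅, isCompact_empty, fun K fr _ => ⟨0, Expansion.zero fr 0, fun ψ φ => by
      rw [Expansion.eval_zero]; rfl⟩⟩
  | add F G _ _ hF hG =>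
    obtain ⟨K₁, hK₁, h₁⟩ := hF
    obtain ⟨K₂, hK₂, h₂⟩ := hG
    refine ⟨K₁ ∪ K₂, hK₁.union hK₂, fun K fr hK => ?_⟩
    obtain ⟨D, X, hX⟩ := h₁ K fr (subset_union_left.trans hK)
    obtain ⟨D', Y, hY⟩ := h₂ K fr (subset_union_right.trans hK)
    refine ⟨D + D', X.add Y, fun ψ φ => ?_⟩
    rw [Expansion.eval_add, ← hX, ← hY]
    rfl
  | smul a F _ hF =>
    obtain ⟨K₁, hK₁, h₁⟩ := hF
    refine ⟨K₁, hK₁, fun K fr hK => ?_⟩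
    obtain ⟨D, X, hX⟩ := h₁ K fr hK
    refine ⟨D, X.smul a, fun ψ φ => ?_⟩
    rw [Expansion.eval_smul, ← hX]
    rfl

/-- Conversely, series of products of smeared fields are regular polynomials: the terms of degree
`k` sum up to a test function on `M^k`. -/
theorem Expansion.eval_mem {K : Set M} {fr : Frame d K} {D : ℕ} (X : Expansion fr 0 D) :
    (fun φ => X.eval S Fin.elim0 φ) ∈ regularPolynomials S := by
  have := X.countable
  -- The degree of a term.
  let p : X.J → Fin (D + 1) := fun j => ⟨(X.P j).length, Nat.lt_succ_of_le (X.length_le j)⟩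
  have hp : ∀ {k : Fin (D + 1)} (j : {j // p j = k}), (k : ℕ) = (X.P j).length := fun j =>
    (congrArg Fin.val j.2).symm
  let P : ∀ k : Fin (D + 1), {j // p j = k} → Fin k → fr.B := fun k j i =>
    (X.P j).get (Fin.cast (hp j) i)
  have hr : ∀ k : Fin (D + 1), Rapid (fun j : {j // p j = k} => X.u j) fun j => X.c j :=
    fun k N => (X.rapid N).subtype _
  let f : ∀ k : Fin (D + 1), TestPow d M k := fun k =>
    ⟨fun x => ∑' j : {j // p j = k}, X.c j * ∏ i, (fr.e (P k j i) : M → ℂ) (x i),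
      fr.pow_mem (hr k) (fun j => X.one_le j) fun j i => X.P_le j _ (List.get_mem _ _)⟩
  have key : (fun φ => X.eval S Fin.elim0 φ) = ∑ k : Fin (D + 1), monomial S k (f k) := by
    funext φ
    rw [Finset.sum_apply]
    have hs := X.summable_eval S Fin.elim0 φ
    have e : ∀ k : Fin (D + 1), monomial S k (f k) φ = ∑' j : {j // p j = k},
        X.c j * (∏ i, pair S (fr.e (X.Q j i)) (Fin.elim0 i)) * X.mono S j φ := by
      intro k
      refine (integral_series S fr (hr k) fun _ => φ).trans (tsum_congr fun j => ?_)
      have h1 : ∏ i, pair S (fr.e (P k j i)) φ = X.mono S j φ := by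
        rw [Expansion.mono, ← Fin.prod_univ_fun_getElem]
        refine Fintype.prod_equiv (finCongr (hp j)) _ _ fun i => ?_
        rfl
      rw [h1]
      simp
    rw [Expansion.eval, ← (Equiv.sigmaFiberEquiv p).tsum_eq]
    refine ((Equiv.sigmaFiberEquiv p).summable_iff.2 hs).tsum_sigma.trans ?_
    rw [tsum_fintype]
    exact Finset.sum_congr rfl fun k _ => (e k).symm
  rw [key]
  exact Submodule.sum_mem _ fun k _ => Submodule.subset_span ⟨k, f k, rfl⟩

/-! ### Tensor powers of a bi-distribution -/

variable {K : Set M} {fr : Frame d K} (W : BiDistr d M)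

/-- The matrix elements of a bi-distribution in a frame. -/
def matrixElem (fr : Frame d K) (b b' : fr.B) : ℂ := W.toLinear (tensor (fr.e b) (fr.e b'))

theorem exists_prod_matrixElem_bound {n : ℕ} {J : Type} {u : J → ℝ} {P Q : J → Fin n → fr.B}
    (hu : ∀ j, 1 ≤ u j) (hP : ∀ j i, fr.wt (P j i) ≤ u j) (hQ : ∀ j i, fr.wt (Q j i) ≤ u j) :
    ∃ (N : ℕ) (C : ℝ), ∀ j, ‖∏ i, matrixElem W fr (P j i) (Q j i)‖ ≤ C * u j ^ N := by
  obtain ⟨N, C, hC⟩ := fr.bi_bound W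
  refine ⟨2 * N * n, |C| ^ n, fun j => ?_⟩
  have hu0 : 0 ≤ u j := zero_le_one.trans (hu j)
  calc ‖∏ i, matrixElem W fr (P j i) (Q j i)‖ = ∏ i, ‖matrixElem W fr (P j i) (Q j i)‖ :=
        norm_prod _ _
    _ ≤ ∏ _i : Fin n, |C| * (u j * u j) ^ N := by
        refine Finset.prod_le_prod (fun i _ => norm_nonneg _) fun i _ => (hC _ _).trans ?_
        have h1 := zero_le_one.trans (fr.one_le_wt (P j i))
        have h2 := zero_le_one.trans (fr.one_le_wt (Q j i))
        gcongr
        · exact le_abs_self C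
        · exact hP j i
        · exact hQ j i
    _ = _ := by
        rw [Finset.prod_const, Finset.card_univ, Fintype.card_fin, mul_pow]
        ring

/-- Tensor powers of a bi-distribution can be applied to rapidly convergent series of tensor
products term by term. -/
theorem tensorPow_series {n : ℕ} {J : Type} {u : J → ℝ} {c : J → ℂ} {P Q : J → Fin n → fr.B}
    (hc : Rapid u c) (hu : ∀ j, 1 ≤ u j) (hP : ∀ j i, fr.wt (P j i) ≤ u j)
    (hQ : ∀ j i, fr.wt (Q j i) ≤ u j) :
    tensorPow W n (fun x y => ∑' j, c j * ((∏ i, (fr.e (P j i) : M → ℂ) (x i)) *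
      ∏ i, (fr.e (Q j i) : M → ℂ) (y i))) =
      ∑' j, c j * ∏ i, matrixElem W fr (P j i) (Q j i) := by
  have hu0 : ∀ j, 0 ≤ u j := fun j => zero_le_one.trans (hu j)
  induction n generalizing c with
  | zero => simp [tensorPow]
  | succ n ih =>
    obtain ⟨N, C, hC⟩ := exists_prod_matrixElem_bound W (P := fun j (i : Fin n) => P j i.succ)
      (Q := fun j (i : Fin n) => Q j i.succ) hu (fun j i => hP j _) (fun j i => hQ j _)
    obtain ⟨hmem, hsum⟩ := fr.bi_sum (hc.mul_bound hu0 hC) hu (fun j => hP j 0) fun j => hQ j 0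
    have e : (fun p : M × M => tensorPow W n fun x y => ∑' j, c j *
        ((∏ i, (fr.e (P j i) : M → ℂ) ((Fin.cons p.1 x : Fin (n + 1) → M) i)) *
          ∏ i, (fr.e (Q j i) : M → ℂ) ((Fin.cons p.2 y : Fin (n + 1) → M) i))) =
        fun p => ∑' j, (c j * ∏ i : Fin n, matrixElem W fr (P j i.succ) (Q j i.succ)) *
          ((fr.e (P j 0) : M → ℂ) p.1 * (fr.e (Q j 0) : M → ℂ) p.2) := by
      funext p
      have hb : ∀ j, ‖(fr.e (P j 0) : M → ℂ) p.1 * (fr.e (Q j 0) : M → ℂ) p.2‖ ≤ 1 := fun j => by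
        rw [norm_mul]
        exact mul_le_one₀ (fr.norm_le _ _) (norm_nonneg _) (fr.norm_le _ _)
      have h := ih (P := fun j (i : Fin n) => P j i.succ) (Q := fun j (i : Fin n) => Q j i.succ)
        (hc.mul_bounded hu0 hb) (fun j i => hP j _) (fun j i => hQ j _)
      refine Eq.trans ?_ (h.trans (tsum_congr fun j => by ring))
      congr 1
      funext x y
      refine tsum_congr fun j => ?_
      simp only [Fin.prod_univ_succ, Fin.cons_zero, Fin.cons_succ]
      ring
    rw [tensorPow, e, W.eval_of_mem hmem, ← (hsum W).tsum_eq]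
    refine tsum_congr fun j => ?_
    rw [Fin.prod_univ_succ, matrixElem]
    ring

/-! ### The star product of regular polynomials -/

/-- The contribution of order `n` to the star product, as a series of products of smeared fields. -/
def Expansion.contract {n D D' : ℕ} (X : Expansion fr n D) (Y : Expansion fr n D') :
    Expansion fr 0 (D + D') where
  J := X.J × Y.J
  countable := by have := X.countable; have := Y.countable; infer_instance
  u q := X.u q.1 * Y.u q.2
  c q := X.c q.1 * Y.c q.2 * ∏ i, matrixElem W fr (X.Q q.1 i) (Y.Q q.2 i)
  Q _ i := i.elim0
  P q := X.P q.1 ++ Y.P q.2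
  rapid := by
    have h1 : ∀ q : X.J × Y.J, 1 ≤ X.u q.1 * Y.u q.2 := fun q =>
      one_le_mul_of_one_le_of_one_le (X.one_le _) (Y.one_le _)
    obtain ⟨N, C, hC⟩ := exists_prod_matrixElem_bound W (P := fun (q : X.J × Y.J) => X.Q q.1)
      (Q := fun q => Y.Q q.2) h1
      (fun q i => (X.Q_le q.1 i).trans (le_mul_of_one_le_right (X.u_nonneg _) (Y.one_le _)))
      (fun q i => (Y.Q_le q.2 i).trans (le_mul_of_one_le_left (Y.u_nonneg _) (X.one_le _)))
    exact (X.rapid.prod Y.rapid X.u_nonneg Y.u_nonneg).mul_bound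
      (fun q => zero_le_one.trans (h1 q)) hC
  one_le q := one_le_mul_of_one_le_of_one_le (X.one_le _) (Y.one_le _)
  Q_le _ i := i.elim0
  P_le q b hb := by
    rcases List.mem_append.1 hb with h | h
    · exact (X.P_le q.1 b h).trans (le_mul_of_one_le_right (X.u_nonneg _) (Y.one_le _))
    · exact (Y.P_le q.2 b h).trans (le_mul_of_one_le_left (Y.u_nonneg _) (X.one_le _))
  length_le q := by
    have h1 := X.length_le q.1
    have h2 := Y.length_le q.2
    rw [List.length_append]
    omega

/-- The pairing of `W^{⊗ n}` with two kernels is computed by contraction. -/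
theorem Expansion.tensorPow_kernel {n D D' : ℕ} (X : Expansion fr n D) (Y : Expansion fr n D')
    (ψ : Fin 0 → Config d M) (φ : Config d M) :
    tensorPow W n (fun x y => (X.kernel S φ : (Fin n → M) → ℂ) x *
      (Y.kernel S φ : (Fin n → M) → ℂ) y) = (X.contract W Y).eval S ψ φ := by
  have h1 : ∀ q : X.J × Y.J, 1 ≤ X.u q.1 * Y.u q.2 := fun q =>
    one_le_mul_of_one_le_of_one_le (X.one_le _) (Y.one_le _)
  have h := tensorPow_series W (P := fun (q : X.J × Y.J) => X.Q q.1) (Q := fun q => Y.Q q.2)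
    ((X.rapid_mono S φ).prod (Y.rapid_mono S φ) X.u_nonneg Y.u_nonneg) h1
    (fun q i => (X.Q_le q.1 i).trans (le_mul_of_one_le_right (X.u_nonneg _) (Y.one_le _)))
    (fun q i => (Y.Q_le q.2 i).trans (le_mul_of_one_le_left (Y.u_nonneg _) (X.one_le _)))
  refine Eq.trans ?_ (h.trans (tsum_congr fun q => ?_))
  · congr 1
    funext x y
    have hs : ∀ {n D : ℕ} (X : Expansion fr n D) (x : Fin n → M), Summable fun j =>
        ‖X.c j * X.mono S j φ * ∏ i, (fr.e (X.Q j i) : M → ℂ) (x i)‖ := fun X x =>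
      ((X.rapid_mono S φ).mul_bounded X.u_nonneg (C := 1) fun j => by
        rw [norm_prod]
        exact Finset.prod_le_one (fun i _ => norm_nonneg _) fun i _ =>
          fr.norm_le _ _).summable_norm
    refine (tsum_mul_tsum_of_summable_norm (hs X x) (hs Y y)).trans (tsum_congr fun q => ?_)
    ring
  · have : (X.contract W Y).mono S q φ = X.mono S q.1 φ * Y.mono S q.2 φ := by
      simp only [Expansion.mono, Expansion.contract, List.map_append, List.prod_append]
    rw [this]
    simp only [Expansion.contract, Finset.univ_eq_empty, Finset.prod_empty]
    ring

theorem exists_common_expansion {F G : Config d M → ℂ} (hF : F ∈ regularPolynomials S)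
    (hG : G ∈ regularPolynomials S) : ∃ (K : Set M) (fr : Frame d K) (D D' : ℕ)
      (X : Expansion fr 0 D) (Y : Expansion fr 0 D'), (∀ ψ φ, F φ = X.eval S ψ φ) ∧
      ∀ ψ φ, G φ = Y.eval S ψ φ := by
  obtain ⟨K₁, hK₁, h₁⟩ := exists_expansion S hF
  obtain ⟨K₂, hK₂, h₂⟩ := exists_expansion S hG
  obtain ⟨A⟩ := exists_bumpCover (d := d) (hK₁.union hK₂)
  obtain ⟨D, X, hX⟩ := h₁ _ A.frame subset_union_left
  obtain ⟨D', Y, hY⟩ := h₂ _ A.frame subset_union_right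
  exact ⟨_, A.frame, D, D', X, Y, hX, hY⟩

/-- The star product is a finite sum: derivatives of order larger than the degree vanish. -/
theorem starProd_eq_sum {F G : Config d M → ℂ} {D D' : ℕ} {X : Expansion fr 0 D}
    {Y : Expansion fr 0 D'} (hX : ∀ ψ φ, F φ = X.eval S ψ φ) (hY : ∀ ψ φ, G φ = Y.eval S ψ φ)
    (φ : Config d M) : starProd S W F G φ = ∑ n ∈ Finset.range (D + 1),
      (1 / (n.factorial : ℂ)) * ((X.iter n).contract W (Y.iter n)).eval S Fin.elim0 φ := by
  rw [starProd, tsum_eq_sum (s := Finset.range (D + 1))]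
  · refine Finset.sum_congr rfl fun n _ => ?_
    rw [Expansion.derivKernel_eq_kernel S hX, Expansion.derivKernel_eq_kernel S hY,
      Expansion.tensorPow_kernel]
  · intro n hn
    have hn' : D < n := by simpa using hn
    rw [Expansion.derivKernel_eq_kernel S hX, Expansion.derivKernel_eq_kernel S hY,
      Expansion.tensorPow_kernel S W _ _ Fin.elim0]
    have := (X.iter n).isEmpty_of_lt hn'
    have : IsEmpty ((X.iter n).contract W (Y.iter n)).J :=
      inferInstanceAs (IsEmpty ((X.iter n).J × (Y.iter n).J))
    rw [Expansion.eval, tsum_empty, mul_zero]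

/-- Regular polynomials are closed under the star product. -/
theorem starProd_mem {F G : Config d M → ℂ} (hF : F ∈ regularPolynomials S)
    (hG : G ∈ regularPolynomials S) : starProd S W F G ∈ regularPolynomials S := by
  obtain ⟨K, fr, D, D', X, Y, hX, hY⟩ := exists_common_expansion S hF hG
  have : starProd S W F G = ∑ n ∈ Finset.range (D + 1), (1 / (n.factorial : ℂ)) •
      fun φ => ((X.iter n).contract W (Y.iter n)).eval S Fin.elim0 φ := by
    funext φ
    rw [starProd_eq_sum S W hX hY, Finset.sum_apply]
    rfl
  rw [this]
  exact Submodule.sum_mem _ fun n _ => Submodule.smul_mem _ _ (Expansion.eval_mem S _)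

end Star

/-! ### Positivity -/

section Positivity

variable {d : ℕ} {M : Type*} [TopologicalSpace M] [ChartedSpace (Coord d) M]
  [IsManifold 𝓘(ℝ, Coord d) ∞ M]

/-- The sesquilinear form `(f, g) ↦ W(f̄ ⊗ g)`. -/
def sesqForm (W : BiDistr d M) : Test d M →ₗ⋆[ℂ] Test d M →ₗ[ℂ] ℂ :=
  LinearMap.mk₂'ₛₗ (starRingEnd ℂ) (RingHom.id ℂ)
    (fun f g => W.toLinear (tensor (testConj f) g))
    (fun f f' g => by
      rw [← map_add]
      congr 1
      refine Subtype.ext (funext fun p => ?_)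
      simp [tensor, testConj, add_mul])
    (fun c f g => by
      rw [smul_eq_mul, ← smul_eq_mul, ← map_smul]
      congr 1
      refine Subtype.ext (funext fun p => ?_)
      simp [tensor, testConj, mul_assoc])
    (fun f g g' => by
      rw [← map_add]
      congr 1
      refine Subtype.ext (funext fun p => ?_)
      simp [tensor, testConj, mul_add])
    (fun c f g => by
      rw [RingHom.id_apply, ← map_smul]
      congr 1
      refine Subtype.ext (funext fun p => ?_)
      simp only [tensor, testConj, Submodule.coe_smul, Pi.smul_apply, smul_eq_mul]
      ring)

theorem sesqForm_apply (W : BiDistr d M) (f g : Test d M) :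
    sesqForm W f g = W.toLinear (tensor (testConj f) g) := rfl

/-- A sesquilinear form with nonnegative diagonal is Hermitian, by polarization. -/
theorem conj_sesqForm {W : BiDistr d M} (hW : ∀ f, 0 ≤ W.toLinear (tensor (testConj f) f))
    (f g : Test d M) : (starRingEnd ℂ) (sesqForm W g f) = sesqForm W f g := by
  have him : ∀ f, (sesqForm W f f).im = 0 := fun f => ((Complex.nonneg_iff.1 (hW f)).2).symm
  have h1 := him (f + g)
  have h2 := him (f + Complex.I • g)
  simp only [map_add, LinearMap.add_apply, map_smulₛₗ, LinearMap.smul_apply, smul_eq_mul,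
    Complex.conj_I, Complex.add_im, Complex.mul_im, Complex.neg_re, Complex.neg_im, Complex.I_re,
    Complex.I_im, RingHom.id_apply, Complex.mul_re, Complex.add_re, mul_zero, him f, him g] at h1 h2
  apply Complex.ext
  · rw [Complex.conj_re]
    linarith
  · rw [Complex.conj_im]
    linarith

theorem posSemidef_sesqForm {W : BiDistr d M} (hW : ∀ f, 0 ≤ W.toLinear (tensor (testConj f) f))
    {ι : Type*} [Fintype ι] (g : ι → Test d M) :
    (Matrix.of fun a b => sesqForm W (g a) (g b)).PosSemidef := by
  refine Matrix.PosSemidef.of_dotProduct_mulVec_nonneg (Matrix.ext fun a b => ?_) fun x => ?_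
  · exact conj_sesqForm hW _ _
  · refine (hW (∑ a, x a • g a)).trans_eq ?_
    rw [← sesqForm_apply]
    simp only [map_sum, LinearMap.sum_apply, map_smulₛₗ, LinearMap.smul_apply, smul_eq_mul,
      dotProduct, Matrix.mulVec, Matrix.of_apply, Pi.star_apply, Finset.mul_sum, RingHom.id_apply]
    rw [Finset.sum_comm]
    refine Finset.sum_congr rfl fun a _ => Finset.sum_congr rfl fun b _ => ?_
    rw [← starRingEnd_apply]
    ring

/-- Entrywise products of positive semidefinite matrices are positive semidefinite; the empty product
is the matrix of ones, of rank at most one. -/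
theorem _root_.Matrix.PosSemidef.finset_prod {ι κ : Type*} (s : Finset κ)
    {A : κ → Matrix ι ι ℂ} (hA : ∀ k ∈ s, (A k).PosSemidef) :
    (Matrix.of fun a b => ∏ k ∈ s, A k a b).PosSemidef := by
  classical
  induction s using Finset.induction_on with
  | empty =>
    refine ⟨Matrix.ext fun a b => by simp, fun x => ?_⟩
    have : (x.sum fun i xi => x.sum fun j xj => star xi *
        (Matrix.of fun a b : ι => ∏ k ∈ (∅ : Finset κ), A k a b) i j * xj) =
        star (x.sum fun _ a => a) * x.sum fun _ a => a := by
      simp only [Finsupp.sum, Finset.prod_empty, Matrix.of_apply, mul_one, star_sum,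
        Finset.sum_mul_sum]
    rw [this]
    exact star_mul_self_nonneg _
  | insert k s hk ih =>
    have h := (hA k (Finset.mem_insert_self _ _)).hadamard
      (ih fun l hl => hA l (Finset.mem_insert_of_mem hl))
    have e : (Matrix.of fun a b => ∏ l ∈ insert k s, A l a b) =
        (A k).hadamard (Matrix.of fun a b => ∏ l ∈ s, A l a b) := by
      ext a b
      simp [Finset.prod_insert hk, Matrix.hadamard]
    rw [e]
    exact h

/-- Double series whose finite square sections are nonnegative are nonnegative. -/
theorem tsum_prod_nonneg {J : Type*} {f : J × J → ℂ} (hf : Summable f)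
    (h : ∀ s : Finset J, 0 ≤ ∑ j ∈ s, ∑ j' ∈ s, f (j, j')) : 0 ≤ ∑' q, f q := by
  have ht : Filter.Tendsto (fun s : Finset J => s ×ˢ s) Filter.atTop Filter.atTop := by
    refine Filter.tendsto_atTop_finset_of_monotone
      (fun s t hst => Finset.product_subset_product hst hst) fun q => ?_
    classical
    exact ⟨{q.1, q.2}, by simp⟩
  refine ge_of_tendsto' (hf.hasSum.comp ht) fun s => ?_
  simpa only [Function.comp_apply, Finset.sum_product] using h s

variable [T2Space M] [SecondCountableTopology M] [MeasurableSpace M] [BorelSpace M]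

/-- The tensor powers of a bi-distribution of positive type are of positive type: in a frame, this
is the Schur product theorem. -/
theorem tensorPow_conj_nonneg {K : Set M} {fr : Frame d K} {W : BiDistr d M}
    (hW : ∀ f, 0 ≤ W.toLinear (tensor (testConj f) f)) {n : ℕ} {J : Type} {u : J → ℝ} {c : J → ℂ}
    {P : J → Fin n → fr.B} (hc : Rapid u c) (hu : ∀ j, 1 ≤ u j) (hP : ∀ j i, fr.wt (P j i) ≤ u j) :
    0 ≤ tensorPow W n (fun x y =>
      (starRingEnd ℂ) (∑' j, c j * ∏ i, (fr.e (P j i) : M → ℂ) (x i)) *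
        ∑' j, c j * ∏ i, (fr.e (P j i) : M → ℂ) (y i)) := by
  have hu0 : ∀ j, 0 ≤ u j := fun j => zero_le_one.trans (hu j)
  have h1 : ∀ q : J × J, 1 ≤ u q.1 * u q.2 := fun q => one_le_mul_of_one_le_of_one_le (hu _) (hu _)
  have hP1 : ∀ (q : J × J) i, fr.wt (fr.conj (P q.1 i)) ≤ u q.1 * u q.2 := fun q i => by
    rw [fr.wt_conj]
    exact (hP q.1 i).trans (le_mul_of_one_le_right (hu0 _) (hu _))
  have hP2 : ∀ (q : J × J) i, fr.wt (P q.2 i) ≤ u q.1 * u q.2 := fun q i =>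
    (hP q.2 i).trans (le_mul_of_one_le_left (hu0 _) (hu _))
  have hr := hc.star.prod hc hu0 hu0
  have hser := tensorPow_series W (P := fun (q : J × J) i => fr.conj (P q.1 i))
    (Q := fun q => P q.2) hr h1 hP1 hP2
  have hconj : ∀ b x, (fr.e (fr.conj b) : M → ℂ) x = (starRingEnd ℂ) ((fr.e b : M → ℂ) x) :=
    fun b x => by rw [fr.e_conj]; rfl
  have hs : ∀ x : Fin n → M, Summable fun j => ‖c j * ∏ i, (fr.e (P j i) : M → ℂ) (x i)‖ :=
    fun x => (hc.mul_bounded hu0 (C := 1) fun j => by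
      rw [norm_prod]
      exact Finset.prod_le_one (fun i _ => norm_nonneg _) fun i _ => fr.norm_le _ _).summable_norm
  have e : ∀ x y : Fin n → M,
      (starRingEnd ℂ) (∑' j, c j * ∏ i, (fr.e (P j i) : M → ℂ) (x i)) *
        ∑' j, c j * ∏ i, (fr.e (P j i) : M → ℂ) (y i) =
      ∑' q : J × J, (starRingEnd ℂ) (c q.1) * c q.2 *
        ((∏ i, (fr.e (fr.conj (P q.1 i)) : M → ℂ) (x i)) *
          ∏ i, (fr.e (P q.2 i) : M → ℂ) (y i)) := by
    intro x y
    rw [Complex.conj_tsum, tsum_mul_tsum_of_summable_norm (by simpa using hs x) (hs y)]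
    refine tsum_congr fun q => ?_
    simp only [hconj, map_mul, map_prod]
    ring
  simp_rw [e]
  rw [hser]
  have hm : ∀ b b' : fr.B, matrixElem W fr (fr.conj b) b' = sesqForm W (fr.e b) (fr.e b') :=
    fun b b' => by rw [matrixElem, fr.e_conj, sesqForm_apply]
  obtain ⟨N, C, hC⟩ := exists_prod_matrixElem_bound W h1 hP1 hP2
  refine tsum_prod_nonneg
    ((hr.mul_bound (fun q => zero_le_one.trans (h1 q)) hC).summable_norm.of_norm) fun s => ?_
  have hpsd := Matrix.PosSemidef.finset_prod (ι := s) (Finset.univ : Finset (Fin n))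
    (A := fun i => Matrix.of fun j j' : s => sesqForm W (fr.e (P j i)) (fr.e (P j' i)))
    fun i _ => posSemidef_sesqForm hW fun j : s => fr.e (P j i)
  refine (hpsd.dotProduct_mulVec_nonneg fun j : s => c j).trans_eq ?_
  simp only [dotProduct, Matrix.mulVec, Matrix.of_apply, Pi.star_apply, Finset.mul_sum]
  rw [← Finset.sum_coe_sort s]
  refine Finset.sum_congr rfl fun j _ => ?_
  rw [← Finset.sum_coe_sort s]
  refine Finset.sum_congr rfl fun j' _ => ?_
  simp only [hm, starRingEnd_apply]
  ring

variable (S : Spacetime d M)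

theorem iterDeriv_conj (F : Config d M → ℂ) (n : ℕ) (ψ : Fin n → Config d M) (φ : Config d M) :
    iterDeriv (fun φ => (starRingEnd ℂ) (F φ)) n ψ φ = (starRingEnd ℂ) (iterDeriv F n ψ φ) := by
  induction n generalizing φ with
  | zero => rfl
  | succ n ih =>
    simp only [iterDeriv, dirDeriv, ih]
    exact deriv.star

theorem derivKernel_conj {K : Set M} {fr : Frame d K} {D : ℕ} {X : Expansion fr 0 D}
    {F : Config d M → ℂ} (hF : ∀ ψ φ, F φ = X.eval S ψ φ) (n : ℕ) (φ : Config d M) :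
    derivKernel S (fun φ => (starRingEnd ℂ) (F φ)) n φ =
      testConj ((X.iter n).kernel S φ) := by
  refine derivKernel_eq S fun ψ => ?_
  rw [iterDeriv_conj, Expansion.iterDeriv_eq S hF, ← Expansion.integral_kernel, ← integral_conj]
  refine integral_congr_ae (Filter.Eventually.of_forall fun x => ?_)
  simp [testConj, map_prod]

/-- Evaluation of `F* ⋆ F` at any configuration is nonnegative, order by order. -/
theorem starProd_conj_nonneg {W : BiDistr d M}
    (hW : ∀ f, 0 ≤ W.toLinear (tensor (testConj f) f)) {F : Config d M → ℂ}
    (hF : F ∈ regularPolynomials S) (φ : Config d M) :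
    0 ≤ starProd S W (fun φ => (starRingEnd ℂ) (F φ)) F φ := by
  obtain ⟨K, fr, D, _, X, _, hX, _⟩ := exists_common_expansion S hF hF
  refine tsum_nonneg fun n => mul_nonneg ?_ ?_
  · rw [one_div, inv_nonneg]
    exact Nat.cast_nonneg _
  · rw [derivKernel_conj S hX, Expansion.derivKernel_eq_kernel S hX]
    exact tensorPow_conj_nonneg hW ((X.iter n).rapid_mono S φ) (X.iter n).one_le (X.iter n).Q_le

end Positivity

/-! ### Recursion for sums over pairings -/

section Pairings

/-- The permutation exchanging `0` and `j + 1` and acting like `τ` on the remaining indices. -/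
def insertPair {m : ℕ} (j : Fin (m + 1)) (τ : Equiv.Perm (Fin m)) : Equiv.Perm (Fin (m + 2)) where
  toFun := Fin.cons j.succ (j.insertNth (α := fun _ => Fin (m + 2)) 0
    fun k => (j.succAbove (τ k)).succ)
  invFun := Fin.cons j.succ (j.insertNth (α := fun _ => Fin (m + 2)) 0
    fun k => (j.succAbove (τ.symm k)).succ)
  left_inv i := by
    refine Fin.cases (by simp) (fun i => ?_) i
    refine Fin.succAboveCases j (by simp) (fun k => by simp) i
  right_inv i := by
    refine Fin.cases (by simp) (fun i => ?_) i
    refine Fin.succAboveCases j (by simp) (fun k => by simp) i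

variable {m : ℕ}

@[simp] theorem insertPair_zero (j : Fin (m + 1)) (τ : Equiv.Perm (Fin m)) :
    insertPair j τ 0 = j.succ := rfl

@[simp] theorem insertPair_succ_self (j : Fin (m + 1)) (τ : Equiv.Perm (Fin m)) :
    insertPair j τ j.succ = 0 := by simp [insertPair]

@[simp] theorem insertPair_succ_succAbove (j : Fin (m + 1)) (τ : Equiv.Perm (Fin m)) (k : Fin m) :
    insertPair j τ (j.succAbove k).succ = (j.succAbove (τ k)).succ := by simp [insertPair]

theorem mem_pairings {σ : Equiv.Perm (Fin m)} :
    σ ∈ pairings m ↔ ∀ i, σ (σ i) = i ∧ σ i ≠ i := by simp [pairings]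

theorem insertPair_mem_pairings {j : Fin (m + 1)} {τ : Equiv.Perm (Fin m)} (hτ : τ ∈ pairings m) :
    insertPair j τ ∈ pairings (m + 2) := by
  rw [mem_pairings] at hτ ⊢
  refine Fin.cases (by simp [Fin.succ_ne_zero]) (fun i => ?_)
  refine Fin.succAboveCases j (by simp [(Fin.succ_ne_zero j).symm]) (fun k => ?_) i
  simp [(hτ k).1, (hτ k).2]

/-- Every pairing arises by insertion of the pair containing the first index into a pairing of the
remaining indices. -/
theorem exists_insertPair {σ : Equiv.Perm (Fin (m + 2))} (hσ : σ ∈ pairings (m + 2)) :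
    ∃ j, ∃ τ ∈ pairings m, insertPair j τ = σ := by
  rw [mem_pairings] at hσ
  obtain ⟨j, hj⟩ := Fin.exists_succ_eq.2 (hσ 0).2
  have hj' : σ j.succ = 0 := by rw [hj, (hσ 0).1]
  have hex : ∀ k : Fin m, ∃ l : Fin m, (j.succAbove l).succ = σ (j.succAbove k).succ := by
    intro k
    have h0 : σ (j.succAbove k).succ ≠ 0 := by
      rw [← hj']
      exact fun h => Fin.succAbove_ne j k (Fin.succ_injective _ (σ.injective h))
    obtain ⟨i, hi⟩ := Fin.exists_succ_eq.2 h0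
    have hij : i ≠ j := by
      rintro rfl
      rw [hj] at hi
      exact Fin.succ_ne_zero _ (σ.injective hi).symm
    obtain ⟨l, rfl⟩ := Fin.exists_succAbove_eq hij
    exact ⟨l, hi⟩
  choose t ht using hex
  have htt : Function.Involutive t := fun k => by
    have h := ht (t k)
    rw [ht k, (hσ _).1] at h
    exact Fin.succAbove_right_injective (Fin.succ_injective _ h)
  refine ⟨j, htt.toPerm, mem_pairings.2 fun k => ⟨htt k, fun h => ?_⟩, Equiv.ext ?_⟩
  · refine (hσ (j.succAbove k).succ).2 ?_
    rw [← ht k]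
    congr 2
  · refine Fin.cases hj (fun i => ?_)
    refine Fin.succAboveCases j ?_ (fun k => ?_) i
    · rw [insertPair_succ_self, hj']
    · rw [insertPair_succ_succAbove]
      exact ht k

theorem insertPair_injective {j j' : Fin (m + 1)} {τ τ' : Equiv.Perm (Fin m)}
    (h : insertPair j τ = insertPair j' τ') : j = j' ∧ τ = τ' := by
  obtain rfl : j = j' := Fin.succ_injective _ (by simpa using congrArg (· 0) h)
  refine ⟨rfl, Equiv.ext fun k => ?_⟩
  have := congrArg (· (j.succAbove k).succ) h
  simpa using this

theorem prod_insertPair (w : Fin (m + 2) → Fin (m + 2) → ℂ) (j : Fin (m + 1))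
    (τ : Equiv.Perm (Fin m)) :
    ∏ i ∈ Finset.univ.filter (fun i => i < insertPair j τ i), w i (insertPair j τ i) =
      w 0 j.succ * ∏ k ∈ Finset.univ.filter (fun k => k < τ k),
        w (j.succAbove k).succ (j.succAbove (τ k)).succ := by
  rw [Finset.prod_filter, Finset.prod_filter, Fin.prod_univ_succ, Fin.prod_univ_succAbove _ j]
  simp [j.strictMono_succAbove.lt_iff_lt]

/-- Sums over pairings are computed by summing over the partner of the first index. -/
theorem sum_pairings (w : Fin (m + 2) → Fin (m + 2) → ℂ) :
    ∑ σ ∈ pairings (m + 2), ∏ i ∈ Finset.univ.filter (fun i => i < σ i), w i (σ i) =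
      ∑ j : Fin (m + 1), w 0 j.succ * ∑ τ ∈ pairings m, ∏ k ∈ Finset.univ.filter (fun k => k < τ k),
        w (j.succAbove k).succ (j.succAbove (τ k)).succ := by
  simp_rw [Finset.mul_sum]
  rw [← Finset.sum_product']
  refine (Finset.sum_bij (fun q _ => insertPair q.1 q.2) (fun q hq => ?_) (fun q _ q' _ h => ?_)
    (fun σ hσ => ?_) fun q _ => (prod_insertPair w q.1 q.2).symm).symm
  · exact insertPair_mem_pairings (Finset.mem_product.1 hq).2
  · exact Prod.ext (insertPair_injective h).1 (insertPair_injective h).2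
  · obtain ⟨j, τ, hτ, h⟩ := exists_insertPair hσ
    exact ⟨(j, τ), Finset.mem_product.2 ⟨Finset.mem_univ _, hτ⟩, h⟩

theorem pairings_one : pairings 1 = ∅ :=
  Finset.filter_eq_empty_iff.2 fun _ _ h => (h 0).2 (Subsingleton.elim _ _)

end Pairings

/-! ### Products of smeared fields -/

section Fields

variable {d : ℕ} {M : Type*} [TopologicalSpace M] [ChartedSpace (Coord d) M]
  [IsManifold 𝓘(ℝ, Coord d) ∞ M] [T2Space M] [SecondCountableTopology M] [MeasurableSpace M]
  [BorelSpace M] (S : Spacetime d M)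

theorem derivKernel_zero_apply (F : Config d M → ℂ) (φ : Config d M) (x : Fin 0 → M) :
    (derivKernel S F 0 φ : (Fin 0 → M) → ℂ) x = F φ := by
  rw [derivKernel_eq S (k := ⟨fun _ => F φ, contMDiff_const, HasCompactSupport.of_compactSpace _⟩)
    fun ψ => by rw [Measure.pi_of_empty]; simp [iterDeriv]]

theorem integral_toPowOne (f : Test d M) (ψ : Fin 1 → Config d M) :
    ∫ x, (WickAlgebra.toPowOne f : (Fin 1 → M) → ℂ) x * ∏ i, (ψ i (x i) : ℂ)
      ∂(Measure.pi fun _ : Fin 1 => S.vol) = pair S f (ψ 0) := by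
  have h := (measurePreserving_funUnique S.vol (Fin 1)).integral_comp
    (MeasurableEquiv.funUnique (Fin 1) M).measurableEmbedding
    (fun x => (f : M → ℂ) x * (ψ 0 x : ℂ))
  rw [pair, ← h]
  simp [WickAlgebra.toPowOne]
  rfl

/-- The kernel of a first derivative which is a combination of smeared fields. -/
theorem derivKernel_one_eq {ι : Type*} [Fintype ι] {G : Config d M → ℂ} {φ : Config d M}
    {a : ι → ℂ} {g : ι → Test d M} (hG : ∀ ψ, dirDeriv G ψ φ = ∑ i, a i * pair S (g i) ψ) :
    derivKernel S G 1 φ = ∑ i, a i • WickAlgebra.toPowOne (g i) := by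
  refine derivKernel_eq S fun ψ => (hG (ψ 0)).trans ?_
  simp only [AddSubmonoidClass.coe_finsetSum, Finset.sum_apply, Submodule.coe_smul, Pi.smul_apply,
    smul_eq_mul, Finset.sum_mul, mul_assoc]
  rw [integral_finsetSum _ fun i _ =>
    (integrable_testPow_mul S _ (continuous_prod_config ψ)).const_mul _]
  simp_rw [integral_const_mul, integral_toPowOne]

theorem hasDerivAt_pair (f : Test d M) (ψ φ : Config d M) :
    HasDerivAt (fun t : ℝ => pair S f (φ + t • ψ)) (pair S f ψ) 0 := by
  simp only [pair_add_smul]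
  simpa using ((Complex.ofRealCLM.hasDerivAt (x := (0 : ℝ))).mul_const
    (pair S f ψ)).const_add (pair S f φ)

theorem dirDeriv_pair (f : Test d M) (ψ φ : Config d M) :
    dirDeriv (pair S f) ψ φ = pair S f ψ := (hasDerivAt_pair S f ψ φ).deriv

theorem iterDeriv_pair (f : Test d M) (n : ℕ) (ψ : Fin (n + 2) → Config d M) (φ : Config d M) :
    iterDeriv (pair S f) (n + 2) ψ φ = 0 := by
  induction n generalizing φ with
  | zero =>
    have h : iterDeriv (pair S f) 1 (Fin.tail ψ) = fun _ => pair S f (ψ 1) :=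
      funext fun φ => dirDeriv_pair S f _ φ
    rw [iterDeriv, h]
    simp [dirDeriv]
  | succ n ih =>
    rw [iterDeriv, dirDeriv]
    simp [ih]

theorem derivKernel_pair (f : Test d M) (n : ℕ) (φ : Config d M) :
    derivKernel S (pair S f) (n + 2) φ = 0 :=
  derivKernel_eq S fun ψ => by
    rw [iterDeriv_pair]
    simp

variable (W : BiDistr d M)

theorem apply_tensor_sum {ι : Type*} [Fintype ι] (f : Test d M) (a : ι → ℂ) (g : ι → Test d M) :
    W.toLinear (tensor f (∑ i, a i • g i)) = ∑ i, a i * W.toLinear (tensor f (g i)) := by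
  have h : ∀ g, W.toLinear (tensor f g) = sesqForm W (testConj f) g := fun g => by
    rw [sesqForm_apply]
    congr 1
    refine Subtype.ext (funext fun p => ?_)
    simp [tensor, testConj]
  simp only [h, map_sum, map_smul, smul_eq_mul]

/-- The star product of a smeared field with a functional: only the contributions of order zero
and one do not vanish. -/
theorem starProd_pair {ι : Type*} [Fintype ι] (f : Test d M) {G : Config d M → ℂ} {φ : Config d M}
    {a : ι → ℂ} {g : ι → Test d M} (hG : ∀ ψ, dirDeriv G ψ φ = ∑ i, a i * pair S (g i) ψ) :
    starProd S W (pair S f) G φ =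
      pair S f φ * G φ + ∑ i, a i * W.toLinear (tensor f (g i)) := by
  have h0 : ∀ n, tensorPow W n (fun _ _ => 0) = 0 := fun n => by
    induction n with
    | zero => rfl
    | succ n ih =>
      simp only [tensorPow, ih]
      exact (W.eval_of_mem (Submodule.zero_mem _)).trans (map_zero _)
  have h1 : derivKernel S (pair S f) 1 φ = WickAlgebra.toPowOne f := by
    rw [derivKernel_one_eq S (ι := Unit) (a := fun _ => 1) (g := fun _ => f) fun ψ => by
      simp [dirDeriv_pair]]
    simp
  rw [starProd, tsum_eq_sum (s := Finset.range 2)]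
  · rw [Finset.sum_range_succ, Finset.sum_range_one]
    congr 1
    · simp [tensorPow, derivKernel_zero_apply]
    · rw [h1, derivKernel_one_eq S hG, ← apply_tensor_sum, Nat.factorial_one, Nat.cast_one,
        div_one, one_mul, tensorPow, ← W.eval_of_mem (tensor f (∑ i, a i • g i)).2]
      congr 1
      funext p
      simp [tensorPow, tensor, WickAlgebra.toPowOne]
  · intro n hn
    obtain ⟨k, rfl⟩ : ∃ k, n = k + 2 := ⟨n - 2, by simp at hn; omega⟩
    simp only [derivKernel_pair, ZeroMemClass.coe_zero, Pi.zero_apply, zero_mul, h0, mul_zero]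

/-- The `m`-fold star product of smeared fields, by Wick's theorem: the first field is either not
contracted or contracted with one of the others. -/
def wickProd : (m : ℕ) → (Fin m → Test d M) → Config d M → ℂ
  | 0, _, _ => 1
  | 1, f, φ => pair S (f 0) φ
  | m + 2, f, φ => pair S (f 0) φ * wickProd (m + 1) (Fin.tail f) φ +
      ∑ j : Fin (m + 1), wickProd m (Fin.tail f ∘ j.succAbove) φ *
        W.toLinear (tensor (f 0) (f j.succ))

/-- Ordered pairs of distinct indices can be exchanged in sums over successive removals of two
indices. -/
theorem sum_succAbove_comm {m : ℕ} {T : Type*} (g : Fin (m + 2) → T) (X : (Fin m → T) → ℂ)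
    (α β : T → ℂ) :
    ∑ i : Fin (m + 2), ∑ l : Fin (m + 1),
      α (g i) * β (g (i.succAbove l)) * X ((g ∘ i.succAbove) ∘ l.succAbove) =
    ∑ i : Fin (m + 2), ∑ l : Fin (m + 1),
      β (g i) * α (g (i.succAbove l)) * X ((g ∘ i.succAbove) ∘ l.succAbove) := by
  rw [← Finset.sum_product', ← Finset.sum_product']
  refine Finset.sum_nbij' (fun q => (q.1.succAbove q.2, q.2.predAbove q.1))
    (fun q => (q.1.succAbove q.2, q.2.predAbove q.1)) (by simp) (by simp) ?_ ?_ ?_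
  · rintro ⟨i, l⟩ -
    simp [Fin.succAbove_succAbove_predAbove, Fin.predAbove_predAbove_succAbove]
  · rintro ⟨i, l⟩ -
    simp [Fin.succAbove_succAbove_predAbove, Fin.predAbove_predAbove_succAbove]
  · rintro ⟨i, l⟩ -
    have : ((g ∘ (i.succAbove l).succAbove) ∘ (l.predAbove i).succAbove) =
      ((g ∘ i.succAbove) ∘ l.succAbove) := funext fun k => by
        simp [Fin.succAbove_succAbove_succAbove_predAbove]
    simp only [this, Fin.succAbove_succAbove_predAbove]
    ring

/-- Derivatives remove one field at a time. -/
theorem hasDerivAt_wickProd : (m : ℕ) → (f : Fin (m + 1) → Test d M) → (ψ φ : Config d M) →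
    HasDerivAt (fun t : ℝ => wickProd S W (m + 1) f (φ + t • ψ))
      (∑ i, wickProd S W m (f ∘ i.succAbove) φ * pair S (f i) ψ) 0
  | 0, f, ψ, φ => by
    simpa [wickProd] using hasDerivAt_pair S (f 0) ψ φ
  | 1, f, ψ, φ => by
    have h := ((hasDerivAt_pair S (f 0) ψ φ).mul (hasDerivAt_pair S (f 1) ψ φ)).add_const
      (W.toLinear (tensor (f 0) (f 1)))
    convert! h using 1
    · funext t
      simp [wickProd, Fin.tail]
    · simp [wickProd, Fin.sum_univ_two]
      ring
  | m + 2, f, ψ, φ => by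
    have h1 := hasDerivAt_wickProd (m + 1) (Fin.tail f) ψ φ
    have h2 := fun j : Fin (m + 2) => hasDerivAt_wickProd m (Fin.tail f ∘ j.succAbove) ψ φ
    have h := ((hasDerivAt_pair S (f 0) ψ φ).mul h1).add
      (HasDerivAt.fun_sum (u := Finset.univ) fun j _ =>
        (h2 j).mul_const (W.toLinear (tensor (f 0) (f j.succ))))
    convert! h using 1
    have e : ∀ i : Fin (m + 2), Fin.tail (f ∘ i.succ.succAbove) = Fin.tail f ∘ i.succAbove :=
      fun i => funext fun k => by simp [Fin.tail]
    have hc := sum_succAbove_comm (Fin.tail f) (fun g => wickProd S W m g φ)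
      (fun g => pair S g ψ) (fun g => W.toLinear (tensor (f 0) g))
    have e0 : f ∘ Fin.succAbove 0 = Fin.tail f := funext fun k => by simp [Fin.tail]
    have eS : ∀ i : Fin (m + 2), wickProd S W (m + 2) (f ∘ i.succ.succAbove) φ =
        pair S (f 0) φ * wickProd S W (m + 1) (Fin.tail f ∘ i.succAbove) φ +
          ∑ l : Fin (m + 1), wickProd S W m ((Fin.tail f ∘ i.succAbove) ∘ l.succAbove) φ *
            W.toLinear (tensor (f 0) (Fin.tail f (i.succAbove l))) := fun i => by
      rw [wickProd, e]
      simp [Fin.tail]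
    -- The term `i = 0` removes the first field. In the terms in which it is contracted, the contracted
    -- field and the field removed by the derivative are an ordered pair of distinct fields.
    rw [Fin.sum_univ_succ]
    simp only [e0, eS, zero_smul, add_zero, add_mul, Finset.sum_add_distrib, Finset.sum_mul,
      Finset.mul_sum]
    rw [mul_comm, ← add_assoc]
    refine congrArg₂ (· + ·) (congrArg₂ (· + ·) rfl ?_) ?_
    · exact Finset.sum_congr rfl fun i _ => by rw [mul_assoc]; rfl
    · refine Eq.trans ?_ (hc.trans ?_)
      · exact Finset.sum_congr rfl fun i _ => Finset.sum_congr rfl fun l _ => by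
          simp only [Fin.tail]
          ring
      · exact Finset.sum_congr rfl fun i _ => Finset.sum_congr rfl fun l _ => by
          simp only [Fin.tail, Function.comp_apply]
          ring

/-- Wick's theorem for smeared fields. -/
theorem starProd_pair_wickProd : (m : ℕ) → (f : Fin (m + 1) → Test d M) → (φ : Config d M) →
    starProd S W (pair S (f 0)) (wickProd S W m (Fin.tail f)) φ = wickProd S W (m + 1) f φ
  | 0, f, φ => by
    rw [starProd_pair S W (ι := Fin 0) (a := Fin.elim0) (g := Fin.elim0) (f 0) fun ψ => by
      simp [dirDeriv, wickProd]]
    simp [wickProd]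
  | m + 1, f, φ => by
    rw [starProd_pair S W (f 0) fun ψ => (hasDerivAt_wickProd S W m (Fin.tail f) ψ φ).deriv]
    rfl

/-- At the zero configuration only the completely contracted terms survive. -/
theorem wickProd_zero_config : (m : ℕ) → (f : Fin m → Test d M) →
    wickProd S W m f 0 = ∑ σ ∈ pairings m, ∏ i ∈ Finset.univ.filter (fun i => i < σ i),
      W.toLinear (tensor (f i) (f (σ i)))
  | 0, f => by
    have : pairings 0 = Finset.univ :=
      Finset.filter_true_of_mem fun _ _ i => i.elim0
    simp [wickProd, this]
  | 1, f => by
    rw [pairings_one, Finset.sum_empty]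
    exact pair_zero S _
  | m + 2, f => by
    rw [sum_pairings fun i j => W.toLinear (tensor (f i) (f j)), wickProd, pair_zero, zero_mul,
      zero_add]
    refine Finset.sum_congr rfl fun j _ => ?_
    rw [wickProd_zero_config m, mul_comm]
    rfl

namespace WickAlgebra

variable {S W}

theorem toFun_mul (F G : WickAlgebra S W) : (F * G).toFun = starProd S W F.toFun G.toFun := by
  have h : F * G = ⟨starProd S W F.toFun G.toFun, starProd_mem S W F.2 G.2⟩ :=
    dif_pos (starProd_mem S W F.2 G.2)
  rw [h]
  rfl

theorem toFun_prod_field : (m : ℕ) → (f : Fin m → Test d M) →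
    (List.ofFn fun i => field S W (f i)).prod.toFun = wickProd S W m f
  | 0, _ => rfl
  | m + 1, f => by
    have h : (List.ofFn fun i => field S W (f i)).prod =
        field S W (f 0) * (List.ofFn fun i => field S W (Fin.tail f i)).prod := by
      rw [List.ofFn_succ]
      rfl
    rw [h, toFun_mul, toFun_prod_field m]
    exact funext fun φ => starProd_pair_wickProd S W m f φ

variable (S W)

theorem isTwoPointFunction_evalZero : IsTwoPointFunction (evalZero S W) W := fun f g => by
  change (field S W f * field S W g).toFun 0 = _
  rw [toFun_mul]
  refine (starProd_pair S W (ι := Unit) (a := fun _ => 1) (g := fun _ => g) f fun ψ => ?_).trans ?_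
  · rw [Fintype.sum_unique, one_mul]
    exact dirDeriv_pair S g ψ 0
  · simp [pair_zero]

theorem isQuasiFree_evalZero : IsQuasiFree (field S W) (evalZero S W) := fun m f => by
  simp only [isTwoPointFunction_evalZero S W _ _]
  refine Eq.trans ?_ (wickProd_zero_config S W m f)
  exact congrFun (toFun_prod_field m f) 0

theorem isState_evalZero (hW : ∀ f, 0 ≤ W.toLinear (tensor (testConj f) f)) :
    IsState (evalZero S W) := by
  refine ⟨rfl, fun F => ?_⟩
  change 0 ≤ (star F * F).toFun 0
  rw [toFun_mul]
  exact starProd_conj_nonneg S hW F.2 0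

end WickAlgebra

end Fields

end ScalarQFT

end

theorem mainTheorem2 {d : ℕ} {M : Type*} [TopologicalSpace M] [T2Space M]
    [SecondCountableTopology M] [ChartedSpace (ScalarQFT.Coord d) M]
    [IsManifold 𝓘(ℝ, ScalarQFT.Coord d) ∞ M] [MeasurableSpace M] [BorelSpace M]
    (S : ScalarQFT.Spacetime d M) (hS : S.GloballyHyperbolic)
    (V : ScalarQFT.Config d M) (W : ScalarQFT.BiDistr d M)
    (hW : ScalarQFT.IsHadamardFunction S V W) :
    (∀ (F G : ScalarQFT.WickAlgebra S W) (φ : ScalarQFT.Config d M),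
      (F * G).toFun φ = ScalarQFT.starProd S W F.toFun G.toFun φ) ∧
    ScalarQFT.IsState (ScalarQFT.WickAlgebra.evalZero S W) ∧
    ScalarQFT.IsQuasiFree (ScalarQFT.WickAlgebra.field S W)
      (ScalarQFT.WickAlgebra.evalZero S W) ∧
    ScalarQFT.WickAlgebra.IsTwoPointFunction (ScalarQFT.WickAlgebra.evalZero S W) W ∧
    ScalarQFT.WickAlgebra.IsHadamard V (ScalarQFT.WickAlgebra.evalZero S W) :=
  have hstate := ScalarQFT.WickAlgebra.isState_evalZero S W hW.pos
  have htwo := ScalarQFT.WickAlgebra.isTwoPointFunction_evalZero S W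
  ⟨fun F G φ => congrFun (ScalarQFT.WickAlgebra.toFun_mul F G) φ, hstate,
    ScalarQFT.WickAlgebra.isQuasiFree_evalZero S W, htwo, hstate, W, htwo, hW⟩
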